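/- **Theorem.** Let $d\ge 2$ be an integer, let $\varepsilon>0$ be real, and put $k=\lceil d^2/\varepsilon\rceil$. If the Max-Weight Rectangle problem on $N$ weighted points in $d$ dimensions can be solved in time $O(N^{d-\varepsilon})$, then the Max-Weight $k$-Clique problem on weighted graphs with $n$ vertices can be solved in time $O(n^{k-\varepsilon})$. *Max-Weight Rectangle in $d$ dimensions*: given $N\ge 1$ points in $\mathbb{R}^d$ (not necessarily distinct) with real weights of arbitrary sign, output an axis-parallel closed box $\prod_{i=1}^d[a_i,b_i]$, $a_i\le b_i$, that maximizes the total weight of the points it contains. *Max-Weight $k$-Clique*: given a complete graph on $n\ge k$ vertices with real edge weights, output the maximum total edge weight of a $k$-clique. *Model of computation*: deterministic algorithms on the real RAM. One program serves all input sizes $m$ ($m=N$, resp. $m=n$). It works with reals ($+,-,\times,\div$, comparison, unit cost) and with words of $O(\log m)$ bits, used for counting and addressing ($+$, truncated $-$, $\times$, $\div$ with rounding down, comparison, conversion of a word to a real, unit cost), and with arrays of both that are addressed by words. There is no conversion of reals to words. Solvable in time $O(T(m))$ means that some program and some constant $C$ satisfy: on every instance of size $m$ the program halts after at most $C\cdot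 T(m)$ steps with a correct answer. -/

import Mathlib

/-! ### The real RAM

A random access machine with two kinds of data: words (natural numbers of `O(log n)` bits, used
for counting and addressing) and real numbers.  A program can name word registers, real registers,
word arrays and real arrays; it mentions only finitely many of them, and everything that does not
hold input is `0` at the start.  Every operation and every test costs one step. There is no
conversion from reals to words (no floor function). -/

namespace RealRAM

/-- A memory configuration. -/
structure State where
  /-- word registers -/
  w : ℕ → ℕ
  /-- real registers -/
  r : ℕ → ℝ
  /-- word arrays: `wa a i` is entry `i` of array `a` -/
  wa : ℕ → ℕ → ℕ
  /-- real arrays: `ra a i` is entry `i` of array `a` -/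
  ra : ℕ → ℕ → ℝ

/-- The elementary operations. In each of them the first argument `x` of an arithmetic operation is
the target register. -/
inductive Op where
  | skip
  | wconst (x c : ℕ)
  | wmov (x y : ℕ)
  | wadd (x y z : ℕ)
  | wsub (x y z : ℕ)
  | wmul (x y z : ℕ)
  | wdiv (x y z : ℕ)
  | wload (x a y : ℕ)
  | wstore (a y x : ℕ)
  | rcast (x y : ℕ)
  | rmov (x y : ℕ)
  | radd (x y z : ℕ)
  | rsub (x y z : ℕ)
  | rmul (x y z : ℕ)
  | rdiv (x y z : ℕ)
  | rload (x a y : ℕ)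
  | rstore (a y x : ℕ)

/-- Write `v` to word register `x`, provided that `v` is a word, i.e. less than `M`; on overflow
the machine is stuck. -/
def State.setW (M : ℕ) (s : State) (x v : ℕ) : Option State :=
  if v < M then some { s with w := Function.update s.w x v } else none

/-- Write `v` to real register `x`. -/
noncomputable def State.setR (s : State) (x : ℕ) (v : ℝ) : State :=
  { s with r := Function.update s.r x v }

open Classical in
/-- The effect of an operation, where words are the natural numbers less than `M`. The result is
`none` (the machine is stuck) on overflow and on division by zero. Word subtraction is truncated
at `0`, and word division rounds down. -/
noncomputable def Op.run (M : ℕ) (s : State) : Op → Option State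
  | .skip => some s
  | .wconst x c => s.setW M x c
  | .wmov x y => s.setW M x (s.w y)
  | .wadd x y z => s.setW M x (s.w y + s.w z)
  | .wsub x y z => s.setW M x (s.w y - s.w z)
  | .wmul x y z => s.setW M x (s.w y * s.w z)
  | .wdiv x y z => if s.w z = 0 then none else s.setW M x (s.w y / s.w z)
  | .wload x a y => s.setW M x (s.wa a (s.w y))
  | .wstore a y x =>
      some { s with wa := Function.update s.wa a (Function.update (s.wa a) (s.w y) (s.w x)) }
  | .rcast x y => some (s.setR x (s.w y : ℝ))
  | .rmov x y => some (s.setR x (s.r y))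
  | .radd x y z => some (s.setR x (s.r y + s.r z))
  | .rsub x y z => some (s.setR x (s.r y - s.r z))
  | .rmul x y z => some (s.setR x (s.r y * s.r z))
  | .rdiv x y z => if s.r z = 0 then none else some (s.setR x (s.r y / s.r z))
  | .rload x a y => some (s.setR x (s.ra a (s.w y)))
  | .rstore a y x =>
      some { s with ra := Function.update s.ra a (Function.update (s.ra a) (s.w y) (s.r x)) }

/-- The tests: comparison of two word registers or of two real registers. -/
inductive Test where
  | wlt (x y : ℕ)
  | weq (x y : ℕ)
  | rlt (x y : ℕ)
  | req (x y : ℕ)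

/-- The condition expressed by a test. -/
def Test.Holds (s : State) : Test → Prop
  | .wlt x y => s.w x < s.w y
  | .weq x y => s.w x = s.w y
  | .rlt x y => s.r x < s.r y
  | .req x y => s.r x = s.r y

/-- Programs: sequences, branchings and while loops of elementary operations. -/
inductive Prog where
  | op (o : Op)
  | seq (p q : Prog)
  | branch (b : Test) (p q : Prog)
  | loop (b : Test) (p : Prog)

/-- `Exec M p s t s'`: on a machine whose words are the natural numbers less than `M`, program `p`
started in `s` halts in `s'` after exactly `t` steps. -/
inductive Exec (M : ℕ) : Prog → State → ℕ → State → Prop where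
  | op {o : Op} {s s' : State} (h : o.run M s = some s') : Exec M (.op o) s 1 s'
  | seq {p q : Prog} {s s' s'' : State} {t u : ℕ}
      (hp : Exec M p s t s') (hq : Exec M q s' u s'') : Exec M (.seq p q) s (t + u) s''
  | branchTrue {b : Test} {p q : Prog} {s s' : State} {t : ℕ}
      (hb : b.Holds s) (hp : Exec M p s t s') : Exec M (.branch b p q) s (t + 1) s'
  | branchFalse {b : Test} {p q : Prog} {s s' : State} {t : ℕ}
      (hb : ¬ b.Holds s) (hq : Exec M q s t s') : Exec M (.branch b p q) s (t + 1) s'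
  | loopFalse {b : Test} {p : Prog} {s : State}
      (hb : ¬ b.Holds s) : Exec M (.loop b p) s 1 s
  | loopTrue {b : Test} {p : Prog} {s s' s'' : State} {t u : ℕ}
      (hb : b.Holds s) (hp : Exec M p s t s') (hl : Exec M (.loop b p) s' u s'') :
      Exec M (.loop b p) s (t + u + 1) s''

/-- A computational problem: its instances, their size parameter, the initial memory that presents
an instance to the machine, and which final memories hold a correct answer. -/
structure Problem where
  Instance : Type
  size : Instance → ℕ
  input : Instance → State
  Correct : Instance → State → Prop

/-- `P` has an `O(T(n))`-time algorithm: one program and constants `c`, `C` such that on every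
instance of size `n`, with words of at most `c log (n + 2)` bits, the program halts after at most
`C * T n` steps with a correct answer. -/
def SolvableInTime (P : Problem) (T : ℕ → ℝ) : Prop :=
  ∃ (p : Prog) (c : ℕ) (C : ℝ), ∀ I : P.Instance, ∃ (t : ℕ) (s : State),
    Exec ((P.size I + 2) ^ c) p (P.input I) t s ∧ (t : ℝ) ≤ C * T (P.size I) ∧ P.Correct I s

end RealRAM

/-! ### Max-Weight Rectangle -/

/-- `N ≥ 1` points in `ℝ^d` (not necessarily distinct) with real weights. -/
structure WeightedPoints (d : ℕ) where
  N : ℕ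
  pos : 0 < N
  pt : Fin N → Fin d → ℝ
  wt : Fin N → ℝ

open Classical in
/-- The total weight of the points in the closed box `∏ i, [lo i, hi i]`. -/
noncomputable def WeightedPoints.boxWeight {d : ℕ} (I : WeightedPoints d) (lo hi : Fin d → ℝ) : ℝ :=
  ∑ p : Fin I.N with I.pt p ∈ Set.Icc lo hi, I.wt p

/-- Max-Weight Rectangle in `d` dimensions. Input: `N` in word register `0`, the `i`-th coordinates
of the points in real array `i` for `i < d`, the weights in real array `d`. Output: an axis-parallel
box of maximum weight, its lower corner in real registers `0, …, d - 1` and its upper corner in real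
registers `d, …, 2 d - 1`. -/
noncomputable def maxWeightRectangle (d : ℕ) : RealRAM.Problem where
  Instance := WeightedPoints d
  size I := I.N
  input I :=
    { w := fun x => if x = 0 then I.N else 0
      r := fun _ => 0
      wa := fun _ _ => 0
      ra := fun a p =>
        if hp : p < I.N then
          if ha : a < d then I.pt ⟨p, hp⟩ ⟨a, ha⟩ else if a = d then I.wt ⟨p, hp⟩ else 0
        else 0 }
  Correct I s :=
    let lo : Fin d → ℝ := fun i => s.r i
    let hi : Fin d → ℝ := fun i => s.r (d + i)
    lo ≤ hi ∧ ∀ lo' hi' : Fin d → ℝ, lo' ≤ hi' → I.boxWeight lo' hi' ≤ I.boxWeight lo hi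

/-! ### Max-Weight k-Clique -/

/-- A complete graph on `n ≥ k` vertices with real edge weights (diagonal entries of `wt` are not
edges and carry no meaning). -/
structure WeightedGraph (k : ℕ) where
  n : ℕ
  le : k ≤ n
  wt : Fin n → Fin n → ℝ
  symm : ∀ u v, wt u v = wt v u

/-- The total weight of the edges with both ends in `S`, each edge counted once. -/
noncomputable def WeightedGraph.cliqueWeight {k : ℕ} (G : WeightedGraph k) (S : Finset (Fin G.n)) :
    ℝ :=
  ∑ u ∈ S, ∑ v ∈ S with u < v, G.wt u v

/-- Max-Weight `k`-Clique. Input: `n` in word register `0`, the weight matrix row by row in real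
array `0` (the weight of `{u, v}` is in entries `u * n + v` and `v * n + u`). Output: the maximum
weight of a `k`-clique in real register `0`. -/
noncomputable def maxWeightClique (k : ℕ) : RealRAM.Problem where
  Instance := WeightedGraph k
  size G := G.n
  input G :=
    { w := fun x => if x = 0 then G.n else 0
      r := fun _ => 0
      wa := fun _ _ => 0
      ra := fun a i =>
        if a = 0 then
          if h : i < G.n * G.n then
            G.wt (finProdFinEquiv.symm ⟨i, h⟩).1 (finProdFinEquiv.symm ⟨i, h⟩).2
          else 0
        else 0 }
  Correct G s :=
    IsGreatest {x : ℝ | ∃ S : Finset (Fin G.n), S.card = k ∧ G.cliqueWeight S = x} (s.r 0)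

/-! ### Executions: larger words, determinism. -/

namespace RealRAM

/-! Put `β = k/d + 1`. A graph on `n` vertices is turned into `O(n^β)` weighted points whose optimal
box encodes a heaviest `k`-clique. The assumed algorithm then needs time `O(n^(β(d-ε)))`, and
`β(d-ε) = k - ε + (d - kε/d) ≤ k - ε`, because `kε ≥ d²`.

Encoding. A vertex is written with `D` digits in base `b`, where `b` is least with `n ≤ b^D`. A box
around the origin has `2d` sides that move independently, and the position of each side spells a
sequence of digits. A `Table` fixes one side in each dimension and the length of a prefix to be read
there. The positions with prescribed prefixes form a product of half-open intervals; `2^d` points at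
its corners, with weights `±y`, have total weight `y` in the box if the position lies in this
product, and `0` otherwise (`boxSum_corners`). One such gadget for each value of the digits read, at
most `2^d b^U` points for `U` digits, lets a table pay any function of these digits. For each pair
of vertices one table pays `Q` plus the edge weight if the two vertices are in increasing order.
Check tables pay `Q` if two sides agree on the digits that they share. A very heavy point forces the
origin into the box, and `Q` is so large that giving up one payment is never worthwhile. So the
optimal boxes are those that encode heaviest cliques (`Design.total_cases`,
`Design.exists_total_eq`, `isGreatest_of_optimal_box`).

Combinatorial core. What is needed is a `Design` with `U = (k+d)D/d`, so that `b^U` is of order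
`n^β`. Any two vertices must be found in prefixes with at most `U` digits altogether, and checks of
the same size must tie all copies of a digit together, although no table sees both sides of one
dimension. `nonempty_blockDesign` does this for `k ≥ 2d` and `nonempty_headDesign` for `d + 2 ≤ k <
2d`. Smaller `k` do not occur: an algorithm for rectangles has to look at all weights, so `d - ε ≥
1` (`one_le_of_solvable_maxWeightRectangle`) and `k ≥ d²/(d-1) > d + 1`. The same inequality makes
the `O(n^β)` steps for writing the points affordable.

The remaining work is to carry out the reduction as a program on the real RAM
(`Design.exists_prog`). -/

theorem Exec.mono {M M' : ℕ} (hM : M ≤ M') {p : Prog} {s s' : State} {t : ℕ}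
    (h : Exec M p s t s') : Exec M' p s t s' := by
  induction h with
  | @op o s s' h =>
    refine .op ?_
    have key : ∀ x v, s.setW M x v = some s' → s.setW M' x v = some s' := by
      intro x v hv
      unfold State.setW at hv ⊢
      split_ifs at hv with h1
      rw [if_pos (h1.trans_le hM)]; exact hv
    cases o <;> simp only [Op.run] at h ⊢ <;> try first | exact key _ _ h | exact h
    split_ifs at h ⊢ with h0
    exact key _ _ h
  | seq _ _ ih1 ih2 => exact .seq ih1 ih2
  | branchTrue hb _ ih => exact .branchTrue hb ih
  | branchFalse hb _ ih => exact .branchFalse hb ih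
  | loopFalse hb => exact .loopFalse hb
  | loopTrue hb _ _ ih1 ih2 => exact .loopTrue hb ih1 ih2

/-- `SolvableInTime` only asserts that some halting run exists; determinism allows two descriptions
of a run to be identified in the adversary argument. -/
theorem Exec.deterministic {M : ℕ} {p : Prog} {s s₁ s₂ : State} {t₁ t₂ : ℕ}
    (h₁ : Exec M p s t₁ s₁) (h₂ : Exec M p s t₂ s₂) : t₁ = t₂ ∧ s₁ = s₂ := by
  induction h₁ generalizing t₂ s₂ with
  | op h =>
    cases h₂ with
    | op h' => exact ⟨rfl, Option.some.inj (h.symm.trans h')⟩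
  | seq _ _ ih1 ih2 =>
    cases h₂ with
    | seq hp hq =>
      obtain ⟨rfl, rfl⟩ := ih1 hp
      obtain ⟨rfl, rfl⟩ := ih2 hq
      exact ⟨rfl, rfl⟩
  | branchTrue hb _ ih =>
    cases h₂ with
    | branchTrue _ hp => obtain ⟨rfl, rfl⟩ := ih hp; exact ⟨rfl, rfl⟩
    | branchFalse hb' _ => exact absurd hb hb'
  | branchFalse hb _ ih =>
    cases h₂ with
    | branchTrue hb' _ => exact absurd hb' hb
    | branchFalse _ hp => obtain ⟨rfl, rfl⟩ := ih hp; exact ⟨rfl, rfl⟩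
  | loopFalse hb =>
    cases h₂ with
    | loopFalse _ => exact ⟨rfl, rfl⟩
    | loopTrue hb' _ _ => exact absurd hb' hb
  | loopTrue hb _ _ ih1 ih2 =>
    cases h₂ with
    | loopFalse hb' => exact absurd hb hb'
    | loopTrue _ hp hq =>
      obtain ⟨rfl, rfl⟩ := ih1 hp
      obtain ⟨rfl, rfl⟩ := ih2 hq
      exact ⟨rfl, rfl⟩

/-! ### Running a program in a shifted part of the memory -/

/-- Shift all register and array names by `B`. -/
def Op.shift (B : ℕ) : Op → Op
  | .skip => .skip
  | .wconst x c => .wconst (x + B) c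
  | .wmov x y => .wmov (x + B) (y + B)
  | .wadd x y z => .wadd (x + B) (y + B) (z + B)
  | .wsub x y z => .wsub (x + B) (y + B) (z + B)
  | .wmul x y z => .wmul (x + B) (y + B) (z + B)
  | .wdiv x y z => .wdiv (x + B) (y + B) (z + B)
  | .wload x a y => .wload (x + B) (a + B) (y + B)
  | .wstore a y x => .wstore (a + B) (y + B) (x + B)
  | .rcast x y => .rcast (x + B) (y + B)
  | .rmov x y => .rmov (x + B) (y + B)
  | .radd x y z => .radd (x + B) (y + B) (z + B)
  | .rsub x y z => .rsub (x + B) (y + B) (z + B)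
  | .rmul x y z => .rmul (x + B) (y + B) (z + B)
  | .rdiv x y z => .rdiv (x + B) (y + B) (z + B)
  | .rload x a y => .rload (x + B) (a + B) (y + B)
  | .rstore a y x => .rstore (a + B) (y + B) (x + B)

def Test.shift (B : ℕ) : Test → Test
  | .wlt x y => .wlt (x + B) (y + B)
  | .weq x y => .weq (x + B) (y + B)
  | .rlt x y => .rlt (x + B) (y + B)
  | .req x y => .req (x + B) (y + B)

def Prog.shift (B : ℕ) : Prog → Prog
  | .op o => .op (o.shift B)
  | .seq p q => .seq (p.shift B) (q.shift B)
  | .branch b p q => .branch (b.shift B) (p.shift B) (q.shift B)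
  | .loop b p => .loop (b.shift B) (p.shift B)

/-- `f` below `B`, followed by `g`. -/
def splice {α : Type*} (B : ℕ) (f g : ℕ → α) : ℕ → α := fun x => if x < B then f x else g (x - B)

theorem splice_add {α : Type*} (B : ℕ) (f g : ℕ → α) (x : ℕ) : splice B f g (x + B) = g x := by
  simp [splice]

theorem splice_low {α : Type*} {B : ℕ} (f g : ℕ → α) {x : ℕ} (h : x < B) :
    splice B f g x = f x := by
  simp [splice, h]

theorem update_splice {α : Type*} (B : ℕ) (f g : ℕ → α) (x : ℕ) (v : α) :
    Function.update (splice B f g) (x + B) v = splice B f (Function.update g x v) := by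
  funext y
  by_cases h : y < B
  · rw [Function.update_of_ne (by omega), splice_low _ _ h, splice_low _ _ h]
  · obtain ⟨z, rfl⟩ := Nat.exists_eq_add_of_le' (not_lt.1 h)
    by_cases hz : z = x
    · subst hz; simp [splice_add]
    · rw [Function.update_of_ne (by omega), splice_add, splice_add, Function.update_of_ne hz]

/-- The memory that agrees with `S` below `B` and holds a copy of `s` from there on. -/
def State.splice (B : ℕ) (S s : State) : State where
  w := RealRAM.splice B S.w s.w
  r := RealRAM.splice B S.r s.r
  wa := RealRAM.splice B S.wa s.wa
  ra := RealRAM.splice B S.ra s.ra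

theorem Op.run_shift {M B : ℕ} {o : Op} {s s' : State} (h : o.run M s = some s') (S : State) :
    (o.shift B).run M (S.splice B s) = some (S.splice B s') := by
  have key : ∀ x v, s.setW M x v = some s' →
      (S.splice B s).setW M (x + B) v = some (S.splice B s') := by
    intro x v hv
    unfold State.setW at hv ⊢
    split_ifs at hv with h1
    rw [if_pos h1, ← Option.some.inj hv]
    simp [State.splice, update_splice]
  cases o <;> simp only [Op.run, Op.shift] at h ⊢ <;>
    simp only [State.splice, splice_add] at key ⊢
  all_goals try exact key _ _ h
  all_goals try (simp [← Option.some.inj h, State.setR, update_splice])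
  all_goals
    split_ifs at h ⊢ with h0
    first
    | exact key _ _ h
    | simp [← Option.some.inj h, State.setR, update_splice]

theorem Test.holds_shift {B : ℕ} (b : Test) (S s : State) :
    (b.shift B).Holds (S.splice B s) ↔ b.Holds s := by
  cases b <;> simp [Test.shift, Test.Holds, State.splice, splice_add]

/-- This embeds the rectangle program into the reduction: it works on the names from `B` on and
leaves the data below `B` untouched. -/
theorem Exec.shift {M : ℕ} {p : Prog} {s s' : State} {t : ℕ} (h : Exec M p s t s') (B : ℕ)
    (S : State) : Exec M (p.shift B) (S.splice B s) t (S.splice B s') := by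
  induction h with
  | op h => exact .op (Op.run_shift h S)
  | seq _ _ ih1 ih2 => exact .seq ih1 ih2
  | branchTrue hb _ ih => exact .branchTrue ((Test.holds_shift _ _ _).2 hb) ih
  | branchFalse hb _ ih => exact .branchFalse (mt (Test.holds_shift _ _ _).1 hb) ih
  | loopFalse hb => exact .loopFalse (mt (Test.holds_shift _ _ _).1 hb)
  | loopTrue hb _ _ ih1 ih2 => exact .loopTrue ((Test.holds_shift _ _ _).2 hb) ih1 ih2

/-! ### A program reads at most one array entry per step -/

/-- `s` and `s'` differ at most in entry `i` of real array `a`. -/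
def AgreeOff (a i : ℕ) (s s' : State) : Prop :=
  s.w = s'.w ∧ s.r = s'.r ∧ s.wa = s'.wa ∧ ∀ a' i', (a', i') ≠ (a, i) → s.ra a' i' = s'.ra a' i'

/-- The entry `c` is the only one on which the effect depends. Only `rload` reads a real array; for
all other operations `c` is a dummy. -/
theorem Op.run_agreeOff {M : ℕ} {o : Op} {s s' : State} (h : o.run M s = some s') :
    ∃ c : ℕ × ℕ, ∀ a i, (a, i) ≠ c → ∀ s₂, AgreeOff a i s s₂ →
      ∃ s₂', o.run M s₂ = some s₂' ∧ AgreeOff a i s' s₂' := by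
  have key : ∀ (x v a i : ℕ) (s₂ : State), AgreeOff a i s s₂ → s.setW M x v = some s' →
      ∃ s₂', s₂.setW M x v = some s₂' ∧ AgreeOff a i s' s₂' := by
    rintro x v a i s₂ ⟨h1, h2, h3, h4⟩ hv
    unfold State.setW at hv ⊢
    split_ifs at hv with hM
    rw [if_pos hM]
    refine ⟨_, rfl, ?_⟩
    rw [← Option.some.inj hv]
    exact ⟨by simp [h1], h2, h3, h4⟩
  have keyR : ∀ (x a i : ℕ) (v v' : ℝ) (s₂ : State), AgreeOff a i s s₂ → v = v' →
      some (s.setR x v) = some s' →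
      ∃ s₂', some (s₂.setR x v') = some s₂' ∧ AgreeOff a i s' s₂' := by
    rintro x a i v _ s₂ ⟨h1, h2, h3, h4⟩ rfl hv
    refine ⟨_, rfl, ?_⟩
    rw [← Option.some.inj hv]
    exact ⟨h1, by simp [State.setR, h2], h3, h4⟩
  cases o with
  | rload x b y =>
    refine ⟨(b, s.w y), fun a i hai s₂ hs => ?_⟩
    refine keyR _ _ _ _ _ s₂ hs ?_ h
    rw [← hs.1]
    exact hs.2.2.2 _ _ (Ne.symm hai)
  | rstore b y x =>
    refine ⟨(0, 0), fun a i _ s₂ hs => ⟨_, rfl, ?_⟩⟩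
    obtain ⟨h1, h2, h3, h4⟩ := hs
    rw [← Option.some.inj h]
    refine ⟨h1, h2, h3, fun a' i' hne => ?_⟩
    simp only [Function.update_apply, ← h1, ← h2]
    by_cases e1 : a' = b
    · subst e1
      simp only [if_pos, Function.update_apply]
      split_ifs with e2
      · rfl
      · exact h4 _ _ hne
    · simp only [if_neg e1]
      exact h4 _ _ hne
  | wstore b y x =>
    refine ⟨(0, 0), fun a i _ s₂ hs => ⟨_, rfl, ?_⟩⟩
    obtain ⟨h1, h2, h3, h4⟩ := hs
    rw [← Option.some.inj h]
    exact ⟨h1, h2, by simp only [← h1, ← h3], h4⟩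
  | skip =>
    refine ⟨(0, 0), fun a i _ s₂ hs => ⟨_, rfl, ?_⟩⟩
    rw [← Option.some.inj h]; exact hs
  | wdiv x y z =>
    refine ⟨(0, 0), fun a i _ s₂ hs => ?_⟩
    simp only [Op.run, ← hs.1] at h ⊢
    split_ifs at h ⊢ with h0
    exact key _ _ _ _ s₂ hs h
  | rdiv x y z =>
    refine ⟨(0, 0), fun a i _ s₂ hs => ?_⟩
    simp only [Op.run, ← hs.2.1] at h ⊢
    split_ifs at h ⊢ with h0
    exact keyR _ _ _ _ _ s₂ hs rfl h
  | rcast x y =>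
    refine ⟨(0, 0), fun a i _ s₂ hs => keyR _ _ _ _ _ s₂ hs ?_ h⟩
    rw [hs.1]
  | rmov x y =>
    refine ⟨(0, 0), fun a i _ s₂ hs => keyR _ _ _ _ _ s₂ hs ?_ h⟩
    rw [hs.2.1]
  | radd x y z =>
    refine ⟨(0, 0), fun a i _ s₂ hs => keyR _ _ _ _ _ s₂ hs ?_ h⟩
    rw [hs.2.1]
  | rsub x y z =>
    refine ⟨(0, 0), fun a i _ s₂ hs => keyR _ _ _ _ _ s₂ hs ?_ h⟩
    rw [hs.2.1]
  | rmul x y z =>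
    refine ⟨(0, 0), fun a i _ s₂ hs => keyR _ _ _ _ _ s₂ hs ?_ h⟩
    rw [hs.2.1]
  | wconst x c => exact ⟨(0, 0), fun a i _ s₂ hs => key _ _ _ _ s₂ hs h⟩
  | wmov x y =>
    refine ⟨(0, 0), fun a i _ s₂ hs => ?_⟩
    simp only [Op.run, ← hs.1] at h ⊢
    exact key _ _ _ _ s₂ hs h
  | wadd x y z =>
    refine ⟨(0, 0), fun a i _ s₂ hs => ?_⟩
    simp only [Op.run, ← hs.1] at h ⊢
    exact key _ _ _ _ s₂ hs h
  | wsub x y z =>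
    refine ⟨(0, 0), fun a i _ s₂ hs => ?_⟩
    simp only [Op.run, ← hs.1] at h ⊢
    exact key _ _ _ _ s₂ hs h
  | wmul x y z =>
    refine ⟨(0, 0), fun a i _ s₂ hs => ?_⟩
    simp only [Op.run, ← hs.1] at h ⊢
    exact key _ _ _ _ s₂ hs h
  | wload x b y =>
    refine ⟨(0, 0), fun a i _ s₂ hs => ?_⟩
    simp only [Op.run, ← hs.1, ← hs.2.2.1] at h ⊢
    exact key _ _ _ _ s₂ hs h

theorem AgreeOff.holds_iff {a i : ℕ} {s s' : State} (h : AgreeOff a i s s') (b : Test) :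
    b.Holds s ↔ b.Holds s' := by
  cases b <;> simp [Test.Holds, h.1, h.2.1]

theorem Exec.exists_read_set {M : ℕ} {p : Prog} {s s' : State} {t : ℕ} (h : Exec M p s t s') :
    ∃ R : Finset (ℕ × ℕ), R.card ≤ t ∧ ∀ a i, (a, i) ∉ R → ∀ s₂, AgreeOff a i s s₂ →
      ∃ s₂', Exec M p s₂ t s₂' ∧ AgreeOff a i s' s₂' := by
  classical
  induction h with
  | op h =>
    obtain ⟨c, hc⟩ := Op.run_agreeOff h
    refine ⟨{c}, by simp, fun a i hai s₂ hs => ?_⟩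
    obtain ⟨s₂', h1, h2⟩ := hc a i (by simpa using hai) s₂ hs
    exact ⟨s₂', .op h1, h2⟩
  | seq _ _ ih1 ih2 =>
    obtain ⟨R1, c1, h1⟩ := ih1
    obtain ⟨R2, c2, h2⟩ := ih2
    refine ⟨R1 ∪ R2, (Finset.card_union_le _ _).trans (by omega), fun a i hai s₂ hs => ?_⟩
    simp only [Finset.mem_union, not_or] at hai
    obtain ⟨s₃, e1, a1⟩ := h1 a i hai.1 s₂ hs
    obtain ⟨s₄, e2, a2⟩ := h2 a i hai.2 s₃ a1
    exact ⟨s₄, .seq e1 e2, a2⟩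
  | branchTrue hb _ ih =>
    obtain ⟨R1, c1, h1⟩ := ih
    refine ⟨R1, by omega, fun a i hai s₂ hs => ?_⟩
    obtain ⟨s₃, e1, a1⟩ := h1 a i hai s₂ hs
    exact ⟨s₃, .branchTrue ((hs.holds_iff _).1 hb) e1, a1⟩
  | branchFalse hb _ ih =>
    obtain ⟨R1, c1, h1⟩ := ih
    refine ⟨R1, by omega, fun a i hai s₂ hs => ?_⟩
    obtain ⟨s₃, e1, a1⟩ := h1 a i hai s₂ hs
    exact ⟨s₃, .branchFalse (mt (hs.holds_iff _).2 hb) e1, a1⟩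
  | loopFalse hb =>
    exact ⟨∅, by simp, fun a i _ s₂ hs => ⟨s₂, .loopFalse (mt (hs.holds_iff _).2 hb), hs⟩⟩
  | loopTrue hb _ _ ih1 ih2 =>
    obtain ⟨R1, c1, h1⟩ := ih1
    obtain ⟨R2, c2, h2⟩ := ih2
    refine ⟨R1 ∪ R2, (Finset.card_union_le _ _).trans (by omega), fun a i hai s₂ hs => ?_⟩
    simp only [Finset.mem_union, not_or] at hai
    obtain ⟨s₃, e1, a1⟩ := h1 a i hai.1 s₂ hs
    obtain ⟨s₄, e2, a2⟩ := h2 a i hai.2 s₃ a1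
    exact ⟨s₄, .loopTrue ((hs.holds_iff _).1 hb) e1 e2, a2⟩

/-! ### A linear lower bound for Max-Weight Rectangle. -/

/-- `N` points at the origin with weights `f`. -/
def originPoints (d N : ℕ) (hN : 0 < N) (f : Fin N → ℝ) : WeightedPoints d where
  N := N
  pos := hN
  pt _ _ := 0
  wt := f

open Classical in
theorem originPoints_boxWeight (d N : ℕ) (hN : 0 < N) (f : Fin N → ℝ) (lo hi : Fin d → ℝ) :
    (originPoints d N hN f).boxWeight lo hi =
      if (0 : Fin d → ℝ) ∈ Set.Icc lo hi then ∑ p, f p else 0 := by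
  unfold WeightedPoints.boxWeight
  change (∑ p : Fin N with (0 : Fin d → ℝ) ∈ Set.Icc lo hi, f p) = _
  split_ifs with h
  · simp only [h, Finset.filter_true]
  · simp only [h, Finset.filter_false, Finset.sum_empty]

/-- Max-Weight Rectangle cannot be solved in sublinear time. -/
theorem one_le_of_solvable_maxWeightRectangle {d : ℕ} (hd : 0 < d) {α : ℝ}
    (h : SolvableInTime (maxWeightRectangle d) (fun N => (N : ℝ) ^ α)) : 1 ≤ α := by
  classical
  by_contra! hα
  obtain ⟨p, c, C, h⟩ := h
  have hlim : Filter.Tendsto (fun N : ℕ => (N : ℝ) ^ (1 - α)) Filter.atTop Filter.atTop :=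
    (tendsto_rpow_atTop (by linarith)).comp tendsto_natCast_atTop_atTop
  -- For `α < 1` some `N` has `C * N ^ α < N`, so that fewer than `N` steps are made and one of the
  -- `N` weights is never read.
  obtain ⟨N, hN, hN0⟩ := ((hlim.eventually_gt_atTop C).and (Filter.eventually_gt_atTop 0)).exists
  have hNr : (0 : ℝ) < N := by exact_mod_cast hN0
  have hCN : C * (N : ℝ) ^ α < N := by
    have h1 : (N : ℝ) = (N : ℝ) ^ (1 - α) * (N : ℝ) ^ α := by
      rw [← Real.rpow_add hNr]; simp
    calc C * (N : ℝ) ^ α < (N : ℝ) ^ (1 - α) * (N : ℝ) ^ α :=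
          mul_lt_mul_of_pos_right hN (Real.rpow_pos_of_pos hNr _)
      _ = N := h1.symm
  -- If all weights are `-1`, an optimal box misses the origin.
  obtain ⟨t, s, he, ht, hlo, hopt⟩ := h (originPoints d N hN0 fun _ => -1)
  change (t : ℝ) ≤ C * (N : ℝ) ^ α at ht
  have htN : t < N := by exact_mod_cast ht.trans_lt hCN
  obtain ⟨R, hR, hagree⟩ := he.exists_read_set
  obtain ⟨q, hq⟩ : ∃ q : Fin N, (d, (q : ℕ)) ∉ R := by
    by_contra! hall
    have : (Finset.univ.image fun q : Fin N => (d, (q : ℕ))) ⊆ R := by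
      intro x hx
      simp only [Finset.mem_image, Finset.mem_univ, true_and] at hx
      obtain ⟨q, rfl⟩ := hx
      exact hall q
    have hc := Finset.card_le_card this
    rw [Finset.card_image_of_injective _ (fun a b hab => by
      simpa [Fin.ext_iff] using hab), Finset.card_univ, Fintype.card_fin] at hc
    omega
  -- Raising the unread weight to `N` makes the total `N - (N - 1) = 1`, so that now an optimal box
  -- must contain the origin. The program cannot notice the change and returns the same box.
  obtain ⟨t', s', he', -, hlo', hopt'⟩ :=
    h (originPoints d N hN0 (Function.update (fun _ => -1) q (N : ℝ)))
  obtain ⟨s₂, he₂, hs₂⟩ := hagree d q hq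
    ((maxWeightRectangle d).input (originPoints d N hN0 (Function.update (fun _ => -1) q (N : ℝ))))
    ⟨rfl, rfl, rfl, by
      intro a' i' hne
      simp only [maxWeightRectangle, originPoints]
      split_ifs with h1 h2 h3
      · rfl
      · rw [Function.update_of_ne]
        intro hq'
        exact hne (by rw [h3, ← hq'])
      · rfl
      · rfl⟩
  obtain ⟨-, rfl⟩ := he'.deterministic he₂
  have e1 := hopt (fun _ => 1) (fun _ => 1) le_rfl
  have e2 := hopt' 0 0 le_rfl
  rw [originPoints_boxWeight, originPoints_boxWeight] at e1 e2
  rw [← hs₂.2.1] at e2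
  have n1 : (0 : Fin d → ℝ) ∉ Set.Icc (fun _ : Fin d => (1 : ℝ)) (fun _ => 1) := by
    rintro ⟨h1, -⟩
    have := h1 ⟨0, hd⟩
    norm_num at this
  rw [if_neg n1] at e1
  have hsum : ∑ p, Function.update (fun _ : Fin N => (-1 : ℝ)) q (N : ℝ) p = 1 := by
    rw [Finset.sum_update_of_mem (Finset.mem_univ q)]
    simp [Finset.card_sdiff, Nat.cast_sub hN0]
  rw [hsum, if_pos (by simp)] at e2
  split_ifs at e1 e2 with hmem
  · simp at e1; omega
  · norm_num at e2

end RealRAM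

namespace CliqueToRectangle

/-! ### Base-`b` fractions and cells -/

/-- The real number `0.a₀a₁…a_{p-1}` in base `b`, plus `e` units in the last place. -/
noncomputable def pos (b : ℕ) : (ℕ → ℕ) → ℕ → ℝ → ℝ
  | _, 0, e => e
  | a, p + 1, e => (a 0 + pos b (fun i => a (i + 1)) p e) / b

/-- The base-`b` digits of the fractional part of a real number. -/
noncomputable def raw (b : ℕ) : ℝ → ℕ → ℕ
  | x, 0 => ⌊b * x⌋₊
  | x, i + 1 => raw b (b * x - ⌊b * x⌋₊) i

/-- `x` starts with the digits `a₀, …, a_{p-1}`. -/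
def Cell (b : ℕ) (x : ℝ) (a : ℕ → ℕ) (p : ℕ) : Prop := pos b a p 0 ≤ x ∧ x < pos b a p 1

theorem pos_nonneg (b : ℕ) (a : ℕ → ℕ) (p : ℕ) {e : ℝ} (he : 0 ≤ e) : 0 ≤ pos b a p e := by
  induction p generalizing a with
  | zero => exact he
  | succ p ih => have := ih (fun i => a (i + 1)); simp only [pos]; positivity

theorem pos_zero_lt_one {b : ℕ} (hb : 0 < b) (a : ℕ → ℕ) (p : ℕ) : pos b a p 0 < pos b a p 1 := by
  induction p generalizing a with
  | zero => exact zero_lt_one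
  | succ p ih =>
    simp only [pos]
    have := ih (fun i => a (i + 1))
    have hb' : (0 : ℝ) < b := by exact_mod_cast hb
    gcongr

/-- Induction on the length: `x` starts with `a₀, a₁, …` exactly if `b * x - a₀` starts with `a₁,
…`. Hence the prefixes read on a side are determined by its position. -/
theorem cell_iff {b : ℕ} (hb : 0 < b) {x : ℝ} {a : ℕ → ℕ} {p : ℕ} (ha : ∀ i < p, a i < b) :
    Cell b x a p ↔ 0 ≤ x ∧ x < 1 ∧ ∀ i < p, a i = raw b x i := by
  have hb' : (0 : ℝ) < b := by exact_mod_cast hb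
  induction p generalizing a x with
  | zero => simp [Cell, pos]
  | succ p ih =>
    have h1 : Cell b x a (p + 1) ↔ Cell b (b * x - a 0) (fun i => a (i + 1)) p := by
      simp only [Cell, pos, div_le_iff₀ hb', lt_div_iff₀ hb']
      constructor <;> rintro ⟨h1, h2⟩ <;> constructor <;> linarith
    have h2 := ih (x := b * x - a 0) (a := fun i => a (i + 1)) fun i hi => ha (i + 1) (by omega)
    refine h1.trans (h2.trans ?_)
    have hab : (a 0 : ℝ) + 1 ≤ b := by exact_mod_cast ha 0 (by omega)
    have ha0 : (0 : ℝ) ≤ a 0 := Nat.cast_nonneg _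
    constructor
    · rintro ⟨h2, h3, h4⟩
      have hf : ⌊b * x⌋₊ = a 0 := by
        rw [Nat.floor_eq_iff (by linarith)]; constructor <;> linarith
      refine ⟨by by_contra! hx; nlinarith, by by_contra! hx; nlinarith, fun i hi => ?_⟩
      cases i with
      | zero => exact hf.symm
      | succ i => rw [h4 i (by omega), raw, hf]
    · rintro ⟨h2, h3, h4⟩
      have hf : a 0 = ⌊b * x⌋₊ := h4 0 (by omega)
      have h5 := (Nat.floor_eq_iff (mul_nonneg hb'.le h2)).1 hf.symm
      refine ⟨by linarith, by linarith, fun i hi => ?_⟩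
      rw [h4 (i + 1) (by omega), raw, ← hf]

theorem cell_pos {b : ℕ} (hb : 0 < b) {a : ℕ → ℕ} (ha : ∀ i, a i < b) {p q : ℕ} (hpq : p ≤ q) :
    Cell b (pos b a q 0) a p := by
  have h : Cell b (pos b a q 0) a q := ⟨le_rfl, pos_zero_lt_one hb _ _⟩
  rw [cell_iff hb fun i _ => ha i] at h ⊢
  exact ⟨h.1, h.2.1, fun i hi => h.2.2 i (hi.trans_le hpq)⟩

/-! ### Decoding a number into digits -/

/-- Assign the base-`b` digits of `c` to the elements of `l`. -/
def assign (b : ℕ) : List ℕ → ℕ → ℕ → ℕ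
  | [], _ => fun _ => 0
  | δ :: l, c => Function.update (assign b l (c / b)) δ (c % b)

theorem assign_lt {b : ℕ} (hb : 0 < b) (l : List ℕ) (c δ : ℕ) : assign b l c δ < b := by
  induction l generalizing c with
  | nil => exact hb
  | cons γ l ih =>
    simp only [assign, Function.update_apply]
    split_ifs
    · exact Nat.mod_lt _ hb
    · exact ih _

theorem assign_inj {b : ℕ} {l : List ℕ} (hl : l.Nodup) {c c' : ℕ} (hc : c < b ^ l.length)
    (hc' : c' < b ^ l.length) (h : ∀ δ ∈ l, assign b l c δ = assign b l c' δ) : c = c' := by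
  induction l generalizing c c' with
  | nil => simp at hc hc'; omega
  | cons γ l ih =>
    rw [List.nodup_cons] at hl
    rw [List.length_cons, pow_succ] at hc hc'
    have h1 : c % b = c' % b := by simpa [assign] using h γ (by simp)
    have h2 : c / b = c' / b := by
      refine ih hl.2 (Nat.div_lt_of_lt_mul (by rwa [mul_comm])) (Nat.div_lt_of_lt_mul (by rwa [mul_comm])) fun δ hδ => ?_
      have hne : δ ≠ γ := fun e => hl.1 (e ▸ hδ)
      simpa [assign, Function.update_of_ne hne] using h δ (by simp [hδ])
    rw [← Nat.div_add_mod c b, ← Nat.div_add_mod c' b, h1, h2]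

theorem assign_surj {b : ℕ} {l : List ℕ} (hl : l.Nodup) {A : ℕ → ℕ} (hA : ∀ δ, A δ < b) :
    ∃ c < b ^ l.length, ∀ δ ∈ l, assign b l c δ = A δ := by
  induction l with
  | nil => exact ⟨0, by simp, by simp⟩
  | cons γ l ih =>
    rw [List.nodup_cons] at hl
    obtain ⟨c, hc, h⟩ := ih hl.2
    have hb : 0 < b := (Nat.zero_le _).trans_lt (hA 0)
    refine ⟨b * c + A γ, ?_, fun δ hδ => ?_⟩
    · rw [List.length_cons, pow_succ]
      calc b * c + A γ < b * c + b := by have := hA γ; omega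
        _ = (c + 1) * b := by ring
        _ ≤ _ := Nat.mul_le_mul_right _ hc
    · have e1 : (b * c + A γ) / b = c := by
        rw [Nat.mul_add_div hb, Nat.div_eq_of_lt (hA γ), add_zero]
      have e2 : (b * c + A γ) % b = A γ := by
        rw [Nat.mul_add_mod, Nat.mod_eq_of_lt (hA γ)]
      simp only [assign, Function.update_apply, e1, e2]
      split_ifs with hd
      · rw [hd]
      · exact h δ (by simpa [hd] using hδ)

/-- The number with base-`b` digits `A off, …, A (off + D - 1)`, least significant first. -/
def vert (b : ℕ) (A : ℕ → ℕ) : ℕ → ℕ → ℕ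
  | 0, _ => 0
  | D + 1, off => vert b A D (off + 1) * b + A off

theorem vert_congr {b : ℕ} {A A' : ℕ → ℕ} {D off : ℕ} (h : ∀ i < D, A (off + i) = A' (off + i)) :
    vert b A D off = vert b A' D off := by
  induction D generalizing off with
  | zero => rfl
  | succ D ih =>
    simp only [vert]
    have h0 := h 0 (by omega)
    rw [add_zero] at h0
    rw [h0, ih fun i hi => by have := h (i + 1) (by omega); rwa [add_comm i, ← add_assoc] at this]

theorem vert_lt {b : ℕ} {A : ℕ → ℕ} (D off : ℕ) (hA : ∀ i < D, A (off + i) < b) :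
    vert b A D off < b ^ D := by
  induction D generalizing off with
  | zero => simp [vert]
  | succ D ih =>
    simp only [vert]
    have h0 := hA 0 (by omega)
    rw [add_zero] at h0
    have := ih (off + 1) fun i hi => by have := hA (i + 1) (by omega); rwa [add_comm i, ← add_assoc] at this
    calc vert b A D (off + 1) * b + A off < (vert b A D (off + 1) + 1) * b := by rw [add_mul]; omega
      _ ≤ b ^ D * b := Nat.mul_le_mul_right _ this
      _ = _ := (pow_succ _ _).symm

theorem vert_eq {b : ℕ} {A : ℕ → ℕ} {D off x : ℕ} (h : ∀ i < D, A (off + i) = x / b ^ i % b)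
    (hx : x < b ^ D) : vert b A D off = x := by
  induction D generalizing off x with
  | zero => simp at hx; simp [vert, hx]
  | succ D ih =>
    have h0 := h 0 (by omega)
    simp only [add_zero, pow_zero, Nat.div_one] at h0
    have := ih (off := off + 1) (x := x / b) (fun i hi => by
      have := h (i + 1) (by omega)
      rw [add_comm i, ← add_assoc] at this
      rw [this, Nat.div_div_eq_div_mul, add_comm 1 i, pow_succ'])
      (Nat.div_lt_of_lt_mul (by rwa [pow_succ'] at hx))
    rw [vert, this, h0, mul_comm, Nat.div_add_mod]

/-! ### Designs -/

/-- A table chooses a side of the box in each dimension, and a length of the prefix that it reads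
of the digit sequence of that side. -/
structure Table (d : ℕ) where
  side : Fin d → Bool
  pre : Fin d → ℕ

/-- The digits that a table reads. -/
def Table.reads {d : ℕ} (seq : Fin d → Bool → ℕ → ℕ) (τ : Table d) : Finset ℕ :=
  Finset.univ.biUnion fun i => (Finset.range (τ.pre i)).image (seq i (τ.side i))

theorem Table.mem_reads {d : ℕ} {seq : Fin d → Bool → ℕ → ℕ} {τ : Table d} {δ : ℕ} :
    δ ∈ τ.reads seq ↔ ∃ i, ∃ j < τ.pre i, seq i (τ.side i) j = δ := by
  simp [Table.reads]

/-- An encoding of `k` vertices, given by `D` digits each, in the `2 d` sides of a box: digit `i` of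
vertex `v` has the name `v * D + i`, and `seq` lists the digits that a side encodes. -/
structure Design (d k D U : ℕ) where
  seq : Fin d → Bool → ℕ → ℕ
  pairTable : ℕ → ℕ → Table d
  checks : List (Table d)
  card_pair : ∀ u v, u < v → v < k → ((pairTable u v).reads seq).card ≤ U
  card_check : ∀ τ ∈ checks, (τ.reads seq).card ≤ U
  covers_left : ∀ u v, u < v → v < k → ∀ i < D, u * D + i ∈ (pairTable u v).reads seq
  covers_right : ∀ u v, u < v → v < k → ∀ i < D, v * D + i ∈ (pairTable u v).reads seq
  -- Here `rw` stands for the digits spelled by the sides of an arbitrary box, and `A τ` for the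
  -- values under which table `τ` pays. A box may spell different values for two occurrences of one
  -- digit name; the checks have to force a common assignment `A₀` on all pair tables.
  sound : ∀ (rw : Fin d → Bool → ℕ → ℕ) (A : Table d → ℕ → ℕ),
    (∀ τ, (τ ∈ checks ∨ ∃ u v, u < v ∧ v < k ∧ τ = pairTable u v) →
      ∀ i, ∀ j < τ.pre i, A τ (seq i (τ.side i) j) = rw i (τ.side i) j) →
    ∃ A₀ : ℕ → ℕ, ∀ u v, u < v → v < k → ∀ i < D,
      A (pairTable u v) (u * D + i) = A₀ (u * D + i) ∧
      A (pairTable u v) (v * D + i) = A₀ (v * D + i)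

variable {d k D U : ℕ}

/-- A table together with the pair of vertices whose edge weight it contributes, if any. -/
abbrev Item (d : ℕ) := Table d × Option (ℕ × ℕ)

/-- The pairs `u < v < k`. -/
def pairs (k : ℕ) : Finset (ℕ × ℕ) :=
  (Finset.range k ×ˢ Finset.range k).filter fun q => q.1 < q.2

theorem mem_pairs {k : ℕ} {q : ℕ × ℕ} : q ∈ pairs k ↔ q.1 < q.2 ∧ q.2 < k := by
  simp only [pairs, Finset.mem_filter, Finset.mem_product, Finset.mem_range]; omega

noncomputable def Design.items (Δ : Design d k D U) : List (Item d) :=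
  Δ.checks.map (fun τ => (τ, none)) ++
    (pairs k).toList.map (fun q => (Δ.pairTable q.1 q.2, some q))

theorem Design.mem_items {Δ : Design d k D U} {x : Item d} :
    x ∈ Δ.items ↔ (x.1 ∈ Δ.checks ∧ x.2 = none) ∨
      ∃ u v, u < v ∧ v < k ∧ x = (Δ.pairTable u v, some (u, v)) := by
  obtain ⟨τ, o⟩ := x
  simp only [Design.items, List.mem_append, List.mem_map, Finset.mem_toList, mem_pairs,
    Prod.exists, Prod.mk.injEq]
  constructor
  · rintro (⟨τ', h1, rfl, rfl⟩ | ⟨u, v, ⟨h1, h2⟩, rfl, rfl⟩)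
    · exact .inl ⟨h1, rfl⟩
    · exact .inr ⟨u, v, h1, h2, rfl, rfl⟩
  · rintro (⟨h1, rfl⟩ | ⟨u, v, h1, h2, rfl, rfl⟩)
    · exact .inl ⟨τ, h1, rfl, rfl⟩
    · exact .inr ⟨u, v, ⟨h1, h2⟩, rfl, rfl⟩

theorem Design.card_reads {Δ : Design d k D U} {x : Item d} (hx : x ∈ Δ.items) :
    (x.1.reads Δ.seq).card ≤ U := by
  obtain ⟨h, -⟩ | ⟨u, v, h1, h2, rfl⟩ := Design.mem_items.1 hx
  · exact Δ.card_check _ h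
  · exact Δ.card_pair u v h1 h2

/-- The digits that a table reads, as a list. -/
noncomputable def Table.digits (seq : Fin d → Bool → ℕ → ℕ) (τ : Table d) : List ℕ :=
  (τ.reads seq).toList

/-- The weight that an item contributes if it reads the digits `A`; it is `none` if `A` does not
describe a pair of vertices in increasing order. -/
noncomputable def itemValue (D b n : ℕ) (w : ℕ → ℕ → ℝ) (Q : ℝ) (A : ℕ → ℕ) :
    Option (ℕ × ℕ) → Option ℝ
  | none => some Q
  | some (u, v) =>
    if vert b A D (u * D) < vert b A D (v * D) then
      if vert b A D (v * D) < n then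
        some (Q + w (vert b A D (u * D)) (vert b A D (v * D)))
      else none
    else none

/-- The box position `X` lies in the cell of `A`. -/
def InCell (b : ℕ) (seq : Fin d → Bool → ℕ → ℕ) (τ : Table d) (A : ℕ → ℕ) (X : Fin d → Bool → ℝ) :
    Prop :=
  ∀ i, Cell b (X i (τ.side i)) (fun j => A (seq i (τ.side i) j)) (τ.pre i)

open Classical in
/-- The contribution of an item at the box position `X`. -/
noncomputable def itemTotal (seq : Fin d → Bool → ℕ → ℕ) (D b n : ℕ) (w : ℕ → ℕ → ℝ) (Q : ℝ)
    (X : Fin d → Bool → ℝ) (x : Item d) : ℝ :=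
  ((List.range (b ^ (x.1.digits seq).length)).map fun c =>
    if InCell b seq x.1 (assign b (x.1.digits seq) c) X then
      (itemValue D b n w Q (assign b (x.1.digits seq) c) x.2).getD 0 else 0).sum

/-- Two codes whose cells contain `X` agree on every digit that is read, hence are equal by
`assign_inj`. So only one summand survives. -/
theorem itemTotal_of_inCell {seq : Fin d → Bool → ℕ → ℕ} {b n : ℕ} (hb : 0 < b)
    {w : ℕ → ℕ → ℝ} {Q : ℝ} {X : Fin d → Bool → ℝ} {x : Item d} {c : ℕ}
    (hc : c < b ^ (x.1.digits seq).length)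
    (h : InCell b seq x.1 (assign b (x.1.digits seq) c) X) :
    itemTotal seq D b n w Q X x =
      (itemValue D b n w Q (assign b (x.1.digits seq) c) x.2).getD 0 := by
  classical
  unfold itemTotal
  rw [← List.sum_toFinset _ List.nodup_range, Finset.sum_eq_single c]
  · rw [if_pos h]
  · intro c' hc' hne
    rw [if_neg]
    intro h'
    refine hne (assign_inj (Finset.nodup_toList _) (List.mem_range.1 (List.mem_toFinset.1 hc')) hc fun δ hδ => ?_)
    rw [Finset.mem_toList, Table.mem_reads] at hδ
    obtain ⟨i, j, hj, rfl⟩ := hδ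
    have e1 := ((cell_iff hb fun _ _ => assign_lt hb _ _ _).1 (h i)).2.2 j hj
    have e2 := ((cell_iff hb fun _ _ => assign_lt hb _ _ _).1 (h' i)).2.2 j hj
    exact e2.trans e1.symm
  · intro hc'
    simp at hc'
    omega

/-- The assignment `A` depends on the table and not on `o`: one table may occur in several items,
and `Design.sound` expects one assignment per table. -/
theorem itemTotal_cases {seq : Fin d → Bool → ℕ → ℕ} {b : ℕ} (n : ℕ) (hb : 0 < b)
    (w : ℕ → ℕ → ℝ) (Q : ℝ) (X : Fin d → Bool → ℝ) (τ : Table d) :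
    (∀ o, itemTotal seq D b n w Q X (τ, o) = 0) ∨
      ∃ A : ℕ → ℕ, (∀ i, ∀ j < τ.pre i,
          A (seq i (τ.side i) j) = raw b (X i (τ.side i)) j) ∧
        ∀ o, itemTotal seq D b n w Q X (τ, o) = (itemValue D b n w Q A o).getD 0 := by
  classical
  by_cases h : ∃ c < b ^ (τ.digits seq).length, InCell b seq τ (assign b (τ.digits seq) c) X
  · obtain ⟨c, hc, h⟩ := h
    exact .inr ⟨_, fun i => ((cell_iff hb fun _ _ => assign_lt hb _ _ _).1 (h i)).2.2,
      fun o => itemTotal_of_inCell (x := (τ, o)) hb hc h⟩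
  · refine .inl fun o => List.sum_eq_zero fun y hy => ?_
    simp only [List.mem_map, List.mem_range] at hy
    obtain ⟨c, hc, rfl⟩ := hy
    exact if_neg fun h' => h ⟨c, hc, h'⟩

theorem itemValue_congr {b n : ℕ} {w : ℕ → ℕ → ℝ} {Q : ℝ} {A A' : ℕ → ℕ} {u v : ℕ}
    (h1 : ∀ i < D, A (u * D + i) = A' (u * D + i)) (h2 : ∀ i < D, A (v * D + i) = A' (v * D + i)) :
    itemValue D b n w Q A (some (u, v)) = itemValue D b n w Q A' (some (u, v)) := by
  simp only [itemValue]
  rw [vert_congr h1, vert_congr h2]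

theorem itemValue_le {b n : ℕ} {w : ℕ → ℕ → ℝ} {Q S : ℝ} {A : ℕ → ℕ} {o : Option (ℕ × ℕ)} {y : ℝ}
    (hS : 0 ≤ S) (hw : ∀ x y, x < n → y < n → |w x y| ≤ S) (hQ : 0 ≤ Q)
    (h : itemValue D b n w Q A o = some y) : |y| ≤ Q + S := by
  match o with
  | none =>
    obtain rfl : Q = y := by simpa [itemValue] using h
    rw [abs_of_nonneg hQ]; linarith
  | some (u, v) =>
    simp only [itemValue] at h
    split_ifs at h with h1 h2
    rw [← Option.some.inj h]
    refine (abs_add_le _ _).trans ?_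
    rw [abs_of_nonneg hQ]
    have := hw _ _ (h1.trans h2) h2
    linarith

/-- The contribution of all items. -/
noncomputable def Design.total (Δ : Design d k D U) (b n : ℕ) (w : ℕ → ℕ → ℝ) (Q : ℝ)
    (X : Fin d → Bool → ℝ) : ℝ :=
  (Δ.items.map (itemTotal Δ.seq D b n w Q X)).sum

theorem Design.sum_items (Δ : Design d k D U) (Q : ℝ) (g : ℕ × ℕ → ℝ) (F : Item d → ℝ)
    (h1 : ∀ τ ∈ Δ.checks, F (τ, none) = Q)
    (h2 : ∀ u v, u < v → v < k → F (Δ.pairTable u v, some (u, v)) = Q + g (u, v)) :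
    (Δ.items.map F).sum = Δ.items.length * Q + ∑ q ∈ pairs k, g q := by
  unfold Design.items
  rw [List.map_append, List.sum_append, List.map_map, List.map_map, List.length_append,
    List.length_map, List.length_map, Finset.length_toList, Nat.cast_add, Finset.sum_map_toList]
  have e1 : (Δ.checks.map (F ∘ fun τ => (τ, none))) = Δ.checks.map fun _ => Q :=
    List.map_congr_left fun τ hτ => h1 τ hτ
  have e2 : ∑ q ∈ pairs k, (F ∘ fun q : ℕ × ℕ => (Δ.pairTable q.1 q.2, some q)) q =
      ∑ q ∈ pairs k, F (Δ.pairTable q.1 q.2, some (q.1, q.2)) := rfl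
  rw [e1, e2, List.map_const', List.sum_replicate,
    Finset.sum_congr rfl fun q hq => h2 q.1 q.2 (mem_pairs.1 hq).1 (mem_pairs.1 hq).2,
    Finset.sum_add_distrib, Finset.sum_const]
  simp only [nsmul_eq_mul, Prod.mk.eta]
  ring

/-- Either some item contributes nothing, and each of the others at most `Q + S`, or all items
contribute. In the second case soundness yields one assignment `A₀`, whose vertices are increasing
because otherwise a pair table would not pay. -/
theorem Design.total_cases (Δ : Design d k D U) {b n : ℕ} (hb : 0 < b) {w : ℕ → ℕ → ℝ}
    {Q S : ℝ} (hS : 0 ≤ S) (hw : ∀ x y, x < n → y < n → |w x y| ≤ S) (hQ : 0 ≤ Q)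
    (X : Fin d → Bool → ℝ) :
    Δ.total b n w Q X ≤ (Δ.items.length - 1) * (Q + S) ∨
      ∃ f : ℕ → ℕ, (∀ u v, u < v → v < k → f u < f v ∧ f v < n) ∧
        Δ.total b n w Q X = Δ.items.length * Q + ∑ q ∈ pairs k, w (f q.1) (f q.2) := by
  classical
  have hle : ∀ x, itemTotal Δ.seq D b n w Q X x ≤ Q + S := by
    rintro ⟨τ, o⟩
    obtain h0 | ⟨A, -, hA⟩ := itemTotal_cases (D := D) (seq := Δ.seq) n hb w Q X τ
    · rw [h0]; linarith
    · rw [hA]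
      cases hy : itemValue D b n w Q A o with
      | none => simp; linarith
      | some y => exact (le_abs_self y).trans (itemValue_le hS hw hQ hy)
  -- The case distinction is on the contribution, not on its cause; an item whose value happens to
  -- be `0` falls harmlessly into the first case.
  by_cases hz : ∃ x ∈ Δ.items, itemTotal Δ.seq D b n w Q X x = 0
  · left
    obtain ⟨x, hx, h0⟩ := hz
    obtain ⟨l₁, l₂, hl⟩ := List.append_of_mem hx
    have h3 : ∀ l : List (Item d), (l.map (itemTotal Δ.seq D b n w Q X)).sum ≤ l.length * (Q + S) := by
      intro l
      have := List.sum_le_card_nsmul (l.map (itemTotal Δ.seq D b n w Q X)) (Q + S) (by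
        intro y hy
        obtain ⟨x, -, rfl⟩ := List.mem_map.1 hy
        exact hle x)
      simpa only [List.length_map, nsmul_eq_mul] using this
    unfold Design.total
    rw [hl]
    simp only [List.map_append, List.map_cons, List.sum_append, List.sum_cons, h0,
      List.length_append, List.length_cons]
    have := h3 l₁
    have := h3 l₂
    push_cast
    linarith
  · right
    push Not at hz
    have hA : ∀ τ : Table d, ∃ A : ℕ → ℕ,
        (τ ∈ Δ.checks ∨ ∃ u v, u < v ∧ v < k ∧ τ = Δ.pairTable u v) →
        (∀ i, ∀ j < τ.pre i, A (Δ.seq i (τ.side i) j) = raw b (X i (τ.side i)) j) ∧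
        ∀ o, itemTotal Δ.seq D b n w Q X (τ, o) = (itemValue D b n w Q A o).getD 0 := by
      intro τ
      obtain h0 | ⟨A, h1, h2⟩ := itemTotal_cases (D := D) (seq := Δ.seq) n hb w Q X τ
      · refine ⟨0, ?_⟩
        rintro (h | ⟨u, v, h1, h2, rfl⟩)
        · exact absurd (h0 none) (hz _ (Design.mem_items.2 (.inl ⟨h, rfl⟩)))
        · exact absurd (h0 (some (u, v))) (hz _ (Design.mem_items.2 (.inr ⟨u, v, h1, h2, rfl⟩)))
      · exact ⟨A, fun _ => ⟨h1, h2⟩⟩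
    choose A hA using hA
    obtain ⟨A₀, hA₀⟩ := Δ.sound (fun i s => raw b (X i s)) A fun τ hτ => (hA τ hτ).1
    have hval : ∀ u v, u < v → v < k →
        itemTotal Δ.seq D b n w Q X (Δ.pairTable u v, some (u, v)) =
          (itemValue D b n w Q A₀ (some (u, v))).getD 0 := by
      intro u v h1 h2
      rw [(hA _ (.inr ⟨u, v, h1, h2, rfl⟩)).2, itemValue_congr
        (fun i hi => (hA₀ u v h1 h2 i hi).1) (fun i hi => (hA₀ u v h1 h2 i hi).2)]
    have hf : ∀ u v, u < v → v < k → vert b A₀ D (u * D) < vert b A₀ D (v * D) ∧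
        vert b A₀ D (v * D) < n := by
      intro u v h1 h2
      have := hz _ (Design.mem_items.2 (.inr ⟨u, v, h1, h2, rfl⟩))
      rw [hval u v h1 h2] at this
      simp only [itemValue] at this
      split_ifs at this with h3 h4
      · exact ⟨h3, h4⟩
      · simp at this
      · simp at this
    refine ⟨fun u => vert b A₀ D (u * D), hf, ?_⟩
    refine Δ.sum_items Q (fun q => w (vert b A₀ D (q.1 * D)) (vert b A₀ D (q.2 * D))) _ ?_ ?_
    · intro τ hτ
      rw [(hA τ (.inl hτ)).2]; rfl
    · intro u v h1 h2
      rw [hval u v h1 h2]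
      simp [itemValue, hf u v h1 h2]

/-- Let every side spell the true digits of the vertices `f u`. All occurrences of a digit name then
have the same value, so each table finds a cell that fits. -/
theorem Design.exists_total_eq (Δ : Design d k D U) {b n : ℕ} (hb : 0 < b) (hn : n ≤ b ^ D)
    (hD : 0 < D) (w : ℕ → ℕ → ℝ) (Q : ℝ) {f : ℕ → ℕ}
    (hf : ∀ u v, u < v → v < k → f u < f v ∧ f v < n) :
    ∃ X : Fin d → Bool → ℝ, (∀ i s, 0 ≤ X i s) ∧
      Δ.total b n w Q X = Δ.items.length * Q + ∑ q ∈ pairs k, w (f q.1) (f q.2) := by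
  set A : ℕ → ℕ := fun δ => f (δ / D) / b ^ (δ % D) % b with hA
  have hAlt : ∀ δ, A δ < b := fun δ => Nat.mod_lt _ hb
  have hdig : ∀ u, ∀ i < D, A (u * D + i) = f u / b ^ i % b := by
    intro u i hi
    simp only [hA]
    rw [mul_comm u D, Nat.mul_add_div hD, Nat.div_eq_of_lt hi, Nat.mul_add_mod,
      Nat.mod_eq_of_lt hi, add_zero]
  -- Each side spells `P` digits, at least as many as any table reads.
  obtain ⟨P, hP⟩ : ∃ P : ℕ, ∀ x ∈ Δ.items, ∀ i, x.1.pre i ≤ P := by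
    refine ⟨(Δ.items.map fun x => ∑ i, x.1.pre i).sum, fun x hx i => ?_⟩
    exact (Finset.single_le_sum (f := fun i => x.1.pre i) (fun _ _ => Nat.zero_le _)
      (Finset.mem_univ i)).trans (List.single_le_sum (fun _ _ => Nat.zero_le _) _
        (List.mem_map.2 ⟨x, hx, rfl⟩))
  set X : Fin d → Bool → ℝ := fun i s => pos b (fun j => A (Δ.seq i s j)) P 0 with hX
  refine ⟨X, fun i s => pos_nonneg _ _ _ le_rfl, ?_⟩
  have hval : ∀ x ∈ Δ.items, ∃ A' : ℕ → ℕ, (∀ δ ∈ x.1.reads Δ.seq, A' δ = A δ) ∧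
      itemTotal Δ.seq D b n w Q X x = (itemValue D b n w Q A' x.2).getD 0 := by
    intro x hx
    obtain ⟨c, hc, h⟩ := assign_surj (l := x.1.digits Δ.seq) (Finset.nodup_toList _) hAlt
    refine ⟨assign b (x.1.digits Δ.seq) c, fun δ hδ => h δ (Finset.mem_toList.2 hδ),
      itemTotal_of_inCell hb hc fun i => ?_⟩
    have hcell : Cell b (X i (x.1.side i)) (fun j => A (Δ.seq i (x.1.side i) j)) (x.1.pre i) :=
      cell_pos hb (fun _ => hAlt _) (hP x hx i)
    rw [cell_iff hb fun _ _ => hAlt _] at hcell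
    rw [cell_iff hb fun _ _ => assign_lt hb _ _ _]
    refine ⟨hcell.1, hcell.2.1, fun j hj => ?_⟩
    rw [h _ (Finset.mem_toList.2 (Table.mem_reads.2 ⟨i, j, hj, rfl⟩))]
    exact hcell.2.2 j hj
  refine Δ.sum_items Q (fun q => w (f q.1) (f q.2)) _ ?_ ?_
  · intro τ hτ
    obtain ⟨A', -, h⟩ := hval (τ, none) (Design.mem_items.2 (.inl ⟨hτ, rfl⟩))
    rw [h]; rfl
  · intro u v h1 h2
    obtain ⟨A', h3, h⟩ := hval _ (Design.mem_items.2 (.inr ⟨u, v, h1, h2, rfl⟩))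
    obtain ⟨h4, h5⟩ := hf u v h1 h2
    have e1 : vert b A' D (u * D) = f u := vert_eq
      (fun i hi => by rw [h3 _ (Δ.covers_left u v h1 h2 i hi), hdig u i hi]) (by omega)
    have e2 : vert b A' D (v * D) = f v := vert_eq
      (fun i hi => by rw [h3 _ (Δ.covers_right u v h1 h2 i hi), hdig v i hi]) (by omega)
    rw [h]
    simp [itemValue, e1, e2, h4, h5]

/-! ### Weighted points that realize a design -/

abbrev Point (d : ℕ) := (Fin d → ℝ) × ℝ

/-- Coordinate `i` of the corner `E` of the cell of `A`. -/
noncomputable def cornerCoord (seq : Fin d → Bool → ℕ → ℕ) (b : ℕ) (τ : Table d) (A : ℕ → ℕ)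
    (E : Fin d → Bool) (i : Fin d) : ℝ :=
  if τ.side i then
    pos b (fun j => A (seq i (τ.side i) j)) (τ.pre i) (if E i then 1 else 0) + 1
  else 0 - (pos b (fun j => A (seq i (τ.side i) j)) (τ.pre i) (if E i then 1 else 0) + 1)

/-- The corners of positive sign. -/
def EvenCorner (E : Fin d → Bool) : Prop := (∏ i, if E i then (-1 : ℤ) else 1) = 1

open Classical in
noncomputable def cornerWeight (y : ℝ) (E : Fin d → Bool) : ℝ :=
  if EvenCorner E then y else 0 - y

theorem cornerWeight_eq (y : ℝ) (E : Fin d → Bool) :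
    cornerWeight y E = (∏ i, if E i then (-1 : ℝ) else 1) * y := by
  have h1 : (∏ i, if E i then (-1 : ℝ) else 1) = ((∏ i, if E i then (-1 : ℤ) else 1 : ℤ) : ℝ) := by
    push_cast; rfl
  have h2 : (∏ i, if E i then (-1 : ℤ) else 1) = 1 ∨ (∏ i, if E i then (-1 : ℤ) else 1) = -1 := by
    refine Finset.prod_induction _ (fun z : ℤ => z = 1 ∨ z = -1) ?_ (.inl rfl) ?_
    · rintro a b (rfl | rfl) (rfl | rfl) <;> simp
    · intro i _; split_ifs <;> simp
  rw [cornerWeight, EvenCorner, h1]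
  obtain h | h := h2 <;> rw [h] <;> norm_num

theorem abs_cornerWeight (y : ℝ) (E : Fin d → Bool) : |cornerWeight y E| = |y| := by
  unfold cornerWeight; split_ifs <;> simp

noncomputable def corners (seq : Fin d → Bool → ℕ → ℕ) (b : ℕ) (τ : Table d) (A : ℕ → ℕ) (y : ℝ) :
    List (Point d) :=
  (Finset.univ : Finset (Fin d → Bool)).toList.map fun E =>
    (cornerCoord seq b τ A E, cornerWeight y E)

noncomputable def cellPoints (seq : Fin d → Bool → ℕ → ℕ) (D b n : ℕ) (w : ℕ → ℕ → ℝ) (Q : ℝ)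
    (x : Item d) (c : ℕ) : List (Point d) :=
  match itemValue D b n w Q (assign b (x.1.digits seq) c) x.2 with
  | none => []
  | some y => corners seq b x.1 (assign b (x.1.digits seq) c) y

noncomputable def itemPoints (seq : Fin d → Bool → ℕ → ℕ) (D b n : ℕ) (w : ℕ → ℕ → ℝ) (Q : ℝ)
    (x : Item d) : List (Point d) :=
  (List.range (b ^ (x.1.digits seq).length)).flatMap (cellPoints seq D b n w Q x)

noncomputable def Design.points (Δ : Design d k D U) (b n : ℕ) (w : ℕ → ℕ → ℝ) (Q : ℝ) :
    List (Point d) :=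
  Δ.items.flatMap (itemPoints Δ.seq D b n w Q)

open Classical in
/-- The total weight of the points in a box. -/
noncomputable def boxSum (lo hi : Fin d → ℝ) (l : List (Point d)) : ℝ :=
  (l.map fun p => if p.1 ∈ Set.Icc lo hi then p.2 else 0).sum

theorem boxSum_append (lo hi : Fin d → ℝ) (l l' : List (Point d)) :
    boxSum lo hi (l ++ l') = boxSum lo hi l + boxSum lo hi l' := by
  simp [boxSum]

theorem boxSum_flatMap {α : Type*} (lo hi : Fin d → ℝ) (l : List α) (f : α → List (Point d)) :
    boxSum lo hi (l.flatMap f) = (l.map fun a => boxSum lo hi (f a)).sum := by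
  induction l with
  | nil => simp [boxSum]
  | cons a l ih => rw [List.flatMap_cons, boxSum_append, ih, List.map_cons, List.sum_cons]

theorem abs_boxSum_le {lo hi : Fin d → ℝ} {l : List (Point d)} {R : ℝ} (hR : 0 ≤ R)
    (h : ∀ p ∈ l, |p.2| ≤ R) : |boxSum lo hi l| ≤ l.length * R := by
  classical
  induction l with
  | nil => simp [boxSum]
  | cons p l ih =>
    have h1 := ih fun q hq => h q (by simp [hq])
    have h2 := h p (by simp)
    have h3 : |if p.1 ∈ Set.Icc lo hi then p.2 else 0| ≤ R := by split_ifs; exacts [h2, by simpa]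
    simp only [boxSum, List.map_cons, List.sum_cons, List.length_cons] at h1 ⊢
    refine (abs_add_le _ _).trans ?_
    push_cast
    linarith

/-- The box position of the box with corners `lo` and `hi`. -/
def boxPosition (lo hi : Fin d → ℝ) (i : Fin d) (s : Bool) : ℝ :=
  if s then hi i - 1 else 0 - lo i - 1

open Classical in
-- Inclusion–exclusion: the signed sum over the corners factors into the differences `[P i 0 ≤ X] -
-- [P i 1 ≤ X]`, one per dimension, each being the indicator of a half-open interval. Closed boxes
-- thus produce half-open cells, which do not overlap.
theorem boxSum_corners {seq : Fin d → Bool → ℕ → ℕ} {b : ℕ} (hb : 0 < b) (τ : Table d) (A : ℕ → ℕ)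
    (y : ℝ) {lo hi : Fin d → ℝ} (hlo : lo ≤ 0) (hhi : 0 ≤ hi) :
    boxSum lo hi (corners seq b τ A y) =
      if InCell b seq τ A (boxPosition lo hi) then y else 0 := by
  set X := boxPosition lo hi with hX
  set P : Fin d → ℝ → ℝ := fun i e => pos b (fun j => A (seq i (τ.side i) j)) (τ.pre i) e with hP
  have hP0 : ∀ i e, 0 ≤ e → 0 ≤ P i e := fun i e he => pos_nonneg _ _ _ he
  -- As the box contains the origin, a coordinate of known sign can violate only the bound on its
  -- own side. This is why a table is tied to one side per dimension.
  have hmem : ∀ E : Fin d → Bool, cornerCoord seq b τ A E ∈ Set.Icc lo hi ↔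
      ∀ i, P i (if E i then 1 else 0) ≤ X i (τ.side i) := by
    intro E
    rw [Set.mem_Icc, Pi.le_def, Pi.le_def, ← forall_and]
    refine forall_congr' fun i => ?_
    have h1 := hP0 i (if E i then 1 else 0) (by split_ifs <;> simp)
    have h2 := hlo i
    have h3 := hhi i
    simp only [Pi.zero_apply] at h2 h3
    simp only [hX, boxPosition, cornerCoord, hP] at h1 ⊢
    cases hs : τ.side i <;> simp only [hs, if_true, if_false, Bool.false_eq_true] at h1 ⊢ <;>
      constructor
    · rintro ⟨h4, h5⟩; linarith
    · intro h4; constructor <;> linarith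
    · rintro ⟨h4, h5⟩; linarith
    · intro h4; constructor <;> linarith
  have hsum : boxSum lo hi (corners seq b τ A y) = ∑ E : Fin d → Bool,
      (∏ i, (if E i then (-1 : ℝ) else 1) *
        (if P i (if E i then 1 else 0) ≤ X i (τ.side i) then 1 else 0)) * y := by
    unfold boxSum corners
    rw [List.map_map, Finset.sum_map_toList]
    refine Finset.sum_congr rfl fun E _ => ?_
    simp only [Function.comp_apply, cornerWeight_eq, Finset.prod_mul_distrib, hmem]
    rw [Finset.prod_ite_zero]
    simp only [Finset.mem_univ, true_imp_iff, Finset.prod_const_one]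
    split_ifs <;> simp
  have hprod : ∑ E : Fin d → Bool, ∏ i, ((if E i then (-1 : ℝ) else 1) *
        (if P i (if E i then 1 else 0) ≤ X i (τ.side i) then 1 else 0)) =
      ∏ i, ∑ e : Bool, ((if e then (-1 : ℝ) else 1) *
        (if P i (if e then 1 else 0) ≤ X i (τ.side i) then 1 else 0)) := by
    rw [Finset.prod_univ_sum, Fintype.piFinset_univ]
  have hcell : ∀ i, ∑ e : Bool, ((if e then (-1 : ℝ) else 1) *
        (if P i (if e then 1 else 0) ≤ X i (τ.side i) then 1 else 0)) =
      if Cell b (X i (τ.side i)) (fun j => A (seq i (τ.side i) j)) (τ.pre i) then 1 else 0 := by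
    intro i
    have h1 : P i 0 < P i 1 := pos_zero_lt_one hb _ _
    have h2 : Cell b (X i (τ.side i)) (fun j => A (seq i (τ.side i) j)) (τ.pre i) ↔
      P i 0 ≤ X i (τ.side i) ∧ X i (τ.side i) < P i 1 := Iff.rfl
    rw [Fintype.sum_bool, if_congr h2 rfl rfl]
    simp only [if_true, Bool.false_eq_true, if_false]
    by_cases h3 : P i 0 ≤ X i (τ.side i) <;> by_cases h4 : P i 1 ≤ X i (τ.side i)
    · simp [h3, h4]
    · simp [h3, not_le.1 h4, h4]
    · linarith
    · simp [h3, h4]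
  rw [hsum, ← Finset.sum_mul, hprod, Finset.prod_congr rfl fun i _ => hcell i,
    Finset.prod_ite_zero]
  simp only [Finset.mem_univ, true_imp_iff, Finset.prod_const_one]
  by_cases h : InCell b seq τ A X
  · rw [if_pos h, if_pos fun i => h i, one_mul]
  · rw [if_neg h, if_neg fun h' => h fun i => h' i, zero_mul]

theorem boxSum_points (Δ : Design d k D U) {b : ℕ} (hb : 0 < b) (n : ℕ) (w : ℕ → ℕ → ℝ) (Q : ℝ)
    {lo hi : Fin d → ℝ} (hlo : lo ≤ 0) (hhi : 0 ≤ hi) :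
    boxSum lo hi (Δ.points b n w Q) = Δ.total b n w Q (boxPosition lo hi) := by
  classical
  unfold Design.points Design.total
  rw [boxSum_flatMap]
  congr 1
  refine List.map_congr_left fun x _ => ?_
  unfold itemPoints itemTotal
  rw [boxSum_flatMap]
  congr 1
  refine List.map_congr_left fun c _ => ?_
  unfold cellPoints
  cases itemValue D b n w Q (assign b (x.1.digits Δ.seq) c) x.2 with
  | none => simp [boxSum]
  | some y => simp only [Option.getD_some]; exact boxSum_corners hb _ _ _ hlo hhi

theorem length_points_le (Δ : Design d k D U) {b : ℕ} (hb : 0 < b) (n : ℕ) (w : ℕ → ℕ → ℝ)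
    (Q : ℝ) : (Δ.points b n w Q).length ≤ Δ.items.length * 2 ^ d * b ^ U := by
  have hcell : ∀ x c, (cellPoints Δ.seq D b n w Q x c).length ≤ 2 ^ d := by
    intro x c
    unfold cellPoints
    split
    · simp
    · simp [corners]
  have hflat : ∀ {α : Type} (l : List α) (f : α → List (Point d)) (R : ℕ),
      (∀ a ∈ l, (f a).length ≤ R) → (l.flatMap f).length ≤ l.length * R := by
    intro α l f R h
    rw [List.length_flatMap]
    have := List.sum_le_card_nsmul (l.map fun a => (f a).length) R (by simpa using h)
    simpa using this
  unfold Design.points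
  rw [mul_assoc]
  refine hflat _ _ _ fun x hx => ?_
  unfold itemPoints
  refine (hflat _ _ _ fun c _ => hcell x c).trans ?_
  rw [List.length_range, mul_comm]
  refine Nat.mul_le_mul_left _ (Nat.pow_le_pow_right hb ?_)
  rw [Table.digits, Finset.length_toList]
  exact Δ.card_reads hx

theorem abs_weight_points_le (Δ : Design d k D U) {b n : ℕ} {w : ℕ → ℕ → ℝ} {Q S : ℝ}
    (hS : 0 ≤ S) (hw : ∀ x y, x < n → y < n → |w x y| ≤ S) (hQ : 0 ≤ Q) :
    ∀ p ∈ Δ.points b n w Q, |p.2| ≤ Q + S := by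
  intro p hp
  simp only [Design.points, itemPoints, List.mem_flatMap] at hp
  obtain ⟨x, -, c, -, hp⟩ := hp
  unfold cellPoints at hp
  split at hp
  · simp at hp
  · rename_i y hy
    simp only [corners, List.mem_map] at hp
    obtain ⟨E, -, rfl⟩ := hp
    rw [abs_cornerWeight]
    exact itemValue_le hS hw hQ hy

/-! ### Cliques -/

/-- The weight matrix as a function on natural numbers. -/
noncomputable def weightOf (G : WeightedGraph k) (x y : ℕ) : ℝ :=
  if h : x < G.n ∧ y < G.n then G.wt ⟨x, h.1⟩ ⟨y, h.2⟩ else 0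

theorem cliqueWeight_map (G : WeightedGraph k) (g : Fin k ↪o Fin G.n) {f : ℕ → ℕ}
    (hf : ∀ i : Fin k, f i = g i) :
    G.cliqueWeight (Finset.univ.map g.toEmbedding) =
      ∑ q ∈ pairs k, weightOf G (f q.1) (f q.2) := by
  unfold WeightedGraph.cliqueWeight pairs
  simp only [Finset.sum_filter, Finset.sum_map, RelEmbedding.coe_toEmbedding,
    OrderEmbedding.lt_iff_lt]
  rw [Finset.sum_product, Finset.sum_range]
  refine Finset.sum_congr rfl fun i _ => ?_
  rw [Finset.sum_range]
  refine Finset.sum_congr rfl fun j _ => ?_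
  simp only [Fin.lt_def, hf, weightOf]
  rw [dif_pos ⟨(g i).2, (g j).2⟩]

theorem exists_enumeration (G : WeightedGraph k) {T : Finset (Fin G.n)} (hT : T.card = k) :
    ∃ f : ℕ → ℕ, (∀ u v, u < v → v < k → f u < f v ∧ f v < G.n) ∧
      G.cliqueWeight T = ∑ q ∈ pairs k, weightOf G (f q.1) (f q.2) := by
  set g := T.orderEmbOfFin hT with hg
  have hmap : Finset.univ.map g.toEmbedding = T := by
    rw [hg, ← Finset.coe_inj]; simp
  let f : ℕ → ℕ := fun u => if h : u < k then g ⟨u, h⟩ else 0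
  have hf : ∀ i : Fin k, f i = g i := fun i => by simp [f]
  refine ⟨f, fun u v h1 h2 => ?_, ?_⟩
  · simp only [f]
    simp only [dif_pos h2, dif_pos (h1.trans h2)]
    exact ⟨g.strictMono (show (⟨u, h1.trans h2⟩ : Fin k) < ⟨v, h2⟩ from h1), (g _).2⟩
  · rw [← hmap]
    exact cliqueWeight_map G g hf

/-- `hf` bounds `f` only through pairs, so `2 ≤ k` is needed to place each value of `f` below `n`.
-/
theorem exists_clique (G : WeightedGraph k) (hk : 2 ≤ k) {f : ℕ → ℕ}
    (hf : ∀ u v, u < v → v < k → f u < f v ∧ f v < G.n) :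
    ∃ T : Finset (Fin G.n), T.card = k ∧
      G.cliqueWeight T = ∑ q ∈ pairs k, weightOf G (f q.1) (f q.2) := by
  have hlt : ∀ i < k, f i < G.n := by
    intro i hi
    obtain h0 | h0 := Nat.eq_zero_or_pos i
    · subst h0; exact (hf 0 1 one_pos hk).1.trans (hf 0 1 one_pos hk).2
    · exact (hf 0 i h0 hi).2
  let g : Fin k ↪o Fin G.n := OrderEmbedding.ofStrictMono (fun i => ⟨f i, hlt i i.2⟩)
    fun i j hij => (hf i j hij j.2).1
  exact ⟨Finset.univ.map g.toEmbedding, by simp, cliqueWeight_map G g fun i => rfl⟩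

/-- The maximum weight of a clique, from an optimal box. -/
theorem isGreatest_of_optimal_box (Δ : Design d k D U) (hk : 2 ≤ k) (hD : 0 < D)
    (G : WeightedGraph k) {b : ℕ} (hb : 0 < b) (hn : G.n ≤ b ^ D) {S Q W : ℝ} (hS : 0 ≤ S)
    (hw : ∀ x y, x < G.n → y < G.n → |weightOf G x y| ≤ S)
    (hQ : Q = 1 + 2 * (Δ.items.length * S))
    (hW : W = ((Δ.points b G.n (weightOf G) Q).length + 1 : ℕ) * (Q + S))
    {lo hi : Fin d → ℝ}
    (hmax : ∀ lo' hi' : Fin d → ℝ, lo' ≤ hi' →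
      boxSum lo' hi' (Δ.points b G.n (weightOf G) Q ++ [(0, W)]) ≤
        boxSum lo hi (Δ.points b G.n (weightOf G) Q ++ [(0, W)])) :
    IsGreatest {x : ℝ | ∃ T : Finset (Fin G.n), T.card = k ∧ G.cliqueWeight T = x}
      (boxSum lo hi (Δ.points b G.n (weightOf G) Q ++ [(0, W)]) - W - Δ.items.length * Q) := by
  classical
  set l := Δ.points b G.n (weightOf G) Q with hl
  set m : ℝ := ((Δ.items.length : ℕ) : ℝ) with hm
  have hm0 : 0 ≤ m := Nat.cast_nonneg _
  have hmS : 0 ≤ m * S := mul_nonneg hm0 hS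
  have hQ0 : 0 ≤ Q := by rw [hQ]; linarith
  have horigin : ∀ lo' hi' : Fin d → ℝ, lo' ≤ 0 → 0 ≤ hi' →
      boxSum lo' hi' (l ++ [(0, W)]) = Δ.total b G.n (weightOf G) Q (boxPosition lo' hi') + W := by
    intro lo' hi' h1 h2
    rw [boxSum_append, boxSum_points Δ hb _ _ _ h1 h2]
    simp [boxSum, h1, h2]
  -- Every clique is realized by some box around the origin, which the optimal box has to match.
  have hge : ∀ T : Finset (Fin G.n), T.card = k →
      W + m * Q + G.cliqueWeight T ≤ boxSum lo hi (l ++ [(0, W)]) := by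
    intro T hT
    obtain ⟨f, hf, hfT⟩ := exists_enumeration G hT
    obtain ⟨X, hX, hX'⟩ := Δ.exists_total_eq hb hn hD (weightOf G) Q hf
    have h1 : (fun i => -(X i false) - 1) ≤ (0 : Fin d → ℝ) := fun i => by
      have := hX i false; simp only [Pi.zero_apply]; linarith
    have h2 : (0 : Fin d → ℝ) ≤ fun i => X i true + 1 := fun i => by
      have := hX i true; simp only [Pi.zero_apply]; linarith
    have h3 := hmax _ _ (h1.trans h2)
    rw [horigin _ _ h1 h2] at h3
    have h4 : boxPosition (fun i => -(X i false) - 1) (fun i => X i true + 1) = X := by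
      funext i s; cases s <;> simp [boxPosition]
    rw [h4, hX', ← hfT] at h3
    linarith
  obtain ⟨T₀, hT₀⟩ : ∃ T : Finset (Fin G.n), T.card = k := by
    obtain ⟨T, -, hT⟩ := Finset.exists_subset_card_eq (s := (Finset.univ : Finset (Fin G.n)))
      (n := k) (by simpa using G.le)
    exact ⟨T, hT⟩
  have hpairs : ((pairs k).card : ℝ) ≤ m := by
    rw [hm]
    simp [Design.items]
  have hT₀' : -(m * S) ≤ G.cliqueWeight T₀ := by
    obtain ⟨f, hf, hfT⟩ := exists_enumeration G hT₀
    have h1 : |G.cliqueWeight T₀| ≤ (pairs k).card * S := by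
      rw [hfT]
      refine (Finset.abs_sum_le_sum_abs _ _).trans ?_
      rw [← nsmul_eq_mul]
      refine Finset.sum_le_card_nsmul _ _ _ fun q hq => ?_
      obtain ⟨h1, h2⟩ := mem_pairs.1 hq
      obtain ⟨h3, h4⟩ := hf _ _ h1 h2
      exact hw _ _ (h3.trans h4) h4
    have h2 : (pairs k).card * S ≤ m * S := mul_le_mul_of_nonneg_right hpairs hS
    linarith [(abs_le.1 h1).1]
  have hm1 : 1 ≤ m := by
    refine le_trans ?_ hpairs
    exact_mod_cast Finset.card_pos.2 ⟨(0, 1), mem_pairs.2 ⟨one_pos, hk⟩⟩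
  have h0 := hge T₀ hT₀
  -- A box without the origin weighs at most `l.length * (Q + S)`. The heavy point exceeds this by
  -- `Q + S`, and the remaining `m * Q + G.cliqueWeight T₀` is nonnegative because the clique costs
  -- at most `m * S`.
  have hbig : (l.length : ℝ) * (Q + S) < boxSum lo hi (l ++ [(0, W)]) := by
    rw [hW] at h0 ⊢
    push_cast at h0 ⊢
    nlinarith
  have hmem : (0 : Fin d → ℝ) ∈ Set.Icc lo hi := by
    by_contra hnot
    rw [boxSum_append] at hbig
    have h1 : boxSum lo hi [((0 : Fin d → ℝ), W)] = 0 := by simp [boxSum]; tauto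
    have h2 := abs_boxSum_le (lo := lo) (hi := hi) (by linarith)
      (abs_weight_points_le Δ (b := b) hS hw hQ0)
    rw [← hl] at h2
    linarith [le_abs_self (boxSum lo hi l)]
  rw [horigin _ _ hmem.1 hmem.2] at h0 hge ⊢
  obtain hsmall | ⟨f, hf, hfX⟩ := Δ.total_cases (n := G.n) hb hS hw hQ0 (boxPosition lo hi)
  -- Now `m * Q - m * S ≤ (m - 1) * (Q + S)`, that is, `Q ≤ 2 * m * S - S`, against the choice `Q =
  -- 1 + 2 * m * S`.
  · exfalso
    rw [← hm] at hsmall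
    nlinarith
  · obtain ⟨T, hT, hTf⟩ := exists_clique G hk hf
    rw [hfX, ← hm, ← hTf] at hge ⊢
    refine ⟨⟨T, hT, by ring⟩, ?_⟩
    rintro _ ⟨T', hT', rfl⟩
    linarith [hge T' hT']

/-- A nonempty list of points as an instance of Max-Weight Rectangle. -/
noncomputable def toInstance (l : List (Point d)) (hl : 0 < l.length) : WeightedPoints d where
  N := l.length
  pos := hl
  pt p := (l.get p).1
  wt p := (l.get p).2

theorem toInstance_boxWeight (l : List (Point d)) (hl : 0 < l.length) (lo hi : Fin d → ℝ) :
    (toInstance l hl).boxWeight lo hi = boxSum lo hi l := by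
  classical
  unfold WeightedPoints.boxWeight boxSum
  rw [Finset.sum_filter]
  change ∑ p : Fin l.length, (if (l.get p).1 ∈ Set.Icc lo hi then (l.get p).2 else 0) = _
  rw [← List.sum_ofFn]
  congr 1
  conv_rhs => rw [← List.ofFn_get l, List.map_ofFn]
  rfl

end CliqueToRectangle

/-! ### A calculus of time-bounded correctness for programs. -/

namespace RealRAM

/-- `p` started in `s` halts after at most `T` steps in a state that satisfies `Q`. -/
def Runs (M : ℕ) (p : Prog) (T : ℕ) (s : State) (Q : State → Prop) : Prop :=
  ∃ t s', Exec M p s t s' ∧ t ≤ T ∧ Q s'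

variable {M T T' : ℕ} {p q : Prog} {s : State} {Q Q' : State → Prop} {b : Test}

theorem Runs.mono (h : Runs M p T s Q) (hT : T ≤ T') (hQ : ∀ s', Q s' → Q' s') :
    Runs M p T' s Q' := by
  obtain ⟨t, s', h1, h2, h3⟩ := h
  exact ⟨t, s', h1, h2.trans hT, hQ _ h3⟩

theorem Runs.op {o : Op} {s' : State} (h : o.run M s = some s') (hQ : Q s') :
    Runs M (.op o) 1 s Q :=
  ⟨1, s', .op h, le_rfl, hQ⟩

theorem Runs.seq (h : Runs M p T s fun s' => Runs M q T' s' Q) : Runs M (.seq p q) (T + T') s Q := by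
  obtain ⟨t, s', h1, h2, t', s'', h3, h4, h5⟩ := h
  exact ⟨_, _, .seq h1 h3, by omega, h5⟩

theorem Runs.branch (h₁ : b.Holds s → Runs M p T s Q) (h₂ : ¬ b.Holds s → Runs M q T' s Q) :
    Runs M (.branch b p q) (T + T' + 1) s Q := by
  by_cases hb : b.Holds s
  · obtain ⟨t, s', h1, h2, h3⟩ := h₁ hb
    exact ⟨_, _, .branchTrue hb h1, by omega, h3⟩
  · obtain ⟨t, s', h1, h2, h3⟩ := h₂ hb
    exact ⟨_, _, .branchFalse hb h1, by omega, h3⟩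

/-- A loop with an invariant that is indexed by the number of rounds. -/
theorem Runs.loop (I : ℕ → State → Prop) (m : ℕ) (h0 : I 0 s)
    (ht : ∀ i < m, ∀ s, I i s → b.Holds s) (hf : ∀ s, I m s → ¬ b.Holds s)
    (hI : ∀ i < m, ∀ s, I i s → Runs M p T s (I (i + 1))) :
    Runs M (.loop b p) (m * (T + 1) + 1) s (I m) := by
  suffices h : ∀ j i s, i + j = m → I i s → Runs M (.loop b p) (j * (T + 1) + 1) s (I m) from
    h m 0 s (zero_add m) h0
  intro j
  induction j with
  | zero =>
    intro i s hi h
    obtain rfl : i = m := by omega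
    exact ⟨1, s, .loopFalse (hf s h), by omega, h⟩
  | succ j ih =>
    intro i s hi h
    obtain ⟨t, s', h1, h2, h3⟩ := hI i (by omega) s h
    obtain ⟨t', s'', h4, h5, h6⟩ := ih (i + 1) s' (by omega) h3
    refine ⟨_, _, .loopTrue (ht i (by omega) s h) h1 h4, ?_, h6⟩
    rw [add_mul]; omega

theorem Runs.skip (h : Q s) : Runs M (.op .skip) 1 s Q := .op rfl h

/-- Overwrite a word register. -/
def State.updW (s : State) (x v : ℕ) : State := { s with w := Function.update s.w x v }

/-- Overwrite an entry of a real array. -/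
noncomputable def State.updA (s : State) (a i : ℕ) (v : ℝ) : State :=
  { s with ra := Function.update s.ra a (Function.update (s.ra a) i v) }

theorem Runs.setW {o : Op} {x v : ℕ} (ho : o.run M s = s.setW M x v) (hv : v < M)
    (h : Q (s.updW x v)) : Runs M (.op o) 1 s Q :=
  .op (s' := s.updW x v) (by rw [ho, State.setW, if_pos hv]; rfl) h

theorem Runs.wconst {x c : ℕ} (hv : c < M) (h : Q (s.updW x c)) : Runs M (.op (.wconst x c)) 1 s Q :=
  .setW rfl hv h

theorem Runs.wmov {x y : ℕ} (hv : s.w y < M) (h : Q (s.updW x (s.w y))) :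
    Runs M (.op (.wmov x y)) 1 s Q :=
  .setW rfl hv h

theorem Runs.wadd {x y z : ℕ} (hv : s.w y + s.w z < M) (h : Q (s.updW x (s.w y + s.w z))) :
    Runs M (.op (.wadd x y z)) 1 s Q :=
  .setW rfl hv h

theorem Runs.wsub {x y z : ℕ} (hv : s.w y - s.w z < M) (h : Q (s.updW x (s.w y - s.w z))) :
    Runs M (.op (.wsub x y z)) 1 s Q :=
  .setW rfl hv h

theorem Runs.wmul {x y z : ℕ} (hv : s.w y * s.w z < M) (h : Q (s.updW x (s.w y * s.w z))) :
    Runs M (.op (.wmul x y z)) 1 s Q :=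
  .setW rfl hv h

theorem Runs.wdiv {x y z : ℕ} (hz : s.w z ≠ 0) (hv : s.w y / s.w z < M)
    (h : Q (s.updW x (s.w y / s.w z))) : Runs M (.op (.wdiv x y z)) 1 s Q :=
  .setW (by simp [Op.run, hz]) hv h

theorem Runs.rcast {x y : ℕ} (h : Q (s.setR x (s.w y))) : Runs M (.op (.rcast x y)) 1 s Q :=
  .op rfl h

theorem Runs.rmov {x y : ℕ} (h : Q (s.setR x (s.r y))) : Runs M (.op (.rmov x y)) 1 s Q :=
  .op rfl h

theorem Runs.radd {x y z : ℕ} (h : Q (s.setR x (s.r y + s.r z))) :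
    Runs M (.op (.radd x y z)) 1 s Q := .op rfl h

theorem Runs.rsub {x y z : ℕ} (h : Q (s.setR x (s.r y - s.r z))) :
    Runs M (.op (.rsub x y z)) 1 s Q := .op rfl h

theorem Runs.rmul {x y z : ℕ} (h : Q (s.setR x (s.r y * s.r z))) :
    Runs M (.op (.rmul x y z)) 1 s Q := .op rfl h

theorem Runs.rdiv {x y z : ℕ} (hz : s.r z ≠ 0) (h : Q (s.setR x (s.r y / s.r z))) :
    Runs M (.op (.rdiv x y z)) 1 s Q := .op (by simp [Op.run, hz]) h

theorem Runs.rload {x a y : ℕ} (h : Q (s.setR x (s.ra a (s.w y)))) :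
    Runs M (.op (.rload x a y)) 1 s Q := .op rfl h

theorem Runs.rstore {a y x : ℕ} (h : Q (s.updA a (s.w y) (s.r x))) :
    Runs M (.op (.rstore a y x)) 1 s Q := .op rfl h

@[simp] theorem State.updW_w (s : State) (x v : ℕ) : (s.updW x v).w = Function.update s.w x v := rfl
@[simp] theorem State.updW_r (s : State) (x v : ℕ) : (s.updW x v).r = s.r := rfl
@[simp] theorem State.updW_wa (s : State) (x v : ℕ) : (s.updW x v).wa = s.wa := rfl
@[simp] theorem State.updW_ra (s : State) (x v : ℕ) : (s.updW x v).ra = s.ra := rfl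
@[simp] theorem State.setR_w (s : State) (x : ℕ) (v : ℝ) : (s.setR x v).w = s.w := rfl
@[simp] theorem State.setR_r (s : State) (x : ℕ) (v : ℝ) :
    (s.setR x v).r = Function.update s.r x v := rfl
@[simp] theorem State.setR_wa (s : State) (x : ℕ) (v : ℝ) : (s.setR x v).wa = s.wa := rfl
@[simp] theorem State.setR_ra (s : State) (x : ℕ) (v : ℝ) : (s.setR x v).ra = s.ra := rfl
@[simp] theorem State.updA_w (s : State) (a i : ℕ) (v : ℝ) : (s.updA a i v).w = s.w := rfl
@[simp] theorem State.updA_r (s : State) (a i : ℕ) (v : ℝ) : (s.updA a i v).r = s.r := rfl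
@[simp] theorem State.updA_wa (s : State) (a i : ℕ) (v : ℝ) : (s.updA a i v).wa = s.wa := rfl
@[simp] theorem State.updA_ra (s : State) (a i : ℕ) (v : ℝ) : (s.updA a i v).ra =
    Function.update s.ra a (Function.update (s.ra a) i v) := rfl

/-- Infix sequencing of programs. -/
infixr:60 " ;; " => Prog.seq

instance : Coe Op Prog := ⟨Prog.op⟩

end RealRAM

namespace CliqueToRectangle

open RealRAM

variable {d k D U : ℕ}

/-! ### The reduction as a program

Low word registers: `0`: `n`, `1`: `b`, `2`: loop bound, `3`: loop counter, `5`: number of points,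
`9`: the constant `1`, `11 + δ`: digit `δ`, the others are temporary. Low real registers: `0`:
result, `1`: `b`, `2`: `Q`, `3`: current weight, `6`: `S`, `7`: the constant `1`, `8`: weight of the
origin, `9`: the constant `0`. Real arrays: `0`: input, `1, …, d + 1`: the points. Everything from
`B` on belongs to the rectangle program. -/

/-- The part of the memory that stays fixed while points are written. -/
structure Base (B n b N : ℕ) (Q S : ℝ) (R : ℕ → ℕ → ℝ) (s : State) : Prop where
  w0 : s.w 0 = n
  w1 : s.w 1 = b
  w5 : s.w 5 = N
  w9 : s.w 9 = 1
  r1 : s.r 1 = b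
  r2 : s.r 2 = Q
  r6 : s.r 6 = S
  r7 : s.r 7 = 1
  r9 : s.r 9 = 0
  wa : s.wa = fun _ _ => 0
  ra : s.ra = R
  hw : ∀ x, s.w (x + B) = 0
  hr : ∀ x, s.r (x + B) = 0

section

variable {B n b N : ℕ} {Q S : ℝ} {R : ℕ → ℕ → ℝ} {s : State}

theorem Base.updW (h : Base B n b N Q S R s) {x : ℕ} (v : ℕ) (hx : x < B) (h0 : x ≠ 0) (h1 : x ≠ 1)
    (h5 : x ≠ 5) (h9 : x ≠ 9) : Base B n b N Q S R (s.updW x v) where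
  w0 := by simp [h0.symm, h.w0]
  w1 := by simp [h1.symm, h.w1]
  w5 := by simp [h5.symm, h.w5]
  w9 := by simp [h9.symm, h.w9]
  r1 := h.r1
  r2 := h.r2
  r6 := h.r6
  r7 := h.r7
  r9 := h.r9
  wa := h.wa
  ra := h.ra
  hw y := by rw [State.updW_w, Function.update_of_ne (by omega), h.hw]
  hr := h.hr

theorem Base.of_frame (h : Base B n b N Q S R s) {s' : State} {R' : ℕ → ℕ → ℝ} (hB : 8 < B)
    (hw : s'.w = s.w) (hwa : s'.wa = s.wa) (hra : s'.ra = R')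
    (hr : ∀ x, x ≠ 3 → x ≠ 4 → x ≠ 5 → x ≠ 8 → s'.r x = s.r x) : Base B n b N Q S R' s' where
  w0 := by rw [hw, h.w0]
  w1 := by rw [hw, h.w1]
  w5 := by rw [hw, h.w5]
  w9 := by rw [hw, h.w9]
  r1 := by rw [hr 1 (by omega) (by omega) (by omega) (by omega), h.r1]
  r2 := by rw [hr 2 (by omega) (by omega) (by omega) (by omega), h.r2]
  r6 := by rw [hr 6 (by omega) (by omega) (by omega) (by omega), h.r6]
  r7 := by rw [hr 7 (by omega) (by omega) (by omega) (by omega), h.r7]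
  r9 := by rw [hr 9 (by omega) (by omega) (by omega) (by omega), h.r9]
  wa := by rw [hwa, h.wa]
  ra := hra
  hw x := by rw [hw, h.hw]
  hr x := by rw [hr _ (by omega) (by omega) (by omega) (by omega), h.hr]

end

/-- `s'` differs from `s` in the real registers `4` and `5` only. -/
structure Frame (s s' : State) : Prop where
  w : s'.w = s.w
  wa : s'.wa = s.wa
  ra : s'.ra = s.ra
  r : ∀ x, x ≠ 4 → x ≠ 5 → s'.r x = s.r x

/-- Put the base-`b` fraction with the digits in registers `11 + dig 0, …` into register `4`. -/
def posProg (init : ℕ) : (ℕ → ℕ) → ℕ → Prog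
  | _, 0 => Op.rmov 4 init
  | dig, p + 1 => posProg init (fun j => dig (j + 1)) p ;;
      Op.rcast 5 (11 + dig 0) ;; Op.radd 4 4 5 ;; Op.rdiv 4 4 1

theorem runs_posProg (M init : ℕ) {b : ℕ} (hb : 0 < b) (dig : ℕ → ℕ) (p : ℕ) (A : ℕ → ℕ) (s : State)
    (h1 : s.r 1 = b) (hA : ∀ j < p, s.w (11 + dig j) = A j) :
    Runs M (posProg init dig p) (p * 3 + 1) s fun s' =>
      Frame s s' ∧ s'.r 4 = pos b A p (s.r init) := by
  induction p generalizing dig A with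
  | zero =>
    refine .mono (.rmov ?_) (by omega) fun _ h => h
    refine ⟨⟨rfl, rfl, rfl, fun x h4 h5 => ?_⟩, by simp [pos]⟩
    simp [h4]
  | succ p ih =>
    refine .mono (.seq (T' := 3) (.mono (ih (fun j => dig (j + 1)) (fun j => A (j + 1))
      fun j hj => hA (j + 1) (by omega)) le_rfl ?_)) (by omega) fun _ h => h
    rintro s₁ ⟨hf, h4⟩
    refine .seq (T' := 2) (.rcast (.seq (T' := 1) (.radd (.rdiv ?_ ?_))))
    · simp [hf.r, h1]; omega
    · refine ⟨⟨hf.w, hf.wa, hf.ra, fun x h4 h5 => ?_⟩, ?_⟩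
      · simp [h4, h5, hf.r]
      · simp only [State.setR_r, Function.update_self, pos, hf.w,
          Function.update_of_ne (show (1 : ℕ) ≠ 4 by omega),
          Function.update_of_ne (show (1 : ℕ) ≠ 5 by omega),
          Function.update_of_ne (show (4 : ℕ) ≠ 5 by omega), hf.r 1 (by omega) (by omega), h1, h4,
          hA 0 (by omega)]
        rw [add_comm]

/-- Put coordinate `i` of a corner into register `4`. -/
def coordProg (seq : Fin d → Bool → ℕ → ℕ) (τ : Table d) (E : Fin d → Bool) (i : Fin d) : Prog :=
  posProg (if E i then 7 else 9) (seq i (τ.side i)) (τ.pre i) ;; Op.radd 4 4 7 ;;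
    (if τ.side i then Op.skip else Op.rsub 4 9 4 : Op)

theorem runs_coordProg (M : ℕ) {b : ℕ} (hb : 0 < b) (seq : Fin d → Bool → ℕ → ℕ) (τ : Table d)
    (E : Fin d → Bool) (i : Fin d) (A : ℕ → ℕ) (s : State) (h1 : s.r 1 = b) (h7 : s.r 7 = 1)
    (h9 : s.r 9 = 0) (hA : ∀ δ ∈ τ.reads seq, s.w (11 + δ) = A δ) :
    Runs M (coordProg seq τ E i) (τ.pre i * 3 + 3) s fun s' =>
      Frame s s' ∧ s'.r 4 = cornerCoord seq b τ A E i := by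
  refine .mono (.seq (T' := 2) (.mono (runs_posProg M _ hb _ _
    (fun j => A (seq i (τ.side i) j)) s h1
    fun j hj => hA _ (Table.mem_reads.2 ⟨i, j, hj, rfl⟩)) le_rfl ?_)) (by omega) fun _ h => h
  rintro s₁ ⟨hf, h4⟩
  have he : s.r (if E i then 7 else 9) = if E i then 1 else 0 := by split_ifs <;> assumption
  rw [he] at h4
  refine .seq (T' := 1) (.radd ?_)
  unfold cornerCoord
  rw [← h4]
  split_ifs with hs
  · refine .skip ⟨⟨hf.w, hf.wa, hf.ra, fun x h4 h5 => ?_⟩, ?_⟩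
    · simp [h4, hf.r x h4 h5]
    · simp [hf.r 7, h7]
  · refine .rsub ⟨⟨hf.w, hf.wa, hf.ra, fun x h4 h5 => ?_⟩, ?_⟩
    · simp [h4, hf.r x h4 h5]
    · simp [hf.r 7, hf.r 9, h7, h9]

/-- Component `i` of a point: its coordinates, then its weight. -/
noncomputable def component (q : Point d) (i : ℕ) : ℝ :=
  if h : i < d then q.1 ⟨i, h⟩ else if i = d then q.2 else 0

/-- The array of the `i`-th components. -/
noncomputable def pointArray (l : List (Point d)) (i p : ℕ) : ℝ :=
  if h : p < l.length then component l[p] i else 0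

theorem pointArray_append (l : List (Point d)) (q : Point d) (i : ℕ) :
    pointArray (l ++ [q]) i = Function.update (pointArray l i) l.length (component q i) := by
  funext p
  simp only [pointArray, Function.update_apply, List.length_append, List.length_singleton]
  rcases lt_trichotomy p l.length with h | h | h
  · rw [dif_pos (by omega), if_neg (by omega), dif_pos h, List.getElem_append_left h]
  · subst h; simp
  · rw [dif_neg (by omega), if_neg (by omega), dif_neg (by omega)]

/-- The real arrays after the first `j` components of `q` have been stored behind the points `l`. -/
noncomputable def arrays (B : ℕ) (inp : ℕ → ℝ) (l : List (Point d)) (q : Point d) (j a : ℕ) : ℕ → ℝ :=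
  if a = 0 then inp
  else if a ≤ d + 1 then (if a - 1 < j then pointArray (l ++ [q]) (a - 1) else pointArray l (a - 1))
  else if B ≤ a then (if a - B < j then pointArray (l ++ [q]) (a - B) else pointArray l (a - B))
  else fun _ => 0

theorem component_eq_zero (q : Point d) {i : ℕ} (h : d < i) : component q i = 0 := by
  rw [component, dif_neg (by omega), if_neg (by omega)]

theorem pointArray_eq_zero (l : List (Point d)) {i : ℕ} (h : d < i) :
    pointArray l i = fun _ => 0 := by
  funext p
  rw [pointArray]; split_ifs
  · exact component_eq_zero _ h
  · rfl

theorem arrays_full (B : ℕ) (inp : ℕ → ℝ) (l : List (Point d)) (q q' : Point d) :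
    arrays B inp l q (d + 1) = arrays B inp (l ++ [q]) q' 0 := by
  funext a
  simp only [arrays, Nat.not_lt_zero, if_false]
  split_ifs with h1 h2 h3 h4 h5
  · rfl
  · rfl
  · omega
  · rfl
  · rw [pointArray_eq_zero _ (by omega), pointArray_eq_zero _ (by omega)]
  · rfl

theorem arrays_zero (B : ℕ) (inp : ℕ → ℝ) (l : List (Point d)) (q q' : Point d) :
    arrays B inp l q 0 = arrays B inp l q' 0 := by
  funext a; simp [arrays]

/-- Store register `4` as component `j` of the next point. -/
def storeProg (B j : ℕ) : Prog := Op.rstore (1 + j) 5 4 ;; Op.rstore (B + j) 5 4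

/-- Each component is stored twice. The arrays from `B` on are the input of the rectangle program,
which may overwrite them; the copy in arrays `1, …, d + 1` survives for the evaluation of the box.
-/
theorem runs_storeProg (M : ℕ) {B j : ℕ} (hj : j ≤ d) (hB : d + 2 ≤ B) (inp : ℕ → ℝ)
    (l : List (Point d)) (q : Point d) (s : State) (h5 : s.w 5 = l.length)
    (h4 : s.r 4 = component q j) (hra : s.ra = arrays B inp l q j) :
    Runs M (storeProg B j) 2 s fun s' => s'.w = s.w ∧ s'.wa = s.wa ∧ s'.r = s.r ∧
      s'.ra = arrays B inp l q (j + 1) := by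
  refine .seq (T := 1) (T' := 1) (.rstore (.rstore ⟨rfl, rfl, rfl, ?_⟩))
  simp only [State.updA_ra, State.updA_w, State.updA_r, h5, h4, hra]
  have e1 : arrays B inp l q j (1 + j) = pointArray l j := by
    rw [arrays, if_neg (by omega), if_pos (by omega), if_neg (by omega), Nat.add_sub_cancel_left]
  have e2 : arrays B inp l q j (B + j) = pointArray l j := by
    rw [arrays, if_neg (by omega), if_neg (by omega), if_pos (by omega), if_neg (by omega),
      Nat.add_sub_cancel_left]
  rw [Function.update_of_ne (show B + j ≠ 1 + j by omega), e1, e2, ← pointArray_append]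
  funext a
  by_cases ha : a = B + j
  · subst ha
    rw [Function.update_self, arrays, if_neg (by omega), if_neg (by omega), if_pos (by omega),
      if_pos (by omega), Nat.add_sub_cancel_left]
  rw [Function.update_of_ne ha]
  by_cases ha' : a = 1 + j
  · subst ha'
    rw [Function.update_self, arrays, if_neg (by omega), if_pos (by omega),
      if_pos (by omega), Nat.add_sub_cancel_left]
  rw [Function.update_of_ne ha']
  simp only [arrays]
  have h1 : a ≠ 0 → (a - 1 < j ↔ a - 1 < j + 1) := by omega
  have h2 : B ≤ a → (a - B < j ↔ a - B < j + 1) := by omega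
  by_cases c0 : a = 0
  · simp [c0]
  · by_cases c1 : B ≤ a
    · simp only [h1 c0, h2 c1]
    · simp only [h1 c0, c1, if_false]

/-- Store the first `j` coordinates of a corner. -/
def coordsProg (seq : Fin d → Bool → ℕ → ℕ) (B : ℕ) (τ : Table d) (E : Fin d → Bool) : ℕ → Prog
  | 0 => Op.skip
  | j + 1 => coordsProg seq B τ E j ;;
      if h : j < d then coordProg seq τ E ⟨j, h⟩ ;; storeProg B j else Op.skip

/-- `T` is quantified before the word size, the base and the points, which makes it a constant of
the program. The lemmas about larger parts keep this order. -/
theorem runs_coordsProg (seq : Fin d → Bool → ℕ → ℕ) (B : ℕ) (hB : d + 2 ≤ B) (τ : Table d)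
    (E : Fin d → Bool) (j : ℕ) (hj : j ≤ d) :
    ∃ T, ∀ (M b : ℕ) (_ : 0 < b) (inp : ℕ → ℝ) (l : List (Point d)) (q : Point d) (A : ℕ → ℕ)
      (s : State) (_ : s.r 1 = b) (_ : s.r 7 = 1) (_ : s.r 9 = 0) (_ : s.w 5 = l.length)
      (_ : ∀ δ ∈ τ.reads seq, s.w (11 + δ) = A δ) (_ : q.1 = cornerCoord seq b τ A E)
      (_ : s.ra = arrays B inp l q 0),
      Runs M (coordsProg seq B τ E j) T s fun s' => s'.w = s.w ∧ s'.wa = s.wa ∧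
        (∀ x, x ≠ 4 → x ≠ 5 → s'.r x = s.r x) ∧ s'.ra = arrays B inp l q j := by
  induction j with
  | zero =>
    exact ⟨1, fun M b _ inp l q A s _ _ _ _ _ _ h => .skip ⟨rfl, rfl, fun _ _ _ => rfl, h⟩⟩
  | succ j ih =>
    obtain ⟨T, ih⟩ := ih (by omega)
    refine ⟨T + ((τ.pre ⟨j, hj⟩ * 3 + 3) + 2),
      fun M b hb inp l q A s h1 h7 h9 h5 hA hq hra => .seq ?_⟩
    refine .mono (ih M b hb inp l q A s h1 h7 h9 h5 hA hq hra) le_rfl ?_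
    rintro s₁ ⟨e1, e2, e3, e4⟩
    rw [dif_pos (show j < d from hj)]
    refine .seq (.mono (runs_coordProg M hb seq τ E ⟨j, hj⟩ A s₁ (by rw [e3 1 (by omega) (by omega), h1])
      (by rw [e3 7 (by omega) (by omega), h7]) (by rw [e3 9 (by omega) (by omega), h9])
      (by rw [e1]; exact hA)) le_rfl ?_)
    rintro s₂ ⟨hf, h4⟩
    refine .mono (runs_storeProg M (by omega) hB inp l q s₂ (by rw [hf.w, e1, h5]) ?_
      (by rw [hf.ra, e4])) le_rfl ?_
    · rw [h4, component, dif_pos (show j < d from hj), hq]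
    · rintro s₃ ⟨f1, f2, f3, f4⟩
      refine ⟨by rw [f1, hf.w, e1], by rw [f2, hf.wa, e2], fun x hx4 hx5 => ?_, f4⟩
      rw [f3, hf.r x hx4 hx5, e3 x hx4 hx5]

open Classical in
/-- Write one corner; its weight, up to sign, is in register `3`. -/
noncomputable def cornerProg (seq : Fin d → Bool → ℕ → ℕ) (B : ℕ) (τ : Table d)
    (E : Fin d → Bool) : Prog :=
  coordsProg seq B τ E d ;; (if EvenCorner E then Op.rmov 4 3 else Op.rsub 4 9 3 : Op) ;;
    storeProg B d ;; Op.wadd 5 5 9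

/-- The state after some points have been written. -/
structure Written (B n b : ℕ) (Q S : ℝ) (inp : ℕ → ℝ) (l : List (Point d)) (s : State) : Prop
    extends Base B n b l.length Q S (arrays B inp l 0 0) s

theorem runs_cornerProg (seq : Fin d → Bool → ℕ → ℕ) (B : ℕ) (hB : d + 2 ≤ B) (hB' : 11 ≤ B)
    (τ : Table d) (E : Fin d → Bool) :
    ∃ T, ∀ (M n b : ℕ) (_ : 0 < b) (Q S y : ℝ) (inp : ℕ → ℝ) (l : List (Point d)) (A : ℕ → ℕ)
      (s : State) (_ : Written B n b Q S inp l s) (_ : s.r 3 = y)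
      (_ : ∀ δ ∈ τ.reads seq, s.w (11 + δ) = A δ) (_ : l.length + 1 < M),
      Runs M (cornerProg seq B τ E) T s fun s' =>
        Written B n b Q S inp (l ++ [(cornerCoord seq b τ A E, cornerWeight y E)]) s' ∧
        s'.r 3 = y ∧ ∀ x, x ≠ 5 → s'.w x = s.w x := by
  classical
  obtain ⟨T, hT⟩ := runs_coordsProg seq B hB τ E d le_rfl
  refine ⟨T + (1 + (2 + 1)), fun M n b hb Q S y inp l A s hs h3 hA hM => ?_⟩
  set q : Point d := (cornerCoord seq b τ A E, cornerWeight y E) with hq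
  refine .seq (.mono (hT M b hb inp l q A s hs.r1 hs.r7 hs.r9 hs.w5 hA rfl
    (by rw [hs.ra]; exact arrays_zero _ _ _ _ _)) le_rfl ?_)
  rintro s₁ ⟨e1, e2, e3, e4⟩
  refine .seq ?_
  have hop : Runs M (if EvenCorner E then Op.rmov 4 3 else Op.rsub 4 9 3 : Op) 1 s₁ fun s' =>
      Frame s₁ s' ∧ s'.r 4 = cornerWeight y E := by
    unfold cornerWeight
    split_ifs
    · refine .rmov ⟨⟨rfl, rfl, rfl, fun x h4 h5 => by simp [h4]⟩, ?_⟩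
      simp [e3 3, h3]
    · refine .rsub ⟨⟨rfl, rfl, rfl, fun x h4 h5 => by simp [h4]⟩, ?_⟩
      simp [e3 3, e3 9, hs.r9, h3]
  refine .mono hop le_rfl ?_
  rintro s₂ ⟨hf, h4⟩
  refine .seq (.mono (runs_storeProg M le_rfl hB inp l q s₂ (by rw [hf.w, e1, hs.w5]) ?_
      (by rw [hf.ra, e4])) le_rfl ?_)
  · rw [h4, component, dif_neg (by omega), if_pos rfl]
  rintro s₃ ⟨f1, f2, f3, f4⟩
  have g1 : s₃.w = s.w := by rw [f1, hf.w, e1]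
  have g2 : ∀ x, x ≠ 4 → x ≠ 5 → s₃.r x = s.r x := fun x h4 h5 => by
    rw [f3, hf.r x h4 h5, e3 x h4 h5]
  have hbase : Base B n b l.length Q S (arrays B inp (l ++ [q]) 0 0) s₃ :=
    hs.toBase.of_frame (by omega) g1 (by rw [f2, hf.wa, e2])
      (by rw [f4]; exact arrays_full _ _ _ _ _) fun x _ h4 h5 _ => g2 x h4 h5
  refine .wadd ?_ ⟨⟨?_⟩, ?_, fun x hx => ?_⟩
  · rw [hbase.w5, hbase.w9]; exact hM
  · exact {
      w0 := by simp [hbase.w0]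
      w1 := by simp [hbase.w1]
      w5 := by simp [hbase.w5, hbase.w9]
      w9 := by simp [hbase.w9]
      r1 := hbase.r1
      r2 := hbase.r2
      r6 := hbase.r6
      r7 := hbase.r7
      r9 := hbase.r9
      wa := hbase.wa
      ra := hbase.ra
      hw := fun x => by rw [State.updW_w, Function.update_of_ne (by omega), hbase.hw]
      hr := hbase.hr }
  · simp [g2 3, h3]
  · simp [hx, g1]

noncomputable def cornersProg (seq : Fin d → Bool → ℕ → ℕ) (B : ℕ) (τ : Table d) :
    List (Fin d → Bool) → Prog
  | [] => Op.skip
  | E :: es => cornerProg seq B τ E ;; cornersProg seq B τ es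

theorem runs_cornersProg (seq : Fin d → Bool → ℕ → ℕ) (B : ℕ) (hB : d + 2 ≤ B) (hB' : 11 ≤ B)
    (τ : Table d) (es : List (Fin d → Bool)) :
    ∃ T, ∀ (M n b : ℕ) (_ : 0 < b) (Q S y : ℝ) (inp : ℕ → ℝ) (l : List (Point d)) (A : ℕ → ℕ)
      (s : State) (_ : Written B n b Q S inp l s) (_ : s.r 3 = y)
      (_ : ∀ δ ∈ τ.reads seq, s.w (11 + δ) = A δ) (_ : l.length + es.length < M),
      Runs M (cornersProg seq B τ es) T s fun s' =>
        Written B n b Q S inp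
          (l ++ es.map fun E => (cornerCoord seq b τ A E, cornerWeight y E)) s' ∧
        ∀ x, x ≠ 5 → s'.w x = s.w x := by
  induction es with
  | nil =>
    exact ⟨1, fun M n b _ Q S y inp l A s hs _ _ _ => .skip ⟨by simpa using hs, fun _ _ => rfl⟩⟩
  | cons E es ih =>
    obtain ⟨T, ih⟩ := ih
    obtain ⟨T', h⟩ := runs_cornerProg seq B hB hB' τ E
    refine ⟨T' + T, fun M n b hb Q S y inp l A s hs h3 hA hM => .seq ?_⟩
    rw [List.length_cons] at hM
    refine .mono (h M n b hb Q S y inp l A s hs h3 hA (by omega)) le_rfl ?_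
    rintro s₁ ⟨e1, e2, e3⟩
    refine .mono (ih M n b hb Q S y inp _ A s₁ e1 e2 (fun δ hδ => ?_) ?_) le_rfl ?_
    · rw [e3 _ (by omega), hA δ hδ]
    · simp; omega
    · rintro s₂ ⟨f1, f2⟩
      refine ⟨by simpa using f1, fun x hx => by rw [f2 x hx, e3 x hx]⟩

theorem Written.updW {B n b : ℕ} {Q S : ℝ} {inp : ℕ → ℝ} {l : List (Point d)} {s : State}
    (h : Written B n b Q S inp l s) {x : ℕ} (v : ℕ) (hx : x < B) (h0 : x ≠ 0) (h1 : x ≠ 1)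
    (h5 : x ≠ 5) (h9 : x ≠ 9) : Written B n b Q S inp l (s.updW x v) :=
  ⟨h.toBase.updW v hx h0 h1 h5 h9⟩

theorem Written.setR {B n b : ℕ} {Q S : ℝ} {inp : ℕ → ℝ} {l : List (Point d)} {s : State}
    (h : Written B n b Q S inp l s) {x : ℕ} (v : ℝ) (hx : x = 3 ∨ x = 4 ∨ x = 5 ∨ x = 8) (hB : 8 < B) :
    Written B n b Q S inp l (s.setR x v) :=
  ⟨h.toBase.of_frame hB rfl rfl h.ra fun y h3 h4 h5 h8 => by
    rw [State.setR_r, Function.update_of_ne (by omega)]⟩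

/-- Put the digits of register `4` into the registers that belong to `l`. -/
def decodeProg : List ℕ → Prog
  | [] => Op.skip
  | δ :: l => Op.wdiv 6 4 1 ;; Op.wmul 10 6 1 ;; Op.wsub (11 + δ) 4 10 ;; Op.wmov 4 6 ;; decodeProg l

theorem runs_decodeProg {B M n b : ℕ} (hB : 11 ≤ B) (hb : 0 < b) {Q S : ℝ}
    {inp : ℕ → ℝ} {pts : List (Point d)} {l : List ℕ} (hl : l.Nodup) (hlB : ∀ δ ∈ l, 11 + δ < B)
    {c : ℕ} {s : State} (hs : Written B n b Q S inp pts s) (h4 : s.w 4 = c) (hc : c < M) :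
    Runs M (decodeProg l) (l.length * 4 + 1) s fun s' =>
      Written B n b Q S inp pts s' ∧ (∀ δ ∈ l, s'.w (11 + δ) = assign b l c δ) ∧
      ∀ x, x ≠ 4 → x ≠ 6 → x ≠ 10 → (∀ δ ∈ l, x ≠ 11 + δ) → s'.w x = s.w x := by
  induction l generalizing s c with
  | nil => exact .mono (.skip ⟨hs, by simp, fun _ _ _ _ _ => rfl⟩) (by simp) fun _ h => h
  | cons δ l ih =>
    rw [List.nodup_cons] at hl
    have hδB := hlB δ (by simp)
    have hdiv : c / b ≤ c := Nat.div_le_self _ _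
    have hmul : c / b * b ≤ c := Nat.div_mul_le_self c b
    refine .mono (.seq (T := 1) (T' := 1 + (1 + (1 + (l.length * 4 + 1)))) (.wdiv (by rw [hs.w1]; omega)
      (by rw [h4, hs.w1]; omega) (.seq (.wmul ?_ (.seq (.wsub ?_ (.seq (.wmov ?_ ?_)))))))) ?_
      fun _ h => h
    · simp [h4, hs.w1]; omega
    · simp [h4, hs.w1]; omega
    · simp [h4, hs.w1, show 6 ≠ 11 + δ by omega]; omega
    · simp only [h4, hs.w1, State.updW_w, Function.update_self, ne_eq,
        Function.update_of_ne (show (1 : ℕ) ≠ 6 by omega),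
        Function.update_of_ne (show (6 : ℕ) ≠ 10 by omega),
        Function.update_of_ne (show (4 : ℕ) ≠ 10 by omega),
        Function.update_of_ne (show (4 : ℕ) ≠ 6 by omega),
        Function.update_of_ne (show (6 : ℕ) ≠ 11 + δ by omega)]
      have hw := (((hs.updW (x := 6) (c / b) (by omega) (by omega) (by omega) (by omega)
        (by omega)).updW (x := 10) (c / b * b) (by omega) (by omega) (by omega) (by omega)
        (by omega)).updW (x := 11 + δ) (c - c / b * b) (by omega) (by omega) (by omega) (by omega)
        (by omega)).updW (x := 4) (c / b) (by omega) (by omega) (by omega) (by omega) (by omega)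
      refine .mono (ih hl.2 (fun γ hγ => hlB γ (by simp [hγ])) hw (c := c / b) (by simp)
        (by omega)) le_rfl ?_
      rintro s₁ ⟨e1, e2, e3⟩
      refine ⟨e1, fun γ hγ => ?_, fun x h4 h6 h10 hx => ?_⟩
      · have hmod : c - c / b * b = c % b := by
          have := Nat.div_add_mod c b
          rw [mul_comm] at this
          omega
        by_cases hγδ : γ = δ
        · subst hγδ
          rw [e3 (11 + γ) (by omega) (by omega) (by omega) fun δ' hδ' e => hl.1 (by
            obtain rfl : γ = δ' := by omega
            exact hδ')]
          simp only [assign, Function.update_self, State.updW_w, hmod,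
            Function.update_of_ne (show 11 + γ ≠ 4 by omega)]
        · have hγl : γ ∈ l := by simpa [hγδ] using hγ
          rw [e2 γ hγl]
          simp [assign, Function.update_of_ne hγδ]
      · rw [e3 x h4 h6 h10 fun γ hγ => hx γ (by simp [hγ])]
        simp only [State.updW_w]
        rw [Function.update_of_ne h4, Function.update_of_ne (hx δ (by simp)),
          Function.update_of_ne h10, Function.update_of_ne h6]
    · simp only [List.length_cons]; omega

theorem updW_updW (s : State) (x v v' : ℕ) : (s.updW x v).updW x v' = s.updW x v' := by
  simp [State.updW]

/-- Put the number with digits `off, …, off + D - 1` into register `x`. -/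
def vertProg (x : ℕ) : ℕ → ℕ → Prog
  | 0, _ => Op.wconst x 0
  | D + 1, off => vertProg x D (off + 1) ;; Op.wmul x x 1 ;; Op.wadd x x (11 + off)

/-- Horner's scheme does not overflow: all intermediate results are below `b ^ D`. -/
theorem runs_vertProg {M b x : ℕ} (hx : x < 11) (hx1 : x ≠ 1) (hb : 0 < b) {A : ℕ → ℕ} {D off : ℕ}
    {s : State} (hM : b ^ D < M) (h1 : s.w 1 = b) (hA : ∀ i < D, s.w (11 + (off + i)) = A (off + i))
    (hAb : ∀ i < D, A (off + i) < b) :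
    Runs M (vertProg x D off) (D * 2 + 1) s fun s' => s' = s.updW x (vert b A D off) := by
  induction D generalizing off with
  | zero => exact .mono (Q := fun s' => s' = s.updW x 0) (.wconst (by omega) rfl) (by omega) fun _ h => h
  | succ D ih =>
    have hpow : b ^ D ≤ b ^ (D + 1) := Nat.pow_le_pow_right hb (by omega)
    refine .mono (.seq (T' := 2) (.mono (ih (off := off + 1) (by omega) (fun i hi => ?_)
      (fun i hi => ?_)) le_rfl ?_)) (by omega) fun _ h => h
    · have := hA (i + 1) (by omega)
      rwa [add_comm i, ← add_assoc off] at this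
    · have := hAb (i + 1) (by omega)
      rwa [add_comm i, ← add_assoc] at this
    · rintro _ rfl
      have hlt := vert_lt (D + 1) off hAb
      have h0 := hA 0 (by omega)
      rw [add_zero] at h0
      simp only [vert] at hlt ⊢
      refine .seq (T := 1) (T' := 1) (.wmul ?_ (.wadd ?_ ?_))
      · simp [hx1.symm, h1]; omega
      · simp [hx1.symm, h1, h0, show 11 + off ≠ x by omega]; omega
      · rw [updW_updW, updW_updW]
        simp [hx1.symm, h1, h0, show 11 + off ≠ x by omega]

/-- Put `b ^ j` into register `x`. -/
def powProg (x : ℕ) : ℕ → Prog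
  | 0 => Op.wconst x 1
  | j + 1 => powProg x j ;; Op.wmul x x 1

theorem runs_powProg {M b x : ℕ} (hx1 : x ≠ 1) (hb : 0 < b) {j : ℕ} {s : State} (hM : b ^ j < M)
    (h1 : s.w 1 = b) : Runs M (powProg x j) (j + 1) s fun s' => s' = s.updW x (b ^ j) := by
  induction j with
  | zero => exact .wconst (by simpa using hM) (by simp)
  | succ j ih =>
    have hpow : b ^ j ≤ b ^ (j + 1) := Nat.pow_le_pow_right hb (by omega)
    refine .seq (.mono (ih (by omega)) le_rfl ?_)
    rintro _ rfl
    have e : (s.updW x (b ^ j)).w x * (s.updW x (b ^ j)).w 1 = b ^ (j + 1) := by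
      simp [hx1.symm, h1, pow_succ]
    exact .wmul (by rw [e]; exact hM) (by rw [e, updW_updW])

/-- Put the value of an item into register `3` and write its points, once its digits are decoded. -/
noncomputable def valueProg (seq : Fin d → Bool → ℕ → ℕ) (D B : ℕ) (x : Item d) : Prog :=
  match x.2 with
  | none => Op.rmov 3 2 ;; cornersProg seq B x.1 Finset.univ.toList
  | some (u, v) => vertProg 7 D (u * D) ;; vertProg 8 D (v * D) ;;
      .branch (.wlt 7 8)
        (.branch (.wlt 8 0)
          (Op.wmul 6 7 0 ;; Op.wadd 6 6 8 ;; Op.rload 3 0 6 ;; Op.radd 3 2 3 ;;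
            cornersProg seq B x.1 Finset.univ.toList) Op.skip) Op.skip

/-- The points that an item contributes if it reads the digits `A`. -/
noncomputable def valuePoints (seq : Fin d → Bool → ℕ → ℕ) (D b n : ℕ) (w : ℕ → ℕ → ℝ) (Q : ℝ)
    (x : Item d) (A : ℕ → ℕ) : List (Point d) :=
  match itemValue D b n w Q A x.2 with
  | none => []
  | some y => corners seq b x.1 A y

/-- The digits can spell a number that is not a vertex, since `b ^ D` may exceed `n`. Both
conditions of `itemValue` are therefore tested at run time, and the matrix entry is loaded only
after they have been confirmed. -/
theorem runs_valueProg (Δ : Design d k D U) {B : ℕ} (hB : d + 2 ≤ B) (hB' : 11 ≤ B) {x : Item d}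
    (hx : x ∈ Δ.items) :
    ∃ T, ∀ (M n b : ℕ) (_ : 0 < b) (_ : b ^ D < M) (_ : n * n < M) (Q S : ℝ) (inp : ℕ → ℝ)
      (w : ℕ → ℕ → ℝ) (_ : ∀ i j, i < n → j < n → inp (i * n + j) = w i j)
      (l : List (Point d)) (A : ℕ → ℕ) (s : State) (_ : Written B n b Q S inp l s)
      (_ : ∀ δ, A δ < b) (_ : ∀ δ ∈ x.1.reads Δ.seq, s.w (11 + δ) = A δ)
      (_ : (l ++ valuePoints Δ.seq D b n w Q x A).length < M),
      Runs M (valueProg Δ.seq D B x) T s fun s' =>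
        Written B n b Q S inp (l ++ valuePoints Δ.seq D b n w Q x A) s' ∧
        s'.w 2 = s.w 2 ∧ s'.w 3 = s.w 3 := by
  obtain ⟨T, hT⟩ := runs_cornersProg Δ.seq B hB hB' x.1 Finset.univ.toList
  obtain ⟨τ, o⟩ := x
  match o with
  | none =>
    refine ⟨1 + T, fun M n b hb _ _ Q S inp w _ l A s hs hA hdig hM => .seq (.rmov ?_)⟩
    simp only [valuePoints, itemValue, corners] at hM ⊢
    refine .mono (hT M n b hb Q S Q inp l A _ (hs.setR _ (.inl rfl) (by omega)) (by simp [hs.r2])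
      hdig (by simpa using hM)) le_rfl ?_
    rintro s₁ ⟨e1, e2⟩
    exact ⟨e1, e2 2 (by omega), e2 3 (by omega)⟩
  | some (u, v) =>
    obtain ⟨huv, hvk⟩ : u < v ∧ v < k := by
      obtain ⟨-, h⟩ | ⟨u', v', h1, h2, h3⟩ := Design.mem_items.1 hx
      · simp at h
      · simp only [Prod.mk.injEq, Option.some.injEq] at h3
        obtain ⟨-, rfl, rfl⟩ := h3
        exact ⟨h1, h2⟩
    obtain rfl : τ = Δ.pairTable u v := by
      obtain ⟨-, h⟩ | ⟨u', v', h1, h2, h3⟩ := Design.mem_items.1 hx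
      · simp at h
      · simp only [Prod.mk.injEq, Option.some.injEq] at h3
        obtain ⟨rfl, rfl, rfl⟩ := h3
        rfl
    refine ⟨(D * 2 + 1) + ((D * 2 + 1) + ((1 + (1 + (1 + (1 + T))) + 1 + 1) + 1 + 1)),
      fun M n b hb hbM hnM Q S inp w hw l A s hs hA hdig hM => .seq ?_⟩
    refine .mono (runs_vertProg (by omega) (by omega) hb hbM hs.w1
      (fun i hi => hdig _ (Δ.covers_left u v huv hvk i hi)) fun i _ => hA _) le_rfl ?_
    rintro _ rfl
    have hs1 := hs.updW (x := 7) (vert b A D (u * D)) (by omega) (by omega) (by omega) (by omega)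
      (by omega)
    refine .seq (.mono (runs_vertProg (x := 8) (A := A) (by omega) (by omega) hb hbM hs1.w1
      (fun i hi => ?_) fun i _ => hA _) le_rfl ?_)
    · rw [State.updW_w, Function.update_of_ne (by omega)]
      exact hdig _ (Δ.covers_right u v huv hvk i hi)
    rintro _ rfl
    have hs2 := hs1.updW (x := 8) (vert b A D (v * D)) (by omega) (by omega) (by omega) (by omega)
      (by omega)
    set s2 := (s.updW 7 (vert b A D (u * D))).updW 8 (vert b A D (v * D)) with hs2def
    have h7 : s2.w 7 = vert b A D (u * D) := by simp [hs2def]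
    have h8 : s2.w 8 = vert b A D (v * D) := by simp [hs2def]
    have h2 : s2.w 2 = s.w 2 := by simp [hs2def]
    have h3 : s2.w 3 = s.w 3 := by simp [hs2def]
    have hdig2 : ∀ δ ∈ (Δ.pairTable u v).reads Δ.seq, s2.w (11 + δ) = A δ := by
      intro δ hδ
      simp only [hs2def, State.updW_w]
      rw [Function.update_of_ne (by omega), Function.update_of_ne (by omega), hdig δ hδ]
    set a := vert b A D (u * D) with ha
    set c := vert b A D (v * D) with hc
    refine .branch (T := 1 + (1 + (1 + (1 + T))) + 1 + 1) (T' := 1) (fun hlt => .branch (T' := 1)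
      (T := 1 + (1 + (1 + (1 + T)))) (fun hcn => ?_) fun hcn => ?_) fun hlt => ?_
    · simp only [Test.Holds, h7, h8, hs2.w0] at hlt hcn
      have hval : valuePoints Δ.seq D b n w Q (Δ.pairTable u v, some (u, v)) A =
          corners Δ.seq b (Δ.pairTable u v) A (Q + w a c) := by
        simp [valuePoints, itemValue, ← ha, ← hc, hlt, hcn]
      rw [hval] at hM ⊢
      have hlin : a * n + c < n * n := by
        calc a * n + c < a * n + n := by omega
          _ = (a + 1) * n := by ring
          _ ≤ n * n := Nat.mul_le_mul_right _ (by omega)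
      refine .seq (.wmul ?_ (.seq (.wadd ?_ (.seq (.rload (.seq (.radd ?_)))))))
      · rw [h7, hs2.w0]; omega
      · simp [h7, h8, hs2.w0]; omega
      · have hs3 := (hs2.updW (x := 6) (a * n) (by omega) (by omega) (by omega) (by omega)
          (by omega)).updW (x := 6) (a * n + c) (by omega) (by omega) (by omega) (by omega) (by omega)
        simp only [h7, h8, hs2.w0, State.updW_w, Function.update_self,
          Function.update_of_ne (show (8 : ℕ) ≠ 6 by omega)]
        refine .mono (hT M n b hb Q S (Q + w a c) inp l A _
          ((hs3.setR _ (.inl rfl) (by omega)).setR _ (.inl rfl) (by omega)) ?_ ?_ ?_) le_rfl ?_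
        · have hin : s2.ra 0 = inp := by rw [hs2.ra]; rfl
          simp [hs2.r2, hin, hw a c (hlt.trans hcn) hcn]
        · intro δ hδ
          simp only [State.setR_w, State.updW_w]
          rw [Function.update_of_ne (by omega), Function.update_of_ne (by omega), hdig2 δ hδ]
        · simpa [corners] using hM
        · rintro s₁ ⟨e1, e2⟩
          refine ⟨e1, ?_, ?_⟩
          · rw [e2 2 (by omega)]; simp [h2]
          · rw [e2 3 (by omega)]; simp [h3]
    · simp only [Test.Holds, h7, h8, hs2.w0] at hlt hcn
      have hval : valuePoints Δ.seq D b n w Q (Δ.pairTable u v, some (u, v)) A = [] := by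
        simp [valuePoints, itemValue, ← ha, ← hc, hlt, hcn]
      rw [hval, List.append_nil]
      exact .skip ⟨hs2, h2, h3⟩
    · simp only [Test.Holds, h7, h8] at hlt
      have hval : valuePoints Δ.seq D b n w Q (Δ.pairTable u v, some (u, v)) A = [] := by
        simp [valuePoints, itemValue, ← ha, ← hc, hlt]
      rw [hval, List.append_nil]
      exact .skip ⟨hs2, h2, h3⟩

/-- Write all points of an item. -/
noncomputable def itemProg (seq : Fin d → Bool → ℕ → ℕ) (D B : ℕ) (x : Item d) : Prog :=
  powProg 2 (x.1.digits seq).length ;; Op.wconst 3 0 ;;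
    .loop (.wlt 3 2)
      (Op.wmov 4 3 ;; decodeProg (x.1.digits seq) ;; valueProg seq D B x ;; Op.wadd 3 3 9)

/-- The loop runs through the at most `b ^ U` codes of the digits read, with a constant number of
steps for each; the loop counter itself is the code. -/
theorem runs_itemProg (Δ : Design d k D U) {B : ℕ} (hB : d + 2 ≤ B) (hB' : 11 ≤ B) {x : Item d}
    (hx : x ∈ Δ.items) (hxB : ∀ δ ∈ x.1.digits Δ.seq, 11 + δ < B) :
    ∃ T, ∀ (M n b : ℕ) (_ : 0 < b) (_ : b ^ D < M) (_ : b ^ U < M) (_ : n * n < M)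
      (Q S : ℝ) (inp : ℕ → ℝ)
      (w : ℕ → ℕ → ℝ) (_ : ∀ i j, i < n → j < n → inp (i * n + j) = w i j)
      (l : List (Point d)) (s : State) (_ : Written B n b Q S inp l s)
      (_ : (l ++ itemPoints Δ.seq D b n w Q x).length < M),
      Runs M (itemProg Δ.seq D B x) (T * b ^ U) s fun s' =>
        Written B n b Q S inp (l ++ itemPoints Δ.seq D b n w Q x) s' := by
  obtain ⟨T, hT⟩ := runs_valueProg Δ hB hB' hx
  obtain ⟨L, hL⟩ : ∃ L, L = (x.1.digits Δ.seq).length := ⟨_, rfl⟩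
  refine ⟨(L + 1) + (1 + (((1 + ((L * 4 + 1) + (T + 1))) + 1) + 1)),
    fun M n b hb hDM hUM hnM Q S inp w hw l s hs hM => ?_⟩
  unfold itemProg
  unfold itemPoints at hM ⊢
  rw [← hL] at hM ⊢
  have hLU : b ^ L ≤ b ^ U := by
    refine Nat.pow_le_pow_right hb ?_
    rw [hL, Table.digits, Finset.length_toList]
    exact Δ.card_reads hx
  refine .mono (T := (L + 1) + (1 + (b ^ L * ((1 + ((L * 4 + 1) + (T + 1))) + 1) + 1))) ?_ ?_
    fun _ h => h
  swap
  · have h1 : 1 ≤ b ^ U := Nat.one_le_pow _ _ hb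
    nlinarith [Nat.mul_le_mul_right ((1 + ((L * 4 + 1) + (T + 1))) + 1) hLU]
  refine .seq (.mono (runs_powProg (x := 2) (by omega) hb (by omega) hs.w1) le_rfl ?_)
  rintro _ rfl
  refine .seq (.wconst (by omega) ?_)
  have hs1 := (hs.updW (x := 2) (b ^ L) (by omega) (by omega) (by omega) (by omega)
    (by omega)).updW (x := 3) 0 (by omega) (by omega) (by omega) (by omega) (by omega)
  obtain ⟨pts, hpts⟩ : ∃ pts : ℕ → List (Point d), pts = fun i =>
    l ++ (List.range i).flatMap (cellPoints Δ.seq D b n w Q x) := ⟨_, rfl⟩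
  have hpts_succ : ∀ i, pts (i + 1) =
      pts i ++ valuePoints Δ.seq D b n w Q x (assign b (x.1.digits Δ.seq) i) := by
    intro i
    simp only [hpts, List.range_succ, List.flatMap_append, List.append_assoc]
    simp only [valuePoints, cellPoints, List.flatMap_cons, List.flatMap_nil, List.append_nil]
  have hpts_len : ∀ i j, i ≤ j → (pts i).length ≤ (pts j).length := by
    intro i j hij
    induction hij with
    | refl => exact le_rfl
    | step _ ih => rw [hpts_succ, List.length_append]; omega
  have hpts_end : (pts (b ^ L)).length < M := by rw [hpts]; exact hM
  refine .mono (.loop (fun i s => Written B n b Q S inp (pts i) s ∧ s.w 2 = b ^ L ∧ s.w 3 = i)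
    (b ^ L) ⟨by simpa [hpts] using hs1, by simp, by simp⟩ ?_ ?_ ?_) le_rfl ?_
  · rintro i hi s' ⟨-, h2, h3⟩
    simp only [Test.Holds, h2, h3]; exact hi
  · rintro s' ⟨-, h2, h3⟩
    simp only [Test.Holds, h2, h3]; omega
  · rintro i hi s' ⟨hs', h2, h3⟩
    refine .seq (.wmov (by omega) (.seq ?_))
    have hs4 := hs'.updW (x := 4) (s'.w 3) (by omega) (by omega) (by omega) (by omega) (by omega)
    refine .mono (runs_decodeProg hB' hb (Finset.nodup_toList _) hxB hs4 (c := i)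
      (by simp [h3]) (by omega)) (by rw [hL]; exact le_rfl) ?_
    rintro s₁ ⟨e1, e2, e3⟩
    have hlen := hpts_len (i + 1) (b ^ L) hi
    refine .seq (.mono (hT M n b hb hDM hnM Q S inp w hw (pts i) (assign b (x.1.digits Δ.seq) i) s₁ e1
      (fun δ => assign_lt hb _ _ _) (fun δ hδ => e2 δ (Finset.mem_toList.2 hδ)) ?_) le_rfl ?_)
    · rw [← hpts_succ]; omega
    · rintro s₂ ⟨f1, f2, f3⟩
      rw [← hpts_succ] at f1
      have g2 : s₂.w 2 = b ^ L := by
        rw [f2, e3 2 (by omega) (by omega) (by omega) (by omega)]; simp [h2]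
      have g3 : s₂.w 3 = i := by
        rw [f3, e3 3 (by omega) (by omega) (by omega) (by omega)]; simp [h3]
      refine .wadd ?_ ⟨?_, ?_, ?_⟩
      · rw [g3, f1.w9]; omega
      · exact f1.updW _ (by omega) (by omega) (by omega) (by omega) (by omega)
      · simp [g2]
      · simp [g3, f1.w9]
  · rintro s' ⟨hs', -⟩
    rw [hpts] at hs'
    exact hs'

noncomputable def itemsProg (seq : Fin d → Bool → ℕ → ℕ) (D B : ℕ) : List (Item d) → Prog
  | [] => Op.skip
  | x :: xs => itemProg seq D B x ;; itemsProg seq D B xs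

theorem runs_itemsProg (Δ : Design d k D U) {B : ℕ} (hB : d + 2 ≤ B) (hB' : 11 ≤ B)
    {xs : List (Item d)} (hxs : ∀ x ∈ xs, x ∈ Δ.items ∧ ∀ δ ∈ x.1.digits Δ.seq, 11 + δ < B) :
    ∃ T, ∀ (M n b : ℕ) (_ : 0 < b) (_ : b ^ D < M) (_ : b ^ U < M) (_ : n * n < M)
      (Q S : ℝ) (inp : ℕ → ℝ)
      (w : ℕ → ℕ → ℝ) (_ : ∀ i j, i < n → j < n → inp (i * n + j) = w i j)
      (l : List (Point d)) (s : State) (_ : Written B n b Q S inp l s)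
      (_ : (l ++ xs.flatMap (itemPoints Δ.seq D b n w Q)).length < M),
      Runs M (itemsProg Δ.seq D B xs) (T * b ^ U) s fun s' =>
        Written B n b Q S inp (l ++ xs.flatMap (itemPoints Δ.seq D b n w Q)) s' := by
  induction xs with
  | nil =>
    refine ⟨1, fun M n b hb _ _ _ Q S inp w _ l s hs _ => ?_⟩
    exact .mono (.skip (by simpa using hs)) (by simpa using Nat.one_le_pow _ _ hb) fun _ h => h
  | cons x xs ih =>
    obtain ⟨T, ih⟩ := ih fun y hy => hxs y (by simp [hy])
    obtain ⟨T', h⟩ := runs_itemProg Δ hB hB' (hxs x (by simp)).1 (hxs x (by simp)).2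
    refine ⟨T' + T, fun M n b hb hDM hUM hnM Q S inp w hw l s hs hM => ?_⟩
    rw [add_mul]
    rw [List.flatMap_cons, ← List.append_assoc] at hM ⊢
    refine .seq (.mono (h M n b hb hDM hUM hnM Q S inp w hw l s hs ?_) le_rfl ?_)
    · rw [List.length_append] at hM; omega
    · intro s₁ e1
      exact ih M n b hb hDM hUM hnM Q S inp w hw _ s₁ e1 hM

/-! ### Initialization -/

/-- The memory during the initialization. -/
structure Init (n : ℕ) (inp : ℕ → ℕ → ℝ) (s : State) : Prop where
  w0 : s.w 0 = n
  w5 : s.w 5 = 0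
  w9 : s.w 9 = 1
  r7 : s.r 7 = 1
  r9 : s.r 9 = 0
  wa : s.wa = fun _ _ => 0
  ra : s.ra = inp
  hw : ∀ x, 11 ≤ x → s.w x = 0
  hr : ∀ x, 11 ≤ x → s.r x = 0

theorem Init.updW {n : ℕ} {inp : ℕ → ℕ → ℝ} {s : State} (h : Init n inp s) {x : ℕ} (v : ℕ)
    (hx : x < 11) (h0 : x ≠ 0) (h5 : x ≠ 5) (h9 : x ≠ 9) : Init n inp (s.updW x v) where
  w0 := by simp [h0.symm, h.w0]
  w5 := by simp [h5.symm, h.w5]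
  w9 := by simp [h9.symm, h.w9]
  r7 := h.r7
  r9 := h.r9
  wa := h.wa
  ra := h.ra
  hw y hy := by rw [State.updW_w, Function.update_of_ne (by omega), h.hw y hy]
  hr := h.hr

theorem Init.setR {n : ℕ} {inp : ℕ → ℕ → ℝ} {s : State} (h : Init n inp s) {x : ℕ} (v : ℝ)
    (hx : x < 11) (h7 : x ≠ 7) (h9 : x ≠ 9) : Init n inp (s.setR x v) where
  w0 := h.w0
  w5 := h.w5
  w9 := h.w9
  r7 := by simp [h7.symm, h.r7]
  r9 := by simp [h9.symm, h.r9]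
  wa := h.wa
  ra := h.ra
  hw := h.hw
  hr y hy := by rw [State.setR_r, Function.update_of_ne (by omega), h.hr y hy]

/-- Put the least `b` with `n ≤ b ^ D` into word register `1`. -/
def baseProg (D : ℕ) : Prog :=
  Op.wconst 9 1 ;; Op.rcast 7 9 ;; Op.wconst 1 1 ;; Op.wconst 2 1 ;;
    .loop (.wlt 2 0) (Op.wadd 1 1 9 ;; powProg 2 D)

/-- The input memory of an instance of Max-Weight Clique. -/
def inputState (n : ℕ) (inp : ℕ → ℕ → ℝ) : State where
  w x := if x = 0 then n else 0
  r _ := 0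
  wa _ _ := 0
  ra := inp

/-- The base is found by trying `1, 2, 3, …`; the real RAM has no roots, and `b` rounds are
affordable. -/
theorem runs_baseProg {M n b D : ℕ} (hD : 0 < D) (hb : 0 < b) (hn : n ≤ b ^ D)
    (hleast : ∀ b' < b, b' ^ D < n) (hM : b ^ D < M) (inp : ℕ → ℕ → ℝ) :
    Runs M (baseProg D) (b * (D + 3) + 5) (inputState n inp) fun s =>
      Init n inp s ∧ s.w 1 = b ∧ s.r 6 = 0 := by
  have hbD : b ≤ b ^ D := Nat.le_self_pow (by omega) b
  refine .mono (.seq (T := 1) (T' := 1 + (1 + (1 + ((b - 1) * ((1 + (D + 1)) + 1) + 1))))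
    (.wconst (by omega) (.seq (.rcast (.seq (.wconst (by omega) (.seq (.wconst (by omega) ?_))))))))
    ?_ fun _ h => h
  · refine .mono (.loop (fun i s => Init n inp s ∧ s.w 1 = 1 + i ∧ s.w 2 = (1 + i) ^ D ∧ s.r 6 = 0)
      (b - 1) ?_ ?_ ?_ ?_) le_rfl ?_
    · refine ⟨?_, by simp, by simp, by simp [inputState]⟩
      constructor <;> try simp [inputState]
      · intro x hx
        rw [Function.update_of_ne (by omega), Function.update_of_ne (by omega),
          Function.update_of_ne (by omega), if_neg (by omega)]
      · intro x hx
        rw [Function.update_of_ne (by omega)]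
    · rintro i hi s ⟨h1, -, h2, -⟩
      simp only [Test.Holds, h1.w0, h2]
      exact hleast _ (by omega)
    · rintro s ⟨h1, -, h2, -⟩
      simp only [Test.Holds, h1.w0, h2, not_lt]
      rwa [show 1 + (b - 1) = b by omega]
    · rintro i hi s ⟨h1, h2, -, h3⟩
      have hpow : (1 + i + 1) ^ D ≤ b ^ D := Nat.pow_le_pow_left (by omega) D
      refine .seq (.wadd ?_ ?_)
      · rw [h2, h1.w9]; omega
      · rw [h2, h1.w9]
        refine .mono (runs_powProg (b := 1 + i + 1) (by omega) (by omega) (by omega) (by simp))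
          le_rfl ?_
        rintro _ rfl
        exact ⟨(h1.updW _ (by omega) (by omega) (by omega) (by omega)).updW _ (by omega) (by omega)
          (by omega) (by omega), by simp; omega, by simp [add_assoc], h3⟩
    · rintro s ⟨h1, h2, -, h3⟩
      exact ⟨h1, by omega, h3⟩
  · obtain ⟨c, rfl⟩ : ∃ c, b = c + 1 := ⟨b - 1, by omega⟩
    rw [Nat.add_sub_cancel]
    nlinarith

/-- Put the sum of the absolute values of the input into register `6`. -/
def absSumProg : Prog :=
  Op.wmul 2 0 0 ;; Op.wconst 3 0 ;;
    .loop (.wlt 3 2) (Op.rload 3 0 3 ;; .branch (.rlt 3 9) (Op.rsub 6 6 3) (Op.radd 6 6 3) ;;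
      Op.wadd 3 3 9)

theorem runs_absSumProg {M n b : ℕ} {inp : ℕ → ℕ → ℝ} (hM : n * n < M) {s : State}
    (hs : Init n inp s) (h1 : s.w 1 = b) (h6 : s.r 6 = 0) :
    Runs M absSumProg (n * n * 6 + 3) s fun s' =>
      Init n inp s' ∧ s'.w 1 = b ∧ s'.r 6 = ∑ i ∈ Finset.range (n * n), |inp 0 i| := by
  refine .mono (.seq (T := 1) (T' := 1 + (n * n * ((1 + ((1 + 1 + 1) + 1)) + 1) + 1))
    (.wmul (by rwa [hs.w0]) (.seq (.wconst (by omega) ?_)))) (by omega) fun _ h => h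
  refine .mono (.loop (fun i s => Init n inp s ∧ s.w 1 = b ∧ s.w 2 = n * n ∧ s.w 3 = i ∧
      s.r 6 = ∑ i ∈ Finset.range i, |inp 0 i|) (n * n) ?_ ?_ ?_ ?_) le_rfl ?_
  · exact ⟨(hs.updW _ (by omega) (by omega) (by omega) (by omega)).updW _ (by omega) (by omega)
      (by omega) (by omega), by simp [h1], by simp [hs.w0], by simp, by simp [h6]⟩
  · rintro i hi s ⟨-, -, h2, h3, -⟩
    simp only [Test.Holds, h2, h3]; exact hi
  · rintro s ⟨-, -, h2, h3, -⟩
    simp only [Test.Holds, h2, h3]; omega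
  · rintro i hi s ⟨hs, h1, h2, h3, h6⟩
    refine .seq (T := 1) (T' := 3 + 1) (.rload (.seq (T := 3) (T' := 1) ?_))
    have h0 : s.ra 0 (s.w 3) = inp 0 i := by rw [hs.ra, h3]
    rw [h0]
    have hs1 := hs.setR (x := 3) (inp 0 i) (by omega) (by omega) (by omega)
    have key : ∀ v : ℝ, v = ∑ i ∈ Finset.range (i + 1), |inp 0 i| →
        Runs M (Op.wadd 3 3 9) 1 ((s.setR 3 (inp 0 i)).setR 6 v) fun s =>
          Init n inp s ∧ s.w 1 = b ∧ s.w 2 = n * n ∧ s.w 3 = i + 1 ∧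
            s.r 6 = ∑ i ∈ Finset.range (i + 1), |inp 0 i| := by
      intro v hv
      refine .wadd ?_ ?_
      · simp [h3, hs.w9]; omega
      · exact ⟨(hs1.setR _ (by omega) (by omega) (by omega)).updW _ (by omega) (by omega)
          (by omega) (by omega), by simp [h1], by simp [h2], by simp [h3, hs.w9], by simp [hv]⟩
    refine .branch (T := 1) (T' := 1) (fun hlt => .rsub (key _ ?_)) fun hlt => .radd (key _ ?_)
    · simp [Test.Holds, hs.r9] at hlt
      simp [h6, Finset.sum_range_succ, abs_of_neg hlt]; ring
    · simp [Test.Holds, hs.r9] at hlt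
      simp [h6, Finset.sum_range_succ, abs_of_nonneg hlt]
  · rintro s ⟨hs, h1, -, -, h6⟩
    exact ⟨hs, h1, h6⟩

/-- Initialize the registers; `m` is the number of items. -/
def initProg (D m : ℕ) : Prog :=
  baseProg D ;; absSumProg ;; Op.rcast 1 1 ;; Op.wconst 6 (2 * m) ;; Op.rcast 4 6 ;;
    Op.rmul 4 4 6 ;; Op.radd 2 7 4

theorem runs_initProg {B M n b D m : ℕ} (hB : 11 ≤ B) (hD : 0 < D) (hb : 0 < b) (hn : n ≤ b ^ D)
    (hleast : ∀ b' < b, b' ^ D < n) (hM : b ^ D < M) (hnM : n * n < M) (hm : 2 * m < M)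
    {inp : ℕ → ℕ → ℝ} (hinp : ∀ a, a ≠ 0 → inp a = fun _ => 0) {S Q : ℝ}
    (hS : S = ∑ i ∈ Finset.range (n * n), |inp 0 i|) (hQ : Q = 1 + 2 * (m * S)) :
    Runs M (initProg D m) (b * (D + 3) + n * n * 6 + 13) (inputState n inp)
      (Written (d := d) B n b Q S (inp 0) []) := by
  refine .mono (.seq (T' := (n * n * 6 + 3) + (1 + (1 + (1 + (1 + 1)))))
    (.mono (runs_baseProg hD hb hn hleast hM inp) le_rfl ?_)) (by omega) fun _ h => h
  rintro s ⟨hs, h1, h6⟩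
  refine .seq (.mono (runs_absSumProg hnM hs h1 h6) le_rfl ?_)
  rintro s ⟨hs, h1, h6⟩
  refine .seq (.rcast (.seq (.wconst hm (.seq (.rcast (.seq (.rmul (.radd ?_))))))))
  have hs' : Init n inp (((((s.setR 1 (s.w 1)).updW 6 (2 * m)).setR 4 ((2 * m : ℕ) : ℝ)).setR 4
      ((2 * m : ℕ) * S)).setR 2 Q) :=
    ((((hs.setR _ (by omega) (by omega) (by omega)).updW _ (by omega) (by omega) (by omega)
      (by omega)).setR _ (by omega) (by omega) (by omega)).setR _ (by omega) (by omega)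
      (by omega)).setR _ (by omega) (by omega) (by omega)
  simp only [State.setR_r, State.updW_r, State.setR_w, State.updW_w, Function.update_self,
    Function.update_of_ne (show (6 : ℕ) ≠ 4 by omega),
    Function.update_of_ne (show (6 : ℕ) ≠ 1 by omega),
    Function.update_of_ne (show (7 : ℕ) ≠ 4 by omega),
    Function.update_of_ne (show (7 : ℕ) ≠ 1 by omega), h6, ← hS, hs.r7]
  have hQ' : 1 + ((2 * m : ℕ) : ℝ) * S = Q := by rw [hQ]; push_cast; ring
  rw [hQ']
  refine ⟨?_⟩
  exact {
    w0 := hs'.w0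
    w1 := by simp [h1]
    w5 := hs'.w5
    w9 := hs'.w9
    r1 := by simp [h1]
    r2 := by simp
    r6 := by simp [h6, ← hS]
    r7 := hs'.r7
    r9 := hs'.r9
    wa := hs'.wa
    ra := by
      rw [hs'.ra]
      funext a p
      by_cases ha : a = 0
      · simp [ha, arrays]
      · rw [hinp a ha]
        simp only [arrays, if_neg ha, Nat.not_lt_zero, if_false]
        split_ifs <;> simp [pointArray]
    hw := fun x => hs'.hw _ (by omega)
    hr := fun x => hs'.hr _ (by omega) }

/-! ### The heavy point at the origin -/

def originProg (d B : ℕ) : Prog :=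
  Op.wadd 6 5 9 ;; Op.rcast 4 6 ;; Op.radd 5 2 6 ;; Op.rmul 4 4 5 ;; Op.rmov 8 4 ;;
    storeProg B d ;; Op.wadd 5 5 9

/-- Entries behind the points written so far are `0`, so the coordinates of the origin are already
in place and only its weight has to be stored. -/
theorem arrays_of_coords_zero (B : ℕ) (inp : ℕ → ℝ) (l : List (Point d)) (W : ℝ) :
    arrays B inp l (0, W) d = arrays B inp l 0 0 := by
  have h : ∀ i < d, pointArray (l ++ [((0 : Fin d → ℝ), W)]) i = pointArray l i := by
    intro i hi
    have h0 : component ((0 : Fin d → ℝ), W) i = pointArray l i l.length := by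
      rw [component, dif_pos hi, pointArray, dif_neg (by omega)]; rfl
    rw [pointArray_append, h0, Function.update_eq_self]
  funext a
  simp only [arrays, Nat.not_lt_zero, if_false]
  split_ifs with h1 h2 h3 h4 h5
  · rfl
  · exact h _ h3
  · rfl
  · exact h _ h5
  · rfl
  · rfl

theorem runs_originProg {B M n b : ℕ} (hB : d + 2 ≤ B) (hB' : 11 ≤ B) {Q S : ℝ} {inp : ℕ → ℝ}
    {l : List (Point d)} {s : State} (hs : Written B n b Q S inp l s) (hM : l.length + 1 < M) :
    Runs M (originProg d B) 8 s fun s' =>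
      Written B n b Q S inp (l ++ [(0, (l.length + 1 : ℕ) * (Q + S))]) s' ∧
        s'.r 8 = (l.length + 1 : ℕ) * (Q + S) := by
  refine .seq (T := 1) (T' := 1 + (1 + (1 + (1 + (2 + 1))))) (.wadd ?_ (.seq (.rcast
    (.seq (.radd (.seq (.rmul (.seq (.rmov (.seq ?_))))))))))
  · rw [hs.w5, hs.w9]; exact hM
  set W : ℝ := (l.length + 1 : ℕ) * (Q + S) with hW
  simp only [State.setR_r, State.updW_r, State.updW_w, Function.update_self, hs.w5,
    hs.w9, hs.r2, hs.r6, Function.update_of_ne (show (2 : ℕ) ≠ 4 by omega),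
    Function.update_of_ne (show (6 : ℕ) ≠ 4 by omega),
    Function.update_of_ne (show (4 : ℕ) ≠ 5 by omega), ← hW]
  have hs1 := ((((hs.updW (x := 6) (l.length + 1) (by omega) (by omega) (by omega) (by omega)
    (by omega)).setR (x := 4) ((l.length + 1 : ℕ) : ℝ) (by omega) (by omega)).setR (x := 5) (Q + S)
    (by omega) (by omega)).setR (x := 4) W (by omega) (by omega)).setR (x := 8) W (by omega) (by omega)
  refine .mono (runs_storeProg M (j := d) le_rfl hB inp l (0, W) _ hs1.w5 ?_ ?_) le_rfl ?_
  · rw [component, dif_neg (by omega), if_pos rfl]; simp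
  · rw [hs1.ra, arrays_of_coords_zero]
  rintro s' ⟨e1, e2, e3, e4⟩
  rw [arrays_full _ _ _ _ 0] at e4
  have hb := hs1.toBase.of_frame (s' := s') (by omega) e1 e2 e4 fun x _ _ _ _ => by rw [e3]
  refine .wadd ?_ ⟨⟨?_⟩, ?_⟩
  · rw [hb.w5, hb.w9]; exact hM
  · exact {
      w0 := by simp [hb.w0]
      w1 := by simp [hb.w1]
      w5 := by simp [hb.w5, hb.w9]
      w9 := by simp [hb.w9]
      r1 := hb.r1
      r2 := hb.r2
      r6 := hb.r6
      r7 := hb.r7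
      r9 := hb.r9
      wa := hb.wa
      ra := hb.ra
      hw := fun x => by rw [State.updW_w, Function.update_of_ne (by omega), hb.hw]
      hr := hb.hr }
  · simp [e3]

/-! ### Evaluation of the box -/

/-- Add register `3` to register `0` if coordinates `0, …, j - 1` of the current point are in the
range given by the box. -/
def checkProg (d B : ℕ) : ℕ → Prog
  | 0 => Op.radd 0 0 3
  | j + 1 => Op.rload 4 (1 + j) 3 ;; .branch (.rlt 4 (j + B)) Op.skip
      (.branch (.rlt (d + j + B) 4) Op.skip (checkProg d B j))

/-- The memory during the evaluation. -/
structure Eval (B : ℕ) (l : List (Point d)) (lo hi : Fin d → ℝ) (Q W : ℝ) (s : State) : Prop where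
  w5 : s.w 5 = l.length
  w9 : s.w 9 = 1
  r2 : s.r 2 = Q
  r8 : s.r 8 = W
  rlo : ∀ i : Fin d, s.r (i + B) = lo i
  rhi : ∀ i : Fin d, s.r (d + i + B) = hi i
  ra : ∀ i ≤ d, s.ra (1 + i) = pointArray l i

theorem Eval.setR {B : ℕ} {l : List (Point d)} {lo hi : Fin d → ℝ} {Q W : ℝ} {s : State}
    (h : Eval B l lo hi Q W s) (hB : 11 ≤ B) {x : ℕ} (v : ℝ) (hx : x < 11) (h2 : x ≠ 2)
    (h8 : x ≠ 8) : Eval B l lo hi Q W (s.setR x v) where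
  w5 := h.w5
  w9 := h.w9
  r2 := by simp [h2.symm, h.r2]
  r8 := by simp [h8.symm, h.r8]
  rlo i := by rw [State.setR_r, Function.update_of_ne (by omega), h.rlo]
  rhi i := by rw [State.setR_r, Function.update_of_ne (by omega), h.rhi]
  ra := h.ra

theorem Eval.updW {B : ℕ} {l : List (Point d)} {lo hi : Fin d → ℝ} {Q W : ℝ} {s : State}
    (h : Eval B l lo hi Q W s) {x : ℕ} (v : ℕ) (h5 : x ≠ 5) (h9 : x ≠ 9) :
    Eval B l lo hi Q W (s.updW x v) where
  w5 := by simp [h5.symm, h.w5]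
  w9 := by simp [h9.symm, h.w9]
  r2 := h.r2
  r8 := h.r8
  rlo := h.rlo
  rhi := h.rhi
  ra := h.ra

open Classical in
theorem runs_checkProg {B M p : ℕ} (hB : 11 ≤ B) {l : List (Point d)} {lo hi : Fin d → ℝ} {Q W : ℝ}
    (hp : p < l.length) {j : ℕ} (hj : j ≤ d) {s : State} (hs : Eval B l lo hi Q W s)
    (h3 : s.w 3 = p) :
    Runs M (checkProg d B j) (j * 5 + 1) s fun s' => Eval B l lo hi Q W s' ∧ s'.w 3 = p ∧
      s'.r 0 = s.r 0 + if ∀ i : Fin d, i < j → lo i ≤ l[p].1 i ∧ l[p].1 i ≤ hi i then s.r 3 else 0 := by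
  induction j generalizing s with
  | zero =>
    refine .mono (.radd ?_) (by omega) fun _ h => h
    exact ⟨hs.setR hB _ (by omega) (by omega) (by omega), h3, by simp⟩
  | succ j ih =>
    have hload : s.ra (1 + j) (s.w 3) = l[p].1 ⟨j, hj⟩ := by
      rw [hs.ra j (by omega), h3, pointArray, dif_pos hp, component, dif_pos]
    refine .mono (.seq (T := 1) (T' := 1 + (1 + (j * 5 + 1) + 1) + 1) (.rload ?_)) (by omega)
      fun _ h => h
    rw [hload]
    have hs1 := hs.setR hB (x := 4) (l[p].1 ⟨j, hj⟩) (by omega) (by omega) (by omega)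
    have hlo := hs1.rlo ⟨j, hj⟩
    have hhi := hs1.rhi ⟨j, hj⟩
    simp only at hlo hhi
    have h4 : (s.setR 4 (l[p].1 ⟨j, hj⟩)).r 4 = l[p].1 ⟨j, hj⟩ := by simp
    refine .branch (fun h => .skip ⟨hs1, h3, ?_⟩) fun h => .branch (fun h' => .skip ⟨hs1, h3, ?_⟩)
      fun h' => ?_
    · simp only [Test.Holds, hlo, h4] at h
      rw [if_neg]
      · simp
      · intro hall
        exact absurd (hall ⟨j, hj⟩ (Nat.lt_succ_self j)).1 (not_le.2 h)
    · simp only [Test.Holds, hhi, h4] at h'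
      rw [if_neg]
      · simp
      · intro hall
        exact absurd (hall ⟨j, hj⟩ (Nat.lt_succ_self j)).2 (not_le.2 h')
    · simp only [Test.Holds, hlo, hhi, h4, not_lt] at h h'
      refine .mono (ih (by omega) hs1 h3) le_rfl ?_
      rintro s' ⟨e1, e2, e3⟩
      refine ⟨e1, e2, ?_⟩
      rw [e3]
      simp only [State.setR_r, Function.update_of_ne (show (0 : ℕ) ≠ 4 by omega),
        Function.update_of_ne (show (3 : ℕ) ≠ 4 by omega)]
      congr 1
      refine if_congr ⟨fun hall i hi => ?_, fun hall i hi => hall i (by omega)⟩ rfl rfl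
      by_cases hij : (i : ℕ) = j
      · obtain rfl : i = ⟨j, hj⟩ := Fin.ext hij
        exact ⟨h, h'⟩
      · exact hall i (by omega)

/-- Put the weight of the box, corrected by the weight of the origin and of the `m` items, into
register `0`. -/
def evalProg (d B m : ℕ) : Prog :=
  Op.rmov 0 9 ;; Op.wconst 3 0 ;;
    .loop (.wlt 3 5) (Op.rload 3 (1 + d) 3 ;; checkProg d B d ;; Op.wadd 3 3 9) ;;
    Op.rsub 0 0 8 ;; Op.wconst 6 m ;; Op.rcast 4 6 ;; Op.rmul 4 4 2 ;; Op.rsub 0 0 4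

/-- The rectangle program returns a box and not its weight, so the weight is recomputed from the
preserved copy of the points. -/
theorem runs_evalProg {B M m : ℕ} (hB : 11 ≤ B) {l : List (Point d)} {lo hi : Fin d → ℝ} {Q W : ℝ}
    {s : State} (hs : Eval B l lo hi Q W s) (h9 : s.r 9 = 0) (hM : l.length < M) (hm : m < M) :
    Runs M (evalProg d B m) (l.length * (d * 5 + 4) + 8) s fun s' =>
      s'.r 0 = boxSum lo hi l - W - m * Q := by
  classical
  refine .mono (.seq (T := 1) (T' := 1 + (l.length * ((1 + ((d * 5 + 1) + 1)) + 1) + 1 + (1 + (1 + (1 +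
    (1 + 1)))))) (.rmov (.seq (.wconst (by omega) (.seq ?_))))) (by ring_nf; omega) fun _ h => h
  refine .mono (.loop (fun i s => Eval B l lo hi Q W s ∧ s.w 3 = i ∧
    s.r 0 = boxSum lo hi (l.take i)) l.length ?_ ?_ ?_ ?_) le_rfl ?_
  · exact ⟨(hs.setR hB _ (by omega) (by omega) (by omega)).updW _ (by omega) (by omega), by simp,
      by simp [h9, boxSum]⟩
  · rintro i hi s ⟨hs, h3, -⟩
    simp only [Test.Holds, hs.w5, h3]; exact hi
  · rintro s ⟨hs, h3, -⟩
    simp only [Test.Holds, hs.w5, h3]; omega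
  · rintro i hi s ⟨hs, h3, h0⟩
    have hload : s.ra (1 + d) (s.w 3) = l[i].2 := by
      rw [hs.ra d le_rfl, h3, pointArray, dif_pos hi, component, dif_neg (by omega), if_pos rfl]
    refine .seq (.rload (.seq ?_))
    rw [hload]
    refine .mono (runs_checkProg hB hi le_rfl (hs.setR hB (x := 3) l[i].2 (by omega) (by omega)
      (by omega)) h3) le_rfl ?_
    rintro s' ⟨e1, e2, e3⟩
    refine .wadd ?_ ⟨e1.updW _ (by omega) (by omega), ?_, ?_⟩
    · rw [e2, e1.w9]; omega
    · simp [e2, e1.w9]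
    · rw [State.updW_r, e3, List.take_add_one, List.getElem?_eq_getElem hi, Option.toList_some,
        boxSum_append]
      simp only [State.setR_r, Function.update_of_ne (show (0 : ℕ) ≠ 3 by omega), h0,
        Function.update_self]
      congr 1
      simp only [boxSum, List.map_cons, List.map_nil, List.sum_cons, List.sum_nil, add_zero]
      refine if_congr ⟨fun h => ⟨fun i => (h i i.2).1, fun i => (h i i.2).2⟩,
        fun h i _ => ⟨h.1 i, h.2 i⟩⟩ rfl rfl
  · rintro s ⟨hs, -, h0⟩
    rw [List.take_length] at h0
    refine .seq (.rsub (.seq (.wconst hm (.seq (.rcast (.seq (.rmul (.rsub ?_))))))))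
    simp [h0, hs.r8, hs.r2]

/-! ### The whole program -/

/-- The design with its items, digit names and prefix lengths is built into the program; only `n`,
the base and the edge weights are data at run time. -/
noncomputable def Design.prog (Δ : Design d k D U) (B : ℕ) (p : Prog) : Prog :=
  initProg D Δ.items.length ;; itemsProg Δ.seq D B Δ.items ;; originProg d B ;; Op.wmov B 5 ;;
    p.shift B ;; evalProg d B Δ.items.length

/-- Registers from `B` on have been kept at `0` and the arrays from `B` on hold the points. Once the
number of points is copied, this part of the memory is exactly a fresh input for the rectangle
program. -/
theorem splice_input {B N : ℕ} (hB : d + 2 ≤ B) (hB' : 11 ≤ B) {n b : ℕ} {Q S : ℝ} {inp : ℕ → ℝ}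
    {l : List (Point d)} (hl : 0 < l.length) {s : State} (hs : Written B n b Q S inp l s)
    (hN : N = l.length) :
    (s.updW B N).splice B ((maxWeightRectangle d).input (toInstance l hl)) = s.updW B N := by
  subst hN
  simp only [State.splice, maxWeightRectangle, State.updW, toInstance]
  congr 1
  · funext x
    by_cases hx : x < B
    · rw [splice_low _ _ hx]
    · obtain ⟨y, rfl⟩ := Nat.exists_eq_add_of_le' (not_lt.1 hx)
      rw [splice_add]
      by_cases hy : y = 0
      · subst hy; simp
      · rw [Function.update_of_ne (by omega), hs.hw, if_neg hy]
  · funext x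
    by_cases hx : x < B
    · rw [splice_low _ _ hx]
    · obtain ⟨y, rfl⟩ := Nat.exists_eq_add_of_le' (not_lt.1 hx)
      rw [splice_add, hs.hr]
  · funext x
    by_cases hx : x < B
    · rw [splice_low _ _ hx]
    · obtain ⟨y, rfl⟩ := Nat.exists_eq_add_of_le' (not_lt.1 hx)
      rw [splice_add, hs.wa]
  · funext x
    by_cases hx : x < B
    · rw [splice_low _ _ hx]
    · obtain ⟨y, rfl⟩ := Nat.exists_eq_add_of_le' (not_lt.1 hx)
      rw [splice_add, hs.ra, arrays, if_neg (by omega), if_neg (by omega), if_pos (by omega),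
        if_neg (by omega), Nat.add_sub_cancel]
      funext i
      simp only [pointArray, component, List.get_eq_getElem]

/-- The reduction: from a program that finds an optimal box for the points of a design, a program
that finds the maximum weight of a clique. -/
theorem Design.exists_prog (Δ : Design d k D U) (hk : 2 ≤ k) (hD : 0 < D) (p : Prog) :
    ∃ (q : Prog) (K : ℕ), ∀ (G : WeightedGraph k) (b : ℕ), 0 < b → G.n ≤ b ^ D →
      (∀ b' < b, b' ^ D < G.n) → ∃ (l : List (Point d)) (hl : 0 < l.length),
        l.length ≤ K * b ^ U ∧ ∀ M, b ^ D < M → b ^ U < M → G.n * G.n < M → K * b ^ U < M →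
          ∀ t s, Exec M p ((maxWeightRectangle d).input (toInstance l hl)) t s →
            (maxWeightRectangle d).Correct (toInstance l hl) s →
            ∃ t' s', Exec M q ((maxWeightClique k).input G) t' s' ∧
              t' ≤ K * (b + G.n * G.n + b ^ U) + t ∧ (maxWeightClique k).Correct G s' := by
  set m := Δ.items.length with hm
  -- `B` lies above the named registers, the arrays of the points and the registers `11 + δ` of all
  -- digits.
  obtain ⟨B, hB11, hBd, hBδ⟩ : ∃ B, 11 ≤ B ∧ d + 2 ≤ B ∧
      ∀ x ∈ Δ.items, ∀ δ ∈ x.1.digits Δ.seq, 11 + δ < B := by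
    refine ⟨12 + d + (Δ.items.map fun x => (x.1.digits Δ.seq).sum).sum, by omega, by omega,
      fun x hx δ hδ => ?_⟩
    have h1 : δ ≤ (x.1.digits Δ.seq).sum := List.single_le_sum (fun _ _ => Nat.zero_le _) _ hδ
    have h2 : (x.1.digits Δ.seq).sum ≤ (Δ.items.map fun x => (x.1.digits Δ.seq).sum).sum :=
      List.single_le_sum (fun _ _ => Nat.zero_le _) _ (List.mem_map.2 ⟨x, hx, rfl⟩)
    omega
  obtain ⟨T, hT⟩ := runs_itemsProg Δ hBd hB11 (xs := Δ.items) fun x hx => ⟨hx, hBδ x hx⟩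
  set K₀ := m * 2 ^ d + 1 with hK₀
  set K := (D + 3) + 6 + (T + 13 + 8 + 1 + 8) + K₀ * (d * 5 + 4) + 2 * m with hK
  refine ⟨Δ.prog B p, K, fun G b hb hn hleast => ?_⟩
  set S : ℝ := ∑ i ∈ Finset.range (G.n * G.n), |((maxWeightClique k).input G).ra 0 i| with hS
  set Q : ℝ := 1 + 2 * (m * S) with hQ
  set pts := Δ.points b G.n (weightOf G) Q with hpts
  set W : ℝ := (pts.length + 1 : ℕ) * (Q + S) with hW
  have hbU : 1 ≤ b ^ U := Nat.one_le_pow _ _ hb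
  have hptsU : pts.length + 1 ≤ K₀ * b ^ U := by
    have := length_points_le Δ hb G.n (weightOf G) Q
    rw [hK₀, add_mul, one_mul]
    rw [← hm, ← hpts] at this
    omega
  have hKK : K₀ ≤ K := by rw [hK]; nlinarith [Nat.zero_le K₀, Nat.zero_le d]
  have hK₀K : K₀ * b ^ U ≤ K * b ^ U := Nat.mul_le_mul_right _ hKK
  have hl : 0 < (pts ++ [((0 : Fin d → ℝ), W)]).length := by simp
  refine ⟨pts ++ [(0, W)], hl, by simpa using hptsU.trans hK₀K,
    fun M hDM hUM hnM hKM t s hexec hcorrect => ?_⟩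
  have h2m : 2 * m < M := by
    have : 2 * m * 1 ≤ K * b ^ U := Nat.mul_le_mul (by omega) hbU
    omega
  have hS0 : 0 ≤ S := Finset.sum_nonneg fun _ _ => abs_nonneg _
  have hentry : ∀ i j, i < G.n → j < G.n →
      ((maxWeightClique k).input G).ra 0 (i * G.n + j) = weightOf G i j := by
    intro i j hi hj
    have hij : i * G.n + j < G.n * G.n := by
      calc i * G.n + j < i * G.n + G.n := by omega
        _ = (i + 1) * G.n := by ring
        _ ≤ G.n * G.n := Nat.mul_le_mul_right _ hi
    have he : (⟨i * G.n + j, hij⟩ : Fin (G.n * G.n)) = finProdFinEquiv (⟨i, hi⟩, ⟨j, hj⟩) := by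
      ext; simp [finProdFinEquiv, mul_comm, add_comm]
    simp only [maxWeightClique, if_true, dif_pos hij, he, Equiv.symm_apply_apply, weightOf,
      dif_pos (And.intro hi hj)]
  have hwS : ∀ i j, i < G.n → j < G.n → |weightOf G i j| ≤ S := by
    intro i j hi hj
    rw [← hentry i j hi hj, hS]
    refine Finset.single_le_sum (f := fun i => |((maxWeightClique k).input G).ra 0 i|)
      (fun _ _ => abs_nonneg _) (Finset.mem_range.2 ?_)
    calc i * G.n + j < i * G.n + G.n := by omega
      _ = (i + 1) * G.n := by ring
      _ ≤ G.n * G.n := Nat.mul_le_mul_right _ hi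
  have hinput : (maxWeightClique k).input G =
      inputState G.n ((maxWeightClique k).input G).ra := rfl
  have hrun : Runs M (Δ.prog B p) ((b * (D + 3) + G.n * G.n * 6 + 13) + (T * b ^ U + (8 + (1 + (t +
      ((pts.length + 1) * (d * 5 + 4) + 8)))))) ((maxWeightClique k).input G) fun s' =>
        (maxWeightClique k).Correct G s' := by
    rw [hinput]
    refine .seq (.mono (runs_initProg (d := d) hB11 hD hb hn hleast hDM hnM h2m ?_ hS hQ) le_rfl ?_)
    · intro a ha
      funext i
      simp [maxWeightClique, ha]
    intro s₁ hs₁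
    refine .seq (.mono (hT M G.n b hb hDM hUM hnM Q S _ (weightOf G) hentry [] s₁ hs₁ ?_) le_rfl ?_)
    · change pts.length < M
      omega
    intro s₂ hs₂
    change Written B G.n b Q S _ pts s₂ at hs₂
    refine .seq (.mono (runs_originProg hBd hB11 hs₂ (by omega)) le_rfl ?_)
    rintro s₃ ⟨hs₃, h8⟩
    rw [← hW] at hs₃ h8
    have h5 : s₃.w 5 = (pts ++ [((0 : Fin d → ℝ), W)]).length := hs₃.w5
    have hlen : (pts ++ [((0 : Fin d → ℝ), W)]).length = pts.length + 1 := by simp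
    refine .seq (.wmov (by rw [h5, hlen]; omega) (.seq ?_))
    -- The given run of `p`, shifted by `B`, starts in this very state.
    refine ⟨t, (s₃.updW B (s₃.w 5)).splice B s, ?_, le_rfl, ?_⟩
    · have := hexec.shift B (s₃.updW B (s₃.w 5))
      rwa [splice_input hBd hB11 hl hs₃ h5] at this
    · obtain ⟨hlohi, hmax⟩ := hcorrect
      have heval : Eval B (pts ++ [((0 : Fin d → ℝ), W)]) (fun i => s.r i) (fun i => s.r (d + i)) Q W
          ((s₃.updW B (s₃.w 5)).splice B s) := by
        refine ⟨?_, ?_, ?_, ?_, fun i => ?_, fun i => ?_, fun i hi => ?_⟩ <;> simp only [State.splice]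
        · rw [splice_low _ _ (by omega), State.updW_w, Function.update_of_ne (by omega), h5]
        · rw [splice_low _ _ (by omega), State.updW_w, Function.update_of_ne (by omega), hs₃.w9]
        · rw [splice_low _ _ (by omega), State.updW_r, hs₃.r2]
        · rw [splice_low _ _ (by omega), State.updW_r, h8]
        · rw [splice_add]
        · rw [splice_add]
        · rw [splice_low _ _ (by omega), State.updW_ra, hs₃.ra, arrays, if_neg (by omega),
            if_pos (by omega), if_neg (by omega), Nat.add_sub_cancel_left]
      refine .mono (runs_evalProg (m := m) hB11 heval ?_ (by rw [hlen]; omega) (by omega))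
        (by rw [hlen]) ?_
      · simp only [State.splice]
        rw [splice_low _ _ (by omega), State.updW_r, hs₃.r9]
      · intro s' hs'
        simp only [maxWeightClique]
        rw [hs']
        refine isGreatest_of_optimal_box Δ hk hD G hb hn hS0 hwS hQ hW fun lo' hi' hle => ?_
        have := hmax lo' hi' hle
        rwa [toInstance_boxWeight, toInstance_boxWeight] at this
  obtain ⟨t', s', h1, h2, h3⟩ := hrun
  refine ⟨t', s', h1, h2.trans ?_, h3⟩
  have e1 : (pts.length + 1) * (d * 5 + 4) ≤ K₀ * (d * 5 + 4) * b ^ U := by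
    calc (pts.length + 1) * (d * 5 + 4) ≤ K₀ * b ^ U * (d * 5 + 4) := Nat.mul_le_mul_right _ hptsU
      _ = _ := by ring
  have e2 : (13 + 8 + 1 + 8) * 1 ≤ (13 + 8 + 1 + 8) * b ^ U := Nat.mul_le_mul_left _ hbU
  have e3 : (D + 3) * b ≤ K * b := Nat.mul_le_mul_right _ (by omega)
  have e4 : 6 * (G.n * G.n) ≤ K * (G.n * G.n) := Nat.mul_le_mul_right _ (by omega)
  have e5 : ((T + 13 + 8 + 1 + 8) + K₀ * (d * 5 + 4)) * b ^ U ≤ K * b ^ U :=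
    Nat.mul_le_mul_right _ (by omega)
  nlinarith

/-! ### Construction of designs -/

/-- A design in which the checks force all sides to agree. -/
theorem Design.nonempty_of_consistent (seq : Fin d → Bool → ℕ → ℕ) (len : Fin d → Bool → ℕ)
    (pairTable : ℕ → ℕ → Table d) (checks : List (Table d))
    (hpre : ∀ u v, u < v → v < k → ∀ i, (pairTable u v).pre i ≤ len i ((pairTable u v).side i))
    (card_pair : ∀ u v, u < v → v < k → ((pairTable u v).reads seq).card ≤ U)
    (card_check : ∀ τ ∈ checks, (τ.reads seq).card ≤ U)
    (covers : ∀ u v, u < v → v < k → ∀ x < D, u * D + x ∈ (pairTable u v).reads seq ∧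
      v * D + x ∈ (pairTable u v).reads seq)
    (consistent : ∀ rw : Fin d → Bool → ℕ → ℕ,
      (∀ τ ∈ checks, ∀ i, ∀ p < τ.pre i, ∀ i', ∀ p' < τ.pre i',
        seq i (τ.side i) p = seq i' (τ.side i') p' → rw i (τ.side i) p = rw i' (τ.side i') p') →
      ∃ A₀ : ℕ → ℕ, ∀ i β, ∀ p < len i β, rw i β p = A₀ (seq i β p)) :
    Nonempty (Design d k D U) := by
  refine ⟨⟨seq, pairTable, checks, card_pair, card_check, fun u v h1 h2 x hx =>
    (covers u v h1 h2 x hx).1, fun u v h1 h2 x hx => (covers u v h1 h2 x hx).2, fun rw A hA => ?_⟩⟩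
  -- A table has one value per digit name, so a check that pays forces equal values wherever it
  -- reads the same name twice.
  obtain ⟨A₀, hA₀⟩ := consistent rw fun τ hτ i p hp i' p' hp' h => by
    rw [← hA τ (.inl hτ) i p hp, ← hA τ (.inl hτ) i' p' hp', h]
  have key : ∀ u v, u < v → v < k → ∀ δ ∈ (pairTable u v).reads seq,
      A (pairTable u v) δ = A₀ δ := by
    intro u v h1 h2 δ hδ
    obtain ⟨i, p, hp, rfl⟩ := Table.mem_reads.1 hδ
    rw [hA _ (.inr ⟨u, v, h1, h2, rfl⟩) i p hp, hA₀ _ _ _ (hp.trans_le (hpre u v h1 h2 i))]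
  exact ⟨A₀, fun u v h1 h2 x hx => ⟨key u v h1 h2 _ (covers u v h1 h2 x hx).1,
    key u v h1 h2 _ (covers u v h1 h2 x hx).2⟩⟩

theorem Table.card_reads_le (seq : Fin d → Bool → ℕ → ℕ) (τ : Table d) :
    (τ.reads seq).card ≤ ∑ i, τ.pre i := by
  refine Finset.card_biUnion_le.trans (Finset.sum_le_sum fun i _ => ?_)
  exact Finset.card_image_le.trans (Finset.card_range _).le

/-- A table that reads prefixes of two sides. -/
def twoSides (d i : ℕ) (β : Bool) (p i' : ℕ) (β' : Bool) (p' : ℕ) : Table d where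
  side e := if (e : ℕ) = i then β else β'
  pre e := if (e : ℕ) = i then p else if (e : ℕ) = i' then p' else 0

theorem card_reads_twoSides_le (seq : Fin d → Bool → ℕ → ℕ) (i : ℕ) (β : Bool) (p i' : ℕ) (β' : Bool)
    (p' : ℕ) : ((twoSides d i β p i' β' p').reads seq).card ≤ p + p' := by
  refine (Table.card_reads_le _ _).trans ?_
  have h : ∀ (m a : ℕ), ∑ e : Fin d, (if (e : ℕ) = m then a else 0) ≤ a := by
    intro m a
    rw [Fin.sum_univ_eq_sum_range (fun e => if e = m then a else 0), Finset.sum_ite_eq']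
    split_ifs <;> omega
  refine le_trans ?_ (add_le_add (h i p) (h i' p'))
  rw [← Finset.sum_add_distrib]
  refine Finset.sum_le_sum fun e _ => ?_
  simp only [twoSides]
  split_ifs <;> omega

/-- For `i' = i` the second side is not read: a table has only one side per dimension. -/
theorem mem_reads_twoSides {seq : Fin d → Bool → ℕ → ℕ} {i i' p p' δ : ℕ} {β β' : Bool} :
    δ ∈ (twoSides d i β p i' β' p').reads seq ↔
      (∃ h : i < d, ∃ x < p, seq ⟨i, h⟩ β x = δ) ∨
        i' ≠ i ∧ ∃ h : i' < d, ∃ x < p', seq ⟨i', h⟩ β' x = δ := by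
  rw [Table.mem_reads]
  constructor
  · rintro ⟨e, x, hx, h⟩
    simp only [twoSides] at hx h
    split_ifs at hx h with h1 h2
    · subst h1; exact .inl ⟨e.2, x, hx, h⟩
    · subst h2; exact .inr ⟨h1, e.2, x, hx, h⟩
    · omega
  · rintro (⟨h, x, hx, h1⟩ | ⟨hne, h, x, hx, h1⟩)
    · exact ⟨⟨i, h⟩, x, by simpa [twoSides] using hx, by simpa [twoSides] using h1⟩
    · exact ⟨⟨i', h⟩, x, by simpa [twoSides, hne] using hx, by simpa [twoSides, hne] using h1⟩

/-- A check of two sides compares them. -/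
theorem eq_of_twoSides {seq rw : Fin d → Bool → ℕ → ℕ} {i i' : Fin d} {p p' : ℕ} {β β' : Bool}
    (h : ∀ e, ∀ x < (twoSides d i β p i' β' p').pre e, ∀ e', ∀ x' < (twoSides d i β p i' β' p').pre e',
      seq e ((twoSides d i β p i' β' p').side e) x = seq e' ((twoSides d i β p i' β' p').side e') x' →
      rw e ((twoSides d i β p i' β' p').side e) x = rw e' ((twoSides d i β p i' β' p').side e') x')
    (hne : i' ≠ i) {x x' : ℕ} (hx : x < p) (hx' : x' < p') (he : seq i β x = seq i' β' x') :
    rw i β x = rw i' β' x' := by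
  have hne' : (i' : ℕ) ≠ i := fun e => hne (Fin.ext e)
  simpa [twoSides, hne'] using h i x (by simpa [twoSides]) i' x' (by simpa [twoSides, hne'])
    (by simpa [twoSides, hne'])

/-- The cyclic successor. -/
def nxt (d i : ℕ) : ℕ := if i + 1 = d then 0 else i + 1

theorem nxt_lt {i : ℕ} (hi : i < d) : nxt d i < d := by unfold nxt; split_ifs <;> omega

theorem nxt_ne {i : ℕ} (hd : 2 ≤ d) : nxt d i ≠ i := by unfold nxt; split_ifs <;> omega

/-! ### The design for `k = d q + r`, `q ≥ 2` -/

/-- The digits of the first `d q` vertices are divided into `d` blocks, those of the others into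
`d` chunks of `r` digits. -/
def blockSeq (d q r i : ℕ) : Bool → ℕ → ℕ
  | true, p => if p < q * d then i * (q * d) + p else d * (q * d) + i * r + (p - q * d)
  | false, p =>
    if p < r then d * (q * d) + i * r + p
    else if p < r + q * d then nxt d i * (q * d) + (q * d - 1 - (p - r))
    else d * (q * d) + nxt d i * r + (p - (r + q * d))

/-- How much has to be read of chunk `i` in order to find the digits `l d, …, l d + d - 1`. -/
def chunkCut (d r l i : ℕ) : ℕ := if l * d / r ≤ i then min r ((l + 1) * d - i * r) else 0

/-- The dimension before `j`. -/
def prv (d j : ℕ) : ℕ := if j = 0 then d - 1 else j - 1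

theorem prv_lt {j : ℕ} (hj : j < d) : prv d j < d := by unfold prv; split_ifs <;> omega

theorem nxt_prv {j : ℕ} (hj : j < d) : nxt d (prv d j) = j := by
  unfold prv nxt; split_ifs <;> omega

/-- Vertices of different blocks are read on the upper sides if they come early, and otherwise on
the reversed copies, where late vertices come early; at least one of the two ways is within the
budget. Chunks are read at the heads of the lower sides, except in the dimension whose upper side is
taken by the block of `u`: there the chunk follows the block. -/
def blockPair (d q r u v : ℕ) : Table d :=
  if v < d * q then
    if u / q = v / q then twoSides d (u / q) true (q * d) (u / q) true 0
    else if u % q + v % q + 2 ≤ q + 1 then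
      twoSides d (u / q) true ((u % q + 1) * d) (v / q) true ((v % q + 1) * d)
    else
      twoSides d (prv d (u / q)) false (r + (q - u % q) * d)
        (prv d (v / q)) false (r + (q - v % q) * d)
  else if u < d * q then
    { side := fun i => decide ((i : ℕ) = u / q)
      pre := fun i =>
        (if (i : ℕ) = u / q then q * d else 0) + chunkCut d r (v - d * q) i }
  else
    { side := fun _ => false
      pre := fun i => max (chunkCut d r (u - d * q) i) (chunkCut d r (v - d * q) i) }

/-- Both kinds of check read a lower side completely and compare it with the next dimension: with
the block and chunk on its upper side, and with the chunk at the head of its lower side. -/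
def blockChecks (d q r : ℕ) : List (Table d) :=
  (List.range d).map (fun i =>
      twoSides d i false (r + q * d + r) (nxt d i) true (q * d + r)) ++
    (List.range d).map fun i => twoSides d i false (r + q * d + r) (nxt d i) false r

theorem chunkCut_le (d r l i : ℕ) : chunkCut d r l i ≤ r := by
  unfold chunkCut; split_ifs <;> omega

theorem chunkCut_bounds {r l i x : ℕ} (h : x < chunkCut d r l i) :
    l * d / r * r ≤ i * r + x ∧ i * r + x < (l + 1) * d := by
  unfold chunkCut at h
  split_ifs at h with h1
  · have := Nat.mul_le_mul_right r h1
    omega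
  · omega

theorem mod_lt_chunkCut {r l p : ℕ} (hr : 0 < r) (h1 : l * d ≤ p) (h2 : p < (l + 1) * d) :
    p % r < chunkCut d r l (p / r) := by
  have h3 := Nat.mod_lt p hr
  have h4 := Nat.div_add_mod' p r
  rw [chunkCut, if_pos (Nat.div_le_div_right h1)]
  omega

/-- `A₀` takes the blocks from the upper sides and the chunks from the heads of the lower sides; the
checks carry the values over to the other copies. -/
theorem blockSeq_consistent {q r : ℕ} (hd : 2 ≤ d) (rw : Fin d → Bool → ℕ → ℕ)
    (h : ∀ τ ∈ blockChecks d q r, ∀ i, ∀ p < τ.pre i, ∀ i', ∀ p' < τ.pre i',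
      blockSeq d q r i (τ.side i) p = blockSeq d q r i' (τ.side i') p' →
      rw i (τ.side i) p = rw i' (τ.side i') p') :
    ∃ A₀ : ℕ → ℕ, ∀ (i : Fin d) (β : Bool), ∀ p < (if β then q * d + r else r + q * d + r),
      rw i β p = A₀ (blockSeq d q r i β p) := by
  set g : Fin d → Fin d := fun i => ⟨nxt d i, nxt_lt i.2⟩ with hg
  have hgi : ∀ i, g i ≠ i := fun i e => nxt_ne hd (congrArg Fin.val e)
  have hgs : ∀ j, ∃ i, g i = j := fun j => ⟨⟨prv d j, prv_lt j.2⟩, Fin.ext (nxt_prv j.2)⟩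
  have c1 : ∀ i : Fin d, ∀ x < r + q * d + r, ∀ x' < q * d + r,
      blockSeq d q r i false x = blockSeq d q r (nxt d i) true x' →
      rw i false x = rw (g i) true x' := fun i x hx x' hx' e =>
    eq_of_twoSides (seq := fun i => blockSeq d q r i) (i' := g i) (h _ (List.mem_append_left _
      (List.mem_map.2 ⟨i, List.mem_range.2 i.2, rfl⟩))) (hgi i) hx hx' e
  have c2 : ∀ i : Fin d, ∀ x < r + q * d + r, ∀ x' < r,
      blockSeq d q r i false x = blockSeq d q r (nxt d i) false x' →
      rw i false x = rw (g i) false x' := fun i x hx x' hx' e =>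
    eq_of_twoSides (seq := fun i => blockSeq d q r i) (i' := g i) (h _ (List.mem_append_right _
      (List.mem_map.2 ⟨i, List.mem_range.2 i.2, rfl⟩))) (hgi i) hx hx' e
  have k1 : ∀ i : Fin d, ∀ x < q * d, rw i false (r + (q * d - 1 - x)) = rw (g i) true x := by
    intro i x hx
    refine c1 i _ (by omega) x (by omega) ?_
    simp only [blockSeq]
    rw [if_neg (by omega), if_pos (by omega), if_pos (by omega)]
    omega
  have k2 : ∀ i : Fin d, ∀ x < r, rw i false (r + q * d + x) = rw (g i) true (q * d + x) := by
    intro i x hx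
    refine c1 i _ (by omega) _ (by omega) ?_
    simp only [blockSeq]
    rw [if_neg (by omega), if_neg (by omega), if_neg (by omega)]
    omega
  have k3 : ∀ i : Fin d, ∀ x < r, rw i false (r + q * d + x) = rw (g i) false x := by
    intro i x hx
    refine c2 i _ (by omega) _ (by omega) ?_
    simp only [blockSeq]
    rw [if_neg (by omega), if_neg (by omega), if_pos (by omega)]
    omega
  -- The two sides of dimension `j` carry the same chunk but cannot meet in one table; the tail of
  -- the preceding lower side is compared with both.
  have k4 : ∀ j : Fin d, ∀ x < r, rw j true (q * d + x) = rw j false x := by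
    intro j x hx
    obtain ⟨i, rfl⟩ := hgs j
    rw [← k2 i x hx, k3 i x hx]
  set rw' : ℕ → Bool → ℕ → ℕ := fun i β p => if hi : i < d then rw ⟨i, hi⟩ β p else 0 with hrw'
  have hval : ∀ (i : Fin d) β p, rw' i β p = rw i β p := fun i β p => by simp [hrw']
  set A₀ : ℕ → ℕ := fun δ => if δ < d * (q * d) then rw' (δ / (q * d)) true (δ % (q * d)) else
    rw' ((δ - d * (q * d)) / r) false ((δ - d * (q * d)) % r) with hA₀
  have a1 : ∀ i : Fin d, ∀ x < q * d, A₀ (i * (q * d) + x) = rw i true x := by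
    intro i x hx
    have hlt : (i : ℕ) * (q * d) + x < d * (q * d) := by
      have := Nat.mul_le_mul_right (q * d) (show (i : ℕ) + 1 ≤ d from i.2)
      rw [add_mul] at this; omega
    simp only [hA₀]
    rw [if_pos hlt, mul_comm (i : ℕ), Nat.mul_add_div (by omega), Nat.mul_add_mod,
      Nat.div_eq_of_lt hx, Nat.mod_eq_of_lt hx, add_zero, hval]
  have a2 : ∀ i : Fin d, ∀ x < r, A₀ (d * (q * d) + i * r + x) = rw i false x := by
    intro i x hx
    simp only [hA₀]
    rw [if_neg (by omega), show d * (q * d) + (i : ℕ) * r + x - d * (q * d) = r * i + x by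
      rw [mul_comm r]; omega, Nat.mul_add_div (by omega), Nat.mul_add_mod,
      Nat.div_eq_of_lt hx, Nat.mod_eq_of_lt hx, add_zero, hval]
  refine ⟨A₀, fun i β p hp => ?_⟩
  cases β with
  | true =>
    simp only [if_true] at hp
    simp only [blockSeq]
    split_ifs with h1
    · rw [a1 i p h1]
    · rw [a2 i _ (by omega), ← k4 i _ (by omega)]
      congr 1; omega
  | false =>
    simp only [Bool.false_eq_true, if_false] at hp
    simp only [blockSeq]
    split_ifs with h1 h2
    · rw [a2 i p h1]
    · rw [show nxt d i = (g i : ℕ) from rfl, a1 (g i) _ (by omega), ← k1 i _ (by omega)]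
      congr 1; omega
    · rw [show nxt d i = (g i : ℕ) from rfl, a2 (g i) _ (by omega), ← k3 i _ (by omega)]
      congr 1; omega

/-- Digit names are counted once although both sides show them: a check involves one block and two
chunks, `q * d + 2 * r` names, and `r < d`. -/
theorem card_blockChecks {q r : ℕ} (hr : r < d) {τ : Table d} (hτ : τ ∈ blockChecks d q r) :
    (τ.reads fun i => blockSeq d q r i).card ≤ d * q + r + d := by
  have key : ∀ i, τ.reads (fun i => blockSeq d q r i) ⊆
      Finset.Ico (d * (q * d) + i * r) (d * (q * d) + i * r + r) ∪
      (Finset.Ico (nxt d i * (q * d)) (nxt d i * (q * d) + q * d) ∪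
        Finset.Ico (d * (q * d) + nxt d i * r) (d * (q * d) + nxt d i * r + r)) →
      (τ.reads fun i => blockSeq d q r i).card ≤ d * q + r + d := by
    intro i h
    refine (Finset.card_le_card h).trans ((Finset.card_union_le _ _).trans
      ((Nat.add_le_add_left (Finset.card_union_le _ _) _).trans ?_))
    simp only [Nat.card_Ico, mul_comm d q]
    omega
  simp only [blockChecks, List.mem_append, List.mem_map, List.mem_range] at hτ
  rcases hτ with ⟨i, -, rfl⟩ | ⟨i, -, rfl⟩
  all_goals
    refine key i fun δ hδ => ?_
    simp only [Finset.mem_union, Finset.mem_Ico]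
    obtain ⟨hi, x, hx, rfl⟩ | ⟨-, hi, x, hx, rfl⟩ := mem_reads_twoSides.1 hδ
    all_goals
      simp only [blockSeq]
      split_ifs <;> omega

theorem mul_add_lt_of_lt {q t x : ℕ} (ht : t < q) (hx : x < d) : t * d + x < q * d := by
  have := Nat.mul_le_mul_right d (show t + 1 ≤ q from ht)
  rw [add_mul] at this; omega

theorem vertex_digit {q : ℕ} (u x : ℕ) : u / q * (q * d) + (u % q * d + x) = u * d + x := by
  conv_rhs => rw [← Nat.div_add_mod' u q]
  ring

theorem blockSeq_true {q r u x : ℕ} (hq : 0 < q) (hx : x < d) :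
    blockSeq d q r (u / q) true (u % q * d + x) = u * d + x := by
  simp only [blockSeq]
  rw [if_pos (mul_add_lt_of_lt (Nat.mod_lt _ hq) hx), vertex_digit]

theorem blockSeq_false {q r u x : ℕ} (hq : 0 < q) (hx : x < d) (hu : u / q < d) :
    ∃ p < r + (q - u % q) * d, blockSeq d q r (prv d (u / q)) false p = u * d + x := by
  have h1 := mul_add_lt_of_lt (Nat.mod_lt u hq) hx
  have h2 : (q - u % q) * d = q * d - u % q * d := Nat.sub_mul _ _ _
  refine ⟨r + (q * d - 1 - (u % q * d + x)), by omega, ?_⟩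
  simp only [blockSeq]
  rw [if_neg (by omega), if_pos (by omega), nxt_prv hu]
  have := vertex_digit (d := d) (q := q) u x
  omega

theorem blockSeq_chunk {q r l x : ℕ} (hl : l < r) (hx : x < d) :
    (l * d + x) / r < d ∧ (l * d + x) % r < chunkCut d r l ((l * d + x) / r) ∧
      d * (q * d) + (l * d + x) / r * r + (l * d + x) % r = (d * q + l) * d + x := by
  have hr : 0 < r := by omega
  refine ⟨?_, mod_lt_chunkCut hr (by omega) (by rw [add_mul]; omega), ?_⟩
  · rw [Nat.div_lt_iff_lt_mul hr, mul_comm d]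
    exact mul_add_lt_of_lt hl hx
  · have := Nat.div_add_mod' (l * d + x) r
    rw [add_assoc, this]; ring

theorem mem_reads_blockPair {q r u v : ℕ} (hq : 2 ≤ q) (huv : u < v) (hv : v < d * q + r) {x : ℕ}
    (hx : x < d) : u * d + x ∈ (blockPair d q r u v).reads (fun i => blockSeq d q r i) ∧
      v * d + x ∈ (blockPair d q r u v).reads (fun i => blockSeq d q r i) := by
  have hq0 : 0 < q := by omega
  have hdiv : ∀ w, w < d * q → w / q < d := fun w hw => (Nat.div_lt_iff_lt_mul hq0).2 hw
  have hlt : ∀ w, w % q * d + x < (w % q + 1) * d := fun w => by rw [add_mul]; omega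
  unfold blockPair
  split_ifs with h1 h2 h3 h4
  · have hs : ∀ w, w / q = u / q → w * d + x ∈ (twoSides d (u / q) true (q * d) (u / q) true 0).reads
        (fun i => blockSeq d q r i) := fun w hw =>
      mem_reads_twoSides.2 (.inl ⟨hdiv u (by omega), w % q * d + x,
        mul_add_lt_of_lt (Nat.mod_lt _ hq0) hx, hw ▸ blockSeq_true hq0 hx⟩)
    exact ⟨hs u rfl, hs v h2.symm⟩
  · exact ⟨mem_reads_twoSides.2 (.inl ⟨hdiv u (by omega), _, hlt u, blockSeq_true hq0 hx⟩),
      mem_reads_twoSides.2 (.inr ⟨Ne.symm h2, hdiv v (by omega), _, hlt v, blockSeq_true hq0 hx⟩)⟩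
  · have hu' := hdiv u (by omega)
    have hv' := hdiv v h1
    obtain ⟨p, hp, e⟩ := blockSeq_false (r := r) hq0 hx hu'
    obtain ⟨p', hp', e'⟩ := blockSeq_false (r := r) hq0 hx hv'
    refine ⟨mem_reads_twoSides.2 (.inl ⟨prv_lt hu', p, hp, e⟩),
      mem_reads_twoSides.2 (.inr ⟨fun h => h2 ?_, prv_lt hv', p', hp', e'⟩)⟩
    rw [← nxt_prv hu', ← nxt_prv hv', h]
  · refine ⟨Table.mem_reads.2 ⟨⟨u / q, hdiv u h4⟩, u % q * d + x, ?_, ?_⟩, ?_⟩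
    · have := mul_add_lt_of_lt (Nat.mod_lt u hq0) hx
      simp only [if_true]; omega
    · simpa using blockSeq_true hq0 hx
    · obtain ⟨l, rfl⟩ : ∃ l, v = d * q + l := ⟨v - d * q, by omega⟩
      obtain ⟨e1, e2, e3⟩ := blockSeq_chunk (d := d) (q := q) (show l < r by omega) hx
      have hr : (l * d + x) % r < r := Nat.mod_lt _ (by omega)
      rw [Nat.add_sub_cancel_left]
      by_cases hi : (l * d + x) / r = u / q
      · refine Table.mem_reads.2 ⟨⟨_, e1⟩, q * d + (l * d + x) % r, ?_, ?_⟩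
        · simp only [hi, if_true] at e2 ⊢; omega
        · simp only [hi, decide_true, blockSeq]
          rw [if_neg (by omega), ← hi, ← e3]; omega
      · refine Table.mem_reads.2 ⟨⟨_, e1⟩, (l * d + x) % r, ?_, ?_⟩
        · simp only [hi, if_false]; omega
        · simp only [hi, decide_false, blockSeq]
          rw [if_pos hr, e3]
  · have hs : ∀ w, d * q ≤ w → w < d * q + r → (∀ i, chunkCut d r (w - d * q) i ≤
        max (chunkCut d r (u - d * q) i) (chunkCut d r (v - d * q) i)) →
        w * d + x ∈ Table.reads (fun i => blockSeq d q r i) ⟨fun _ : Fin d => false, fun i =>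
          max (chunkCut d r (u - d * q) i) (chunkCut d r (v - d * q) i)⟩ := by
      intro w hw hw' hle
      obtain ⟨l, rfl⟩ : ∃ l, w = d * q + l := ⟨w - d * q, by omega⟩
      obtain ⟨e1, e2, e3⟩ := blockSeq_chunk (d := d) (q := q) (show l < r by omega) hx
      have hr : (l * d + x) % r < r := Nat.mod_lt _ (by omega)
      have := hle ((l * d + x) / r)
      rw [Nat.add_sub_cancel_left] at this
      refine Table.mem_reads.2 ⟨⟨_, e1⟩, (l * d + x) % r, lt_of_lt_of_le e2 this, ?_⟩
      simp only [blockSeq]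
      rw [if_pos hr, e3]
    exact ⟨hs u (by omega) (by omega) fun i => le_max_left _ _,
      hs v (by omega) (by omega) fun i => le_max_right _ _⟩

/-- The `d` digits of a vertex may begin inside a chunk, but chunks are read from their start; this
costs at most `r` additional digits. -/
theorem card_chunk_le {q r l : ℕ} (hr : 0 < r) :
    (Finset.Ico (d * (q * d) + l * d / r * r) (d * (q * d) + (l + 1) * d)).card ≤ d + r := by
  have := Nat.lt_div_mul_add (a := l * d) hr
  rw [Nat.card_Ico, add_mul]
  omega

theorem mem_chunk {q r l i x : ℕ} (h : x < chunkCut d r l i) : d * (q * d) + i * r + x ∈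
    Finset.Ico (d * (q * d) + l * d / r * r) (d * (q * d) + (l + 1) * d) := by
  have := chunkCut_bounds h
  rw [Finset.mem_Ico]; omega

theorem card_blockPair {q r u v : ℕ} (hq : 2 ≤ q) (hr : r < d)
    (hv : v < d * q + r) :
    ((blockPair d q r u v).reads fun i => blockSeq d q r i).card ≤ d * q + r + d := by
  have hq0 : 0 < q := by omega
  unfold blockPair
  split_ifs with h1 h2 h3 h4
  · refine (card_reads_twoSides_le _ _ _ _ _ _ _).trans ?_
    rw [mul_comm d]; omega
  · refine (card_reads_twoSides_le _ _ _ _ _ _ _).trans ?_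
    rw [← add_mul]
    have := Nat.mul_le_mul_right d (show u % q + 1 + (v % q + 1) ≤ q + 1 by omega)
    rw [add_mul q, mul_comm q] at this
    omega
  -- Here `u % q + v % q ≥ q`, so the reversed prefixes have at most `q * d + 2 * r` digits.
  · refine (card_reads_twoSides_le _ _ _ _ _ _ _).trans ?_
    have hu' := Nat.mod_lt u hq0
    have hv' := Nat.mod_lt v hq0
    have := Nat.mul_le_mul_right d (show (q - u % q) + (q - v % q) ≤ q by omega)
    rw [add_mul, mul_comm q] at this
    omega
  -- One block and the chunk digits of one vertex make `q * d + (d + r)`, the whole budget.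
  · have hr0 : 0 < r := by omega
    refine (Finset.card_le_card (t := Finset.Ico (u / q * (q * d)) (u / q * (q * d) + q * d) ∪
      Finset.Ico (d * (q * d) + (v - d * q) * d / r * r)
        (d * (q * d) + ((v - d * q) + 1) * d)) fun δ hδ => ?_).trans
      ((Finset.card_union_le _ _).trans ?_)
    · obtain ⟨i, x, hx, rfl⟩ := Table.mem_reads.1 hδ
      rw [Finset.mem_union]
      simp only at hx ⊢
      have hle := chunkCut_le d r (v - d * q) i
      by_cases hi : (i : ℕ) = u / q
      · rw [if_pos hi] at hx
        simp only [hi, decide_true, blockSeq]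
        rw [hi] at hx
        split_ifs with hx'
        · left; rw [Finset.mem_Ico]; omega
        · right; exact mem_chunk (by omega)
      · rw [if_neg hi, zero_add] at hx
        simp only [hi, decide_false, blockSeq]
        rw [if_pos (by omega)]
        exact .inr (mem_chunk hx)
    · have := card_chunk_le (d := d) (q := q) (l := v - d * q) hr0
      have hc := mul_comm d q
      rw [Nat.card_Ico]
      omega
  · have hr0 : 0 < r := by omega
    refine (Finset.card_le_card (t :=
      Finset.Ico (d * (q * d) + (u - d * q) * d / r * r) (d * (q * d) + ((u - d * q) + 1) * d) ∪
      Finset.Ico (d * (q * d) + (v - d * q) * d / r * r) (d * (q * d) + ((v - d * q) + 1) * d))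
      fun δ hδ => ?_).trans ((Finset.card_union_le _ _).trans ?_)
    · obtain ⟨i, x, hx, rfl⟩ := Table.mem_reads.1 hδ
      have hle := chunkCut_le d r (u - d * q) i
      have hle' := chunkCut_le d r (v - d * q) i
      simp only at hx ⊢
      simp only [blockSeq]
      rw [if_pos (by omega), Finset.mem_union]
      obtain h | h := lt_max_iff.1 hx
      · exact .inl (mem_chunk h)
      · exact .inr (mem_chunk h)
    -- The chunk digits of two vertices number up to `2 * (d + r)`; that this is within the budget
    -- uses `q ≥ 2`.
    · have e1 := card_chunk_le (d := d) (q := q) (l := u - d * q) hr0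
      have e2 := card_chunk_le (d := d) (q := q) (l := v - d * q) hr0
      have := Nat.mul_le_mul_left d hq
      omega

theorem blockPair_pre_le {q r u v : ℕ} (hq : 0 < q) (i : Fin d) :
    (blockPair d q r u v).pre i ≤
      if (blockPair d q r u v).side i then q * d + r else r + q * d + r := by
  have h1 : ∀ w, (w % q + 1) * d ≤ q * d := fun w => Nat.mul_le_mul_right d (Nat.mod_lt w hq)
  have h2 : ∀ w, (q - w % q) * d ≤ q * d := fun w => Nat.mul_le_mul_right d (Nat.sub_le _ _)
  have h3 := chunkCut_le d r (u - d * q) i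
  have h4 := chunkCut_le d r (v - d * q) i
  have h5 := h1 u
  have h6 := h1 v
  have h7 := h2 u
  have h8 := h2 v
  unfold blockPair twoSides
  split_ifs <;> simp only [decide_eq_true_eq, ite_self, Bool.false_eq_true] at * <;>
    (try split_ifs at *) <;> omega

theorem nonempty_blockDesign {q r : ℕ} (hq : 2 ≤ q) (hr : r < d) (hd : 2 ≤ d) :
    Nonempty (Design d (d * q + r) d (d * q + r + d)) :=
  Design.nonempty_of_consistent (fun i => blockSeq d q r i)
    (fun _ β => if β then q * d + r else r + q * d + r) (blockPair d q r) (blockChecks d q r)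
    (fun _ _ _ _ i => blockPair_pre_le (by omega) i) (fun _ _ _ => card_blockPair hq hr)
    (fun _ => card_blockChecks hr) (fun _ _ h1 h2 _ => mem_reads_blockPair hq h1 h2)
    (blockSeq_consistent hd)

/-! ### The design for `k = d + r`, `2 ≤ r < d` -/

/-- Each of the first `d` vertices is encoded by one side. The digits of the others are also
divided into `2 d` chunks of `r` digits, which are encoded by the heads of the sides. -/
def headSeq (d r i : ℕ) (β : Bool) (p : ℕ) : ℕ :=
  if p < r then d * (2 * d) + (2 * prv d i + β.toNat) * r + p
  else if β then
    if p < r + 2 * d then i * (2 * d) + (p - r) else (d + i) * (2 * d) + (p - (r + 2 * d))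
  else (d + i) * (2 * d) + (p - r)

/-- Vertex `d + j` is on the lower side of dimension `j`. Its second copy, behind vertex `j` on the
upper side, serves only the pair of `j` and `d + j`, which would otherwise need both sides of one
dimension. -/
def headPair (d r u v : ℕ) : Table d :=
  if v < d then twoSides d u true (r + 2 * d) v true (r + 2 * d)
  else if u < d then
    if v - d = u then twoSides d u true (r + 2 * d + 2 * d) u true 0
    else twoSides d u true (r + 2 * d) (v - d) false (r + 2 * d)
  else twoSides d (u - d) false (r + 2 * d) (v - d) false (r + 2 * d)

/-- The two copies of vertex `d + j` lie on opposite sides of dimension `j`, so no table compares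
them directly. Each of their digits also occurs in the head of a side of another dimension, and both
copies are compared with all heads. For `i = j` the table reads a single side and is harmless. -/
def headChecks (d r : ℕ) : List (Table d) :=
  (List.range r).flatMap fun j => (List.range d).flatMap fun i => [false, true].flatMap fun β =>
    [twoSides d j true (r + 2 * d + 2 * d) i β r, twoSides d j false (r + 2 * d) i β r]

theorem mem_headChecks {r : ℕ} {τ : Table d} : τ ∈ headChecks d r ↔ ∃ j < r, ∃ i < d, ∃ β,
    τ = twoSides d j true (r + 2 * d + 2 * d) i β r ∨
      τ = twoSides d j false (r + 2 * d) i β r := by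
  simp only [headChecks, List.mem_flatMap, List.mem_range, List.mem_cons, List.not_mem_nil, or_false,
    exists_eq_or_imp, exists_eq_left, Bool.exists_bool]

/-- A chunk is not hosted by the dimension of the vertex whose digits it contains. -/
theorem head_ne {r i x : ℕ} (hr : 2 ≤ r) (hrd : r < d) (β : Bool) (hx : x < r) :
    ((2 * prv d i + β.toNat) * r + x) / (2 * d) ≠ i := by
  intro h
  have h1 := Nat.div_add_mod ((2 * prv d i + β.toNat) * r + x) (2 * d)
  have h2 := Nat.mod_lt ((2 * prv d i + β.toNat) * r + x) (show 0 < 2 * d by omega)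
  rw [h] at h1
  have hβ : β.toNat ≤ 1 := Bool.toNat_le β
  obtain rfl | hi := Nat.eq_zero_or_pos i
  -- Dimension `0` hosts the last chunks, which start at `(2 * d - 2) * r` or later, beyond the
  -- first `2 * d` digits; this needs `2 ≤ r`.
  · have := Nat.mul_le_mul (show 2 * d - 2 ≤ 2 * prv d 0 + β.toNat by
      simp only [prv, if_true]; omega) hr
    omega
  -- For `i > 0` the chunks end at `2 * i * r ≤ 2 * i * d`, before the digits of vertex `d + i`
  -- begin.
  · have e1 := Nat.mul_le_mul_right r (show 2 * prv d i + β.toNat + 1 ≤ 2 * i by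
      simp only [prv]; rw [if_neg (by omega)]; omega)
    have e2 := Nat.mul_le_mul_left (2 * i) hrd.le
    rw [add_mul] at e1
    have e3 : 2 * d * i = 2 * i * d := by ring
    omega

theorem prv_nxt {i : ℕ} : prv d (nxt d i) = i := by
  unfold nxt prv
  by_cases h : i + 1 = d
  · rw [if_pos h, if_pos rfl]; omega
  · rw [if_neg h, if_neg (by omega)]; omega

/-- Each digit is found in some head. -/
theorem exists_head {r p : ℕ} (hp : p < r * (2 * d)) :
    ∃ i < d, ∃ β : Bool, ∃ x < r, (2 * prv d i + β.toNat) * r + x = p := by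
  have hr : 0 < r := Nat.pos_of_ne_zero (by rintro rfl; simp at hp)
  have h1 : p / r < 2 * d := (Nat.div_lt_iff_lt_mul hr).2 (by rwa [mul_comm])
  refine ⟨nxt d (p / r / 2), nxt_lt (by omega), decide (p / r % 2 = 1), p % r, Nat.mod_lt _ hr, ?_⟩
  rw [prv_nxt]
  have h2 : 2 * (p / r / 2) + (decide (p / r % 2 = 1)).toNat = p / r := by
    rcases Nat.mod_two_eq_zero_or_one (p / r) with h | h <;> simp [h] <;> omega
  rw [h2, Nat.div_add_mod']

/-- `A₀` takes vertices below `d` from the upper sides and the others from the lower sides. The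
heads agree with it by comparison with the lower sides, and then the second copies on the upper
sides by comparison with the heads. -/
theorem headSeq_consistent {r : ℕ} (hr : 2 ≤ r) (hrd : r < d) (rw : Fin d → Bool → ℕ → ℕ)
    (h : ∀ τ ∈ headChecks d r, ∀ i, ∀ p < τ.pre i, ∀ i', ∀ p' < τ.pre i',
      headSeq d r i (τ.side i) p = headSeq d r i' (τ.side i') p' →
      rw i (τ.side i) p = rw i' (τ.side i') p') :
    ∃ A₀ : ℕ → ℕ, ∀ (i : Fin d) (β : Bool),
      ∀ p < r + (if β then 2 * d else 0) + (if (i : ℕ) < r then 2 * d else 0),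
        rw i β p = A₀ (headSeq d r i β p) := by
  have c1 : ∀ j i : Fin d, (j : ℕ) < r → i ≠ j → ∀ β, ∀ x < r + 2 * d + 2 * d, ∀ x' < r,
      headSeq d r j true x = headSeq d r i β x' → rw j true x = rw i β x' :=
    fun j i hj hij β x hx x' hx' e => eq_of_twoSides (seq := fun i => headSeq d r i)
      (h _ (mem_headChecks.2 ⟨j, hj, i, i.2, β, .inl rfl⟩)) hij hx hx' e
  have c2 : ∀ j i : Fin d, (j : ℕ) < r → i ≠ j → ∀ β, ∀ x < r + 2 * d, ∀ x' < r,
      headSeq d r j false x = headSeq d r i β x' → rw j false x = rw i β x' :=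
    fun j i hj hij β x hx x' hx' e => eq_of_twoSides (seq := fun i => headSeq d r i)
      (h _ (mem_headChecks.2 ⟨j, hj, i, i.2, β, .inr rfl⟩)) hij hx hx' e
  set rw' : ℕ → Bool → ℕ → ℕ := fun i β p => if hi : i < d then rw ⟨i, hi⟩ β p else 0 with hrw'
  have hval : ∀ (i : Fin d) β p, rw' i β p = rw i β p := fun i β p => by simp [hrw']
  set A₀ : ℕ → ℕ := fun δ => if δ / (2 * d) < d then rw' (δ / (2 * d)) true (r + δ % (2 * d)) else
    rw' (δ / (2 * d) - d) false (r + δ % (2 * d)) with hA₀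
  have hdiv : ∀ j x, x < 2 * d → (j * (2 * d) + x) / (2 * d) = j ∧ (j * (2 * d) + x) % (2 * d) = x := by
    intro j x hx
    rw [mul_comm, Nat.mul_add_div (by omega), Nat.mul_add_mod, Nat.div_eq_of_lt hx,
      Nat.mod_eq_of_lt hx]
    exact ⟨rfl, rfl⟩
  have a1 : ∀ j : Fin d, ∀ x < 2 * d, A₀ (j * (2 * d) + x) = rw j true (r + x) := by
    intro j x hx
    simp only [hA₀]
    rw [(hdiv j x hx).1, (hdiv j x hx).2, if_pos j.2, hval]
  have a2 : ∀ j : Fin d, ∀ x < 2 * d, A₀ ((d + j) * (2 * d) + x) = rw j false (r + x) := by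
    intro j x hx
    simp only [hA₀]
    rw [(hdiv _ x hx).1, (hdiv _ x hx).2, if_neg (by omega), Nat.add_sub_cancel_left, hval]
  have a3 : ∀ i : Fin d, ∀ β, ∀ x < r, rw i β x = A₀ (headSeq d r i β x) := by
    intro i β x hx
    have hne := head_ne (i := i) hr hrd β hx
    have hseq : headSeq d r i β x = d * (2 * d) + ((2 * prv d i + β.toNat) * r + x) := by
      rw [headSeq, if_pos hx, add_assoc]
    have hp : (2 * prv d i + β.toNat) * r + x < r * (2 * d) := by
      have hβ : β.toNat ≤ 1 := Bool.toNat_le β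
      have := prv_lt i.2
      have := Nat.mul_le_mul_right r (show 2 * prv d i + β.toNat + 1 ≤ 2 * d by omega)
      rw [add_mul, mul_comm (2 * d)] at this
      omega
    set p := (2 * prv d i + β.toNat) * r + x with hpdef
    have hl : p / (2 * d) < r := (Nat.div_lt_iff_lt_mul (by omega)).2 hp
    have hm : p % (2 * d) < 2 * d := Nat.mod_lt _ (by omega)
    have e1 : d * (2 * d) + p = (d + p / (2 * d)) * (2 * d) + p % (2 * d) := by
      have := Nat.div_add_mod' p (2 * d)
      rw [add_mul]; omega
    have e2 := a2 ⟨p / (2 * d), by omega⟩ _ hm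
    rw [hseq, e1, e2]
    refine (c2 ⟨p / (2 * d), by omega⟩ i hl (fun e => hne (congrArg Fin.val e).symm) β _ (by omega)
      x hx ?_).symm
    rw [hseq, e1, headSeq, if_neg (by omega)]
    simp
  refine ⟨A₀, fun i β p hp => ?_⟩
  by_cases hpr : p < r
  · exact a3 i β p hpr
  rw [headSeq, if_neg hpr]
  cases β with
  | false =>
    simp only [Bool.false_eq_true, if_false] at hp ⊢
    have hpd : p < r + 2 * d := by split_ifs at hp <;> omega
    rw [a2 i _ (by omega)]
    congr 1; omega
  | true =>
    simp only [if_true] at hp ⊢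
    by_cases h1 : p < r + 2 * d
    · rw [if_pos h1, a1 i _ (by omega)]
      congr 1; omega
    · have hir : (i : ℕ) < r := by by_contra hir; rw [if_neg hir] at hp; omega
      rw [if_pos hir] at hp
      obtain ⟨y, rfl⟩ : ∃ y, p = r + 2 * d + y := ⟨p - (r + 2 * d), by omega⟩
      obtain ⟨e, he, β, x, hx, hex⟩ := exists_head (r := r) (mul_add_lt_of_lt (d := 2 * d) hir
        (show y < 2 * d by omega))
      have hne := head_ne (i := e) hr hrd β hx
      rw [hex, (hdiv _ _ (by omega)).1] at hne
      have hseq : headSeq d r e β x = (d + i) * (2 * d) + y := by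
        rw [headSeq, if_pos hx, add_assoc, hex, add_mul, add_assoc]
      rw [if_neg h1, Nat.add_sub_cancel_left, ← hseq, ← a3 ⟨e, he⟩ β x hx]
      refine c1 i ⟨e, he⟩ hir (fun e => hne (congrArg Fin.val e).symm) β _ (by omega) x hx ?_
      rw [hseq, headSeq, if_neg (by omega), if_pos rfl, if_neg (by omega), Nat.add_sub_cancel_left]

theorem mem_reads_headPair {r u v : ℕ} (huv : u < v) (hv : v < d + r) (hrd : r < d) {x : ℕ}
    (hx : x < 2 * d) : u * (2 * d) + x ∈ (headPair d r u v).reads (fun i => headSeq d r i) ∧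
      v * (2 * d) + x ∈ (headPair d r u v).reads (fun i => headSeq d r i) := by
  have ht : ∀ w, headSeq d r w true (r + x) = w * (2 * d) + x := by
    intro w; rw [headSeq, if_neg (by omega), if_pos rfl, if_pos (by omega), Nat.add_sub_cancel_left]
  have hf : ∀ w, d ≤ w → headSeq d r (w - d) false (r + x) = w * (2 * d) + x := by
    intro w hw
    rw [headSeq, if_neg (by omega), if_neg (by simp), Nat.add_sub_cancel_left, Nat.add_sub_cancel' hw]
  have hm : ∀ w, d ≤ w → headSeq d r (w - d) true (r + 2 * d + x) = w * (2 * d) + x := by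
    intro w hw
    rw [headSeq, if_neg (by omega), if_pos rfl, if_neg (by omega), Nat.add_sub_cancel_left,
      Nat.add_sub_cancel' hw]
  unfold headPair
  split_ifs with h1 h2 h3 <;> simp only [mem_reads_twoSides]
  · exact ⟨.inl ⟨by omega, r + x, by omega, ht u⟩, .inr ⟨by omega, h1, r + x, by omega, ht v⟩⟩
  · refine ⟨.inl ⟨by omega, r + x, by omega, ht u⟩, .inl ⟨by omega, r + 2 * d + x, by omega, ?_⟩⟩
    rw [← hm v (by omega), h3]
  · exact ⟨.inl ⟨by omega, r + x, by omega, ht u⟩,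
      .inr ⟨by omega, by omega, r + x, by omega, hf v (by omega)⟩⟩
  · exact ⟨.inl ⟨by omega, r + x, by omega, hf u (by omega)⟩,
      .inr ⟨by omega, by omega, r + x, by omega, hf v (by omega)⟩⟩

theorem card_headPair {r u v : ℕ} :
    ((headPair d r u v).reads fun i => headSeq d r i).card ≤ 2 * (d + r + d) := by
  unfold headPair
  split_ifs <;> refine (card_reads_twoSides_le _ _ _ _ _ _ _).trans ?_ <;> omega

theorem card_headChecks {r : ℕ} {τ : Table d} (hτ : τ ∈ headChecks d r) :
    (τ.reads fun i => headSeq d r i).card ≤ 2 * (d + r + d) := by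
  obtain ⟨j, -, i, -, β, rfl | rfl⟩ := mem_headChecks.1 hτ <;>
    refine (card_reads_twoSides_le _ _ _ _ _ _ _).trans ?_ <;> omega

theorem twoSides_pre_le {len : Fin d → Bool → ℕ} {i i' p p' : ℕ} {β β' : Bool} {e : Fin d}
    (h : (e : ℕ) = i → p ≤ len e β) (h' : (e : ℕ) = i' → p' ≤ len e β') :
    (twoSides d i β p i' β' p').pre e ≤ len e ((twoSides d i β p i' β' p').side e) := by
  simp only [twoSides]
  split_ifs with h1 h2
  · exact h h1
  · exact h' h2
  · exact Nat.zero_le _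

theorem headPair_pre_le {r u v : ℕ} (hv : v < d + r) (huv : u < v) (i : Fin d) :
    (headPair d r u v).pre i ≤ r + (if (headPair d r u v).side i then 2 * d else 0) +
      (if (i : ℕ) < r then 2 * d else 0) := by
  obtain ⟨len, hlen⟩ : ∃ len : Fin d → Bool → ℕ, ∀ e β,
      len e β = r + (if β then 2 * d else 0) + (if (e : ℕ) < r then 2 * d else 0) :=
    ⟨_, fun _ _ => rfl⟩
  rw [← hlen]
  unfold headPair
  split_ifs <;> refine twoSides_pre_le (fun h => ?_) (fun h => ?_) <;> rw [hlen] <;>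
    simp only [if_true, Bool.false_eq_true, if_false] <;> (try rw [if_pos (by omega)]) <;> omega

theorem nonempty_headDesign {r : ℕ} (hr : 2 ≤ r) (hrd : r < d) :
    Nonempty (Design d (d + r) (2 * d) (2 * (d + r + d))) :=
  Design.nonempty_of_consistent (fun i => headSeq d r i)
    (fun i β => r + (if β then 2 * d else 0) + (if (i : ℕ) < r then 2 * d else 0)) (headPair d r)
    (headChecks d r) (fun _ _ h1 h2 i => headPair_pre_le h2 h1 i) (fun _ _ _ _ => card_headPair)
    (fun _ => card_headChecks) (fun _ _ h1 h2 _ => mem_reads_headPair h1 h2 hrd)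
    (headSeq_consistent hr hrd)

/-! ### The reduction -/

/-- With `a = b - 1`, minimality gives `a ^ D ≤ n`, and `b ≥ 2` gives `b ≤ 2 * a`; so rounding up
the root of `n` costs only a constant factor in `b ^ U`. -/
theorem exists_base {n : ℕ} (hn : 2 ≤ n) (hD : 0 < D) :
    ∃ b : ℕ, 0 < b ∧ b ≤ n ∧ n ≤ b ^ D ∧ (∀ b' < b, b' ^ D < n) ∧
      ∃ a : ℕ, a ^ D ≤ n ∧ b ≤ 2 * a := by
  classical
  have hex : ∃ b, n ≤ b ^ D := ⟨n, Nat.le_self_pow (by omega) n⟩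
  have hleast : ∀ b' < Nat.find hex, b' ^ D < n := fun b' hb' => not_le.1 (Nat.find_min hex hb')
  have hfind := Nat.find_spec hex
  have h2 : 2 ≤ Nat.find hex := by
    by_contra! h
    have := Nat.pow_le_pow_left (show Nat.find hex ≤ 1 by omega) D
    rw [one_pow] at this
    omega
  exact ⟨Nat.find hex, by omega, Nat.find_min' hex (Nat.le_self_pow (by omega) n), hfind, hleast,
    Nat.find hex - 1, (hleast _ (by omega)).le, by omega⟩

theorem pow_le_rpow {a n : ℕ} (hd : 0 < d) (hU : U * d = (k + d) * D)
    (ha : a ^ D ≤ n) : (a : ℝ) ^ U ≤ (n : ℝ) ^ ((k : ℝ) / d + 1) := by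
  have hβ : (U : ℝ) = D * ((k : ℝ) / d + 1) := by
    have : (U : ℝ) * d = (k + d) * D := by exact_mod_cast hU
    field_simp
    linarith
  have ha' : (a : ℝ) ^ D ≤ n := by exact_mod_cast ha
  rw [← Real.rpow_natCast, hβ, Real.rpow_mul (by positivity), Real.rpow_natCast]
  exact Real.rpow_le_rpow (by positivity) ha' (by positivity)

/-- With `β = k / d + 1` there are `O(n ^ β)` points. `hkε` yields `β * (d - ε) ≤ k - ε` for the
rectangle program; `hε` then yields `2 ≤ β ≤ k - ε`, which covers the writing of the points and the
pass over the `n * n` matrix entries. -/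
theorem solvable_clique_of_design (Δ : Design d k D U) (hd : 0 < d) (hk : 2 ≤ k) (hD : 0 < D)
    (hdk : d ≤ k) (hU : U * d = (k + d) * D) {ε : ℝ} (hε : 1 ≤ d - ε) (hkε : (d : ℝ) ^ 2 ≤ k * ε)
    (h : SolvableInTime (maxWeightRectangle d) (fun N => (N : ℝ) ^ ((d : ℝ) - ε))) :
    SolvableInTime (maxWeightClique k) (fun n => (n : ℝ) ^ ((k : ℝ) - ε)) := by
  obtain ⟨p, c, C, h⟩ := h
  obtain ⟨q, K, hq⟩ := Δ.exists_prog hk hD p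
  -- The summand with `c` makes room for the words of the rectangle program, since the number of
  -- points plus `2` is at most `(n + 2) ^ (K + U + 1)`; the other summand for the words of the
  -- reduction. The sign of `C` is not known, hence `|C|`.
  refine ⟨q, (K + U + 1) * c + (K + U + D + 3), K * (2 + 2 ^ U) + |C| * ((K : ℝ) * 2 ^ U) ^ ((d : ℝ) - ε),
    fun G => ?_⟩
  have hn : 2 ≤ G.n := hk.trans G.le
  obtain ⟨b, hb, hbn, hnb, hleast, a, ha, hba⟩ := exists_base hn hD
  obtain ⟨l, hl, hlK, hq⟩ := hq G b hb hnb hleast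
  obtain ⟨t, s, hexec, ht, hs⟩ := h (toInstance l hl)
  have hsize : (maxWeightRectangle d).size (toInstance l hl) = l.length := rfl
  have hsize' : (maxWeightClique k).size G = G.n := rfl
  rw [hsize] at hexec ht
  rw [hsize']
  have hK : K ≤ (G.n + 2) ^ K := Nat.lt_two_pow_self.le.trans (Nat.pow_le_pow_left (by omega) K)
  have hbU : b ^ U ≤ (G.n + 2) ^ U := Nat.pow_le_pow_left (by omega) U
  have hKU : K * b ^ U ≤ (G.n + 2) ^ (K + U) := by
    rw [pow_add]; exact Nat.mul_le_mul hK hbU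
  have hword : ∀ e x, e < K + U + D + 3 → x ≤ (G.n + 2) ^ e →
      x < (G.n + 2) ^ ((K + U + 1) * c + (K + U + D + 3)) := fun e x he hx =>
    hx.trans_lt (Nat.pow_lt_pow_right (by omega) (by omega))
  have hN : (l.length + 2) ^ c ≤ (G.n + 2) ^ ((K + U + 1) * c + (K + U + D + 3)) := by
    refine le_trans ?_ (Nat.pow_le_pow_right (by omega) (Nat.le_add_right _ _))
    rw [pow_mul]
    refine Nat.pow_le_pow_left ?_ c
    rw [pow_succ]
    have h1 : 1 ≤ (G.n + 2) ^ (K + U) := Nat.one_le_pow _ _ (by omega)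
    have h2 := Nat.mul_le_mul_left ((G.n + 2) ^ (K + U)) (show 4 ≤ G.n + 2 by omega)
    omega
  obtain ⟨t', s', hexec', ht', hs'⟩ := hq _
    (hword D _ (by omega) (Nat.pow_le_pow_left (by omega) D)) (hword U _ (by omega) hbU)
    (hword 2 _ (by omega) (by rw [sq]; exact Nat.mul_le_mul (by omega) (by omega)))
    (hword (K + U) _ (by omega) hKU) t s (hexec.mono hN) hs
  refine ⟨t', s', hexec', ?_, hs'⟩
  set n := G.n with hndef
  have hn1 : (1 : ℝ) ≤ n := by exact_mod_cast (by omega : 1 ≤ n)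
  have hd' : (0 : ℝ) < d := by exact_mod_cast hd
  set β : ℝ := (k : ℝ) / d + 1 with hβ
  have hβ2 : 2 ≤ β := by
    have : 1 ≤ (k : ℝ) / d := by rw [le_div_iff₀ hd', one_mul]; exact_mod_cast hdk
    linarith
  have hβα : β * (d - ε) ≤ k - ε := by
    have h1 : (d : ℝ) ≤ k * ε / d := by rw [le_div_iff₀ hd', ← sq]; exact hkε
    have h2 : β * (d - ε) = k + d - k * ε / d - ε := by rw [hβ]; field_simp; ring
    linarith
  have hβγ : β ≤ k - ε := by nlinarith
  have hpow : ∀ e : ℝ, e ≤ k - ε → (n : ℝ) ^ e ≤ (n : ℝ) ^ ((k : ℝ) - ε) := fun e he =>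
    Real.rpow_le_rpow_of_exponent_le hn1 he
  have hbUR : (b : ℝ) ^ U ≤ 2 ^ U * (n : ℝ) ^ β := by
    have h1 : (b : ℝ) ^ U ≤ (2 * a) ^ U := by
      have : (b : ℝ) ≤ 2 * a := by exact_mod_cast hba
      gcongr
    rw [mul_pow] at h1
    exact h1.trans (mul_le_mul_of_nonneg_left (pow_le_rpow hd hU ha) (by positivity))
  have e1 : (b : ℝ) ≤ (n : ℝ) ^ ((k : ℝ) - ε) := by
    have h1 : (b : ℝ) ≤ n := by exact_mod_cast hbn
    have h2 := hpow 1 (by linarith)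
    rw [Real.rpow_one] at h2
    exact h1.trans h2
  have e2 : (n : ℝ) * n ≤ (n : ℝ) ^ ((k : ℝ) - ε) := by
    have h2 := hpow (2 : ℕ) (by push_cast; linarith)
    rwa [Real.rpow_natCast, sq] at h2
  have e3 : (b : ℝ) ^ U ≤ 2 ^ U * (n : ℝ) ^ ((k : ℝ) - ε) :=
    hbUR.trans (mul_le_mul_of_nonneg_left (hpow β hβγ) (by positivity))
  have e4 : (t : ℝ) ≤ |C| * ((K : ℝ) * 2 ^ U) ^ ((d : ℝ) - ε) * (n : ℝ) ^ ((k : ℝ) - ε) := by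
    have h1 : (l.length : ℝ) ≤ (K : ℝ) * 2 ^ U * (n : ℝ) ^ β := by
      have : (l.length : ℝ) ≤ K * (b : ℝ) ^ U := by exact_mod_cast hlK
      refine this.trans ?_
      rw [mul_assoc]
      exact mul_le_mul_of_nonneg_left hbUR (by positivity)
    have h2 : (l.length : ℝ) ^ ((d : ℝ) - ε) ≤
        ((K : ℝ) * 2 ^ U) ^ ((d : ℝ) - ε) * (n : ℝ) ^ ((k : ℝ) - ε) := by
      refine (Real.rpow_le_rpow (by positivity) h1 (by linarith)).trans ?_
      rw [Real.mul_rpow (by positivity) (by positivity), ← Real.rpow_mul (by positivity)]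
      exact mul_le_mul_of_nonneg_left (hpow _ hβα) (by positivity)
    refine ht.trans ?_
    rw [mul_assoc]
    exact mul_le_mul (le_abs_self C) h2 (by positivity) (abs_nonneg C)
  have e5 : (t' : ℝ) ≤ K * (b + n * n + (b : ℝ) ^ U) + t := by exact_mod_cast ht'
  have e6 : (K : ℝ) * (b + n * n + (b : ℝ) ^ U) ≤
      K * ((2 + 2 ^ U) * (n : ℝ) ^ ((k : ℝ) - ε)) :=
    mul_le_mul_of_nonneg_left (by linarith) (Nat.cast_nonneg K)
  calc (t' : ℝ) ≤ _ := e5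
    _ ≤ K * ((2 + 2 ^ U) * (n : ℝ) ^ ((k : ℝ) - ε)) +
        |C| * ((K : ℝ) * 2 ^ U) ^ ((d : ℝ) - ε) * (n : ℝ) ^ ((k : ℝ) - ε) := add_le_add e6 e4
    _ = _ := by ring

end CliqueToRectangle

/-! ### The main theorem. -/

theorem mainTheorem1 (d : ℕ) (hd : 2 ≤ d) (ε : ℝ) (hε : 0 < ε)
    (h : RealRAM.SolvableInTime (maxWeightRectangle d) (fun N => (N : ℝ) ^ ((d : ℝ) - ε))) :
    RealRAM.SolvableInTime (maxWeightClique ⌈(d : ℝ) ^ 2 / ε⌉₊)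
      (fun n => (n : ℝ) ^ ((⌈(d : ℝ) ^ 2 / ε⌉₊ : ℝ) - ε)) := by
  have hα : 1 ≤ (d : ℝ) - ε := RealRAM.one_le_of_solvable_maxWeightRectangle (by omega) h
  have hkε : (d : ℝ) ^ 2 ≤ ⌈(d : ℝ) ^ 2 / ε⌉₊ * ε := (div_le_iff₀ hε).1 (Nat.le_ceil _)
  -- From here on `d ^ 2 ≤ k * ε` is all that is used about `k`.
  generalize ⌈(d : ℝ) ^ 2 / ε⌉₊ = k at hkε ⊢
  -- If `k ≤ d + 1`, then `k * ε ≤ (d + 1) * (d - 1) < d ^ 2`, since `ε ≤ d - 1`.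
  have hk : d + 2 ≤ k := by
    by_contra! hlt
    have hk' : (k : ℝ) ≤ d + 1 := by exact_mod_cast (by omega : k ≤ d + 1)
    have hk0 : (0 : ℝ) ≤ k := Nat.cast_nonneg k
    have hd' : (2 : ℝ) ≤ d := by exact_mod_cast hd
    nlinarith
  by_cases hkd : 2 * d ≤ k
  · obtain ⟨Δ⟩ := CliqueToRectangle.nonempty_blockDesign (d := d) (q := k / d) (r := k % d)
      ((Nat.le_div_iff_mul_le (by omega)).2 hkd) (Nat.mod_lt _ (by omega)) hd
    rw [Nat.div_add_mod] at Δ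
    exact CliqueToRectangle.solvable_clique_of_design Δ (by omega) (by omega) (by omega) (by omega)
      rfl hα hkε h
  · obtain ⟨r, rfl⟩ : ∃ r, k = d + r := ⟨k - d, by omega⟩
    obtain ⟨Δ⟩ := CliqueToRectangle.nonempty_headDesign (d := d) (r := r) (by omega) (by omega)
    exact CliqueToRectangle.solvable_clique_of_design Δ (by omega) (by omega) (by omega) (by omega)
      (by ring) hα hkε h
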